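/- **Diagrams.** A *capacity* is an integer $a\ge 1$; an object is a finite list $[a_1,\dots,a_n]$ of capacities, the tensor product of objects is concatenation, and the unit is the empty list $[\,]$. The $\mathrm{ZW}_f$-diagrams are the formal sequential composites ($\circ$) and parallel composites ($\otimes$) of: identities; swaps $[a,b]\to[b,a]$; cups $[a,a]\to[\,]$ and caps $[\,]\to[a,a]$; Z-spiders $Z_a^{n,m}(r):[a^n]\to[a^m]$ ($n,m\ge 0$, $r\in\mathbb C$, where $a^n$ denotes $n$ copies of $a$); W-nodes $W^{c}_{b_1,\dots,b_n}:[c]\to[b_1,\dots,b_n]$ ($n\ge 0$, all $b_i\le c$); states $|1\rangle_a:[\,]\to[a]$; global scalars $r:[\,]\to[\,]$ ($r\in\mathbb C$). The upside-down W-node $\overline W^{c}_{b_1,\dots,b_n}:[b_1,\dots,b_n]\to[c]$ is obtained by bending all the legs of a W-node with caps and cups. For $2\le k\le a$ put $|k\rangle_a:=\overline W^{a}_{k-1,1}\circ(|k-1\rangle_{k-1}\otimes|1\rangle_1)$. **Structural equations**, always available: the axioms of strict symmetric compact closed categories (with the swaps, cups and caps as structure); the legs of a Z-spider may be permuted, and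 bent from input to output; the outputs of a W-node may be permuted. **The equational theory $\mathrm{ZW}_f$** consists of the following twelve equation schemas, for all values of the parameters for which both sides are defined. Diagrams are composed from right to left, and permutations of wires are not written. * $(s)$ Two Z-spiders of capacity $a$ with parameters $r$ and $t$, joined by exactly one wire, are equal to one Z-spider with parameter $rt$ having all the remaining legs. * $(a)$ $(\mathrm{id}\otimes W^b_{a_1,\dots,a_n}\otimes\mathrm{id})\circ W^c_{\vec d,b,\vec d'}=W^c_{\vec d,a_1,\dots,a_n,\vec d'}$ if $b=c$ or $b\ge\sum_i a_i$. * $(o)$ $W^b_{a_1,\dots,a_n}\circ W^c_{b}=\big(\mathrm{id}\otimes (Z_b^{1,0}(1)\circ\overline W^b_{a_1,\dots,a_n})\big)\circ\big(\bigotimes_i Z_{a_i}^{1,2}(1)\big)\circ W^c_{a_1,\dots,a_n}$ if all $a_i\le b\le c$; here the first output of each Z-spider is an output of the diagram, and the second one goes into $\overline W^b$. * $(id)$ $W^a_a=\mathrm{id}_{[a]}$. * $(b_1)$ $W^b_{a_1,\dots,a_m}\circ Z_b^{n,1}(r)=\big(\bigotimes_j Z_{a_j}^{n,1}(r)\big)\circ\big(W^b_{a_1,\dots,a_m}\big)^{\otimes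 n}$ for $n\neq0$, the $j$-th output of each W-node going into the $j$-th Z-spider. * $(b_2)$ $W^c_{b_1,\dots,b_m}\circ\overline W^c_{a_1,\dots,a_n}=\big(\bigotimes_j\overline W^{b_j}_{\ell_{1j},\dots,\ell_{nj}}\big)\circ\big(\bigotimes_i W^{a_i}_{\ell_{i1},\dots,\ell_{im}}\big)$ with $\ell_{ij}=\min(a_i,b_j)$, if $c\ge\min(\sum_i a_i,\sum_j b_j)$, the $j$-th output of the $i$-th W-node going into the $i$-th input of the $j$-th upside-down W-node. * $(+)$ $(Z_a^{1,0}(r)\otimes Z_a^{1,0}(t))\circ W^a_{a,a}=Z_a^{1,0}(r+t)$. * $(cp)$ $Z_a^{1,n}(r)\circ|1\rangle_a=r\otimes|1\rangle_a^{\otimes n}$. * $(h)$ $\overline W^a_{b,\dots,b}\circ Z_b^{1,n}(1)=W^b_{\varnothing}\otimes Z_a^{0,1}(0)$ if $b\le a$ and $n>a$, where $W^b_\varnothing:[b]\to[\,]$ is the W-node without outputs. * $(\ell)$ $\mathrm{cup}_1\circ Z_1^{n,2}(1)=Z_1^{n,0}(1)$. * $(i)$ $\overline W^a_b\circ|1\rangle_b=|1\rangle_a$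 for $b\le a$. * $(u)$ $Z_a^{0,1}(1)=\frac1{a!}\otimes\big((\mathrm{id}_{[a]}\otimes(\mathrm{cup}_a\circ Z_a^{1,2}(1)))\circ W^a_{a,a}\circ|a\rangle_a\big)$. An equation is *derivable* from a set of schemas if it follows from the structural equations and the instances of these schemas by reflexivity, symmetry, transitivity and replacement inside sequential and parallel composites. **Theorem.** The equational theory $\mathrm{ZW}_f$ is minimal: for each of the twelve schemas, at least one of its instances is not derivable from the other eleven schemas. -/

import Mathlib

namespace ZWf

/-! ### Diagrams

Wires carry a capacity `a ≥ 1` (the wire of capacity `a` stands for `ℂ^(a+1)`); an object is a list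
of capacities, the tensor product of objects is concatenation and the unit is `[]`. -/

/-- `Diagram A B`: the formal mixed-dimensional ZW-diagrams from `A` to `B`.  Sequential composition
is written in diagrammatic order (`comp f g` is `f` followed by `g`) and carries a proof that the
intermediate lists of capacities agree. -/
inductive Diagram : List ℕ+ → List ℕ+ → Type
  /-- parallel identity wires; `id []` is the empty diagram -/
  | id (A : List ℕ+) : Diagram A A
  | comp {A B B' C : List ℕ+} (f : Diagram A B) (g : Diagram B' C) (h : B = B') : Diagram A C
  | tensor {A B C D : List ℕ+} (f : Diagram A B) (g : Diagram C D) : Diagram (A ++ C) (B ++ D)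
  | swap (a b : ℕ+) : Diagram [a, b] [b, a]
  | cup (a : ℕ+) : Diagram [a, a] []
  | cap (a : ℕ+) : Diagram [] [a, a]
  /-- the Z-spider of capacity `a` and parameter `r`, with `n` inputs and `m` outputs -/
  | Z (a : ℕ+) (r : ℂ) (n m : ℕ) : Diagram (List.replicate n a) (List.replicate m a)
  /-- the W-node with input capacity `a` and output capacities `bs`, all at most `a` -/
  | W (a : ℕ+) (bs : List ℕ+) (h : ∀ b ∈ bs, b ≤ a) : Diagram [a] bs
  /-- the state `|1⟩` of capacity `a` -/
  | one (a : ℕ+) : Diagram [] [a]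
  /-- global scalars -/
  | scalar (r : ℂ) : Diagram [] []

namespace Diagram

/-- Identity wires between two provably equal lists of capacities. -/
def ofEq {A B : List ℕ+} (h : A = B) : Diagram A B := comp (id A) (id B) h

/-- The wire `a` crosses all the wires of `B`, from left to right. -/
def slide (a : ℕ+) : (B : List ℕ+) → Diagram (a :: B) (B ++ [a])
  | [] => id [a]
  | b :: B => comp (tensor (swap a b) (id B) :) (tensor (id [b]) (slide a B) :) rfl

/-- The symmetry exchanging two bundles of wires. -/
def braid : (A B : List ℕ+) → Diagram (A ++ B) (B ++ A)
  | [], B => ofEq (by simp)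
  | a :: A, B =>
      comp (comp (tensor (id [a]) (braid A B) :) (tensor (slide a B) (id A) :) rfl)
        (ofEq (by simp : B ++ [a] ++ A = B ++ a :: A)) rfl

/-- Nested cups, joining the `i`-th wire from the left with the `i`-th wire from the right. -/
def cups : (A : List ℕ+) → Diagram (A ++ A.reverse) []
  | [] => id []
  | a :: A =>
      comp (comp (ofEq (by simp : a :: A ++ (a :: A).reverse = [a] ++ (A ++ A.reverse ++ [a])))
          (tensor (id [a]) (tensor (cups A) (id [a]))) rfl)
        (cup a) rfl

/-- The upside-down W-node, obtained by bending all the legs of a W-node. -/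
def coW (a : ℕ+) (bs : List ℕ+) (h : ∀ b ∈ bs, b ≤ a) : Diagram bs [a] :=
  comp (comp (comp (ofEq (by simp : bs = bs ++ [])) (tensor (id bs) (cap a)) rfl)
      (tensor (id bs) (tensor (W a bs.reverse (by simpa using h)) (id [a]))) rfl)
    (tensor (cups bs) (id [a])) (by simp)

/-- `ket k a _` is the state `|k+1⟩` of capacity `a` (up to normalisation): `|1⟩` is a generator, and
`|k+2⟩` of capacity `a` merges `|k+1⟩` of capacity `k+1` with `|1⟩` of capacity `1`. -/
def ket : (k : ℕ) → (a : ℕ+) → k + 1 ≤ (a : ℕ) → Diagram [] [a]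
  | 0, a, _ => one a
  | k + 1, a, h =>
      comp (tensor (ket k k.succPNat (le_refl _)) (one 1))
        (coW a [k.succPNat, 1] (by
          intro b hb
          rcases List.mem_cons.mp hb with rfl | hb
          · exact PNat.coe_le_coe _ _ |>.mp (by simpa using Nat.le_of_succ_le h)
          · rw [List.mem_singleton.mp hb]; exact one_le (a := a))) rfl

/-- The diagrams `f x`, for `x` in the list `l`, side by side. -/
def par {α : Type} (dom cod : α → List ℕ+) (f : (x : α) → Diagram (dom x) (cod x)) :
    (l : List α) → Diagram (l.flatMap dom) (l.flatMap cod)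
  | [] => id []
  | x :: l => tensor (f x) (par dom cod f l)

/-- Permutation of wires inserting the `j`-th wire of the first bundle in front of the `j`-th block
of the second. -/
def interleave {β : Type} (g : β → ℕ+) (k : β → List ℕ+) :
    (J : List β) → Diagram (J.map g ++ J.flatMap k) (J.flatMap fun j => g j :: k j)
  | [] => id []
  | j :: J =>
      comp (comp (ofEq (by simp : (j :: J).map g ++ (j :: J).flatMap k
            = [g j] ++ ((J.map g ++ k j) ++ J.flatMap k)))
          (tensor (id [g j]) (tensor (braid (J.map g) (k j)) (id (J.flatMap k)))) rfl)
        (tensor (id (g j :: k j)) (interleave g k J)) (by simp)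

/-- Permutation of wires sending a family of wires indexed by pairs `(i, j)` and ordered by `i`
first to the same family ordered by `j` first. -/
def transpose {α β : Type} (f : α → β → ℕ+) (J : List β) :
    (I : List α) → Diagram (I.flatMap fun i => J.map (f i)) (J.flatMap fun j => I.map fun i => f i j)
  | [] => ofEq (by simp)
  | i :: I =>
      comp (tensor (id (J.map (f i))) (transpose f J I))
        (interleave (f i) (fun j => I.map fun i => f i j) J) rfl

end Diagram

open Diagram

/-! ### The structural equations -/

/-- The equations that hold in every equational theory considered: the axioms of (strict) symmetric
compact closed categories, the flexsymmetry of Z-spiders and the cocommutativity of W-nodes.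
The relation is between diagrams whose types are only propositionally equal, so that the strictness
of the tensor product needs no casts. -/
inductive Structural : {A B A' B' : List ℕ+} → Diagram A B → Diagram A' B' → Prop
  | comp_assoc {A B B' C C' D : List ℕ+} (f : Diagram A B) (g : Diagram B' C) (k : Diagram C' D)
      (h : B = B') (h' : C = C') :
      Structural (comp (comp f g h) k h') (comp f (comp g k h') h)
  | id_comp {A A' B : List ℕ+} (f : Diagram A' B) (h : A = A') : Structural (comp (id A) f h) f
  | comp_id {A B B' : List ℕ+} (f : Diagram A B) (h : B = B') : Structural (comp f (id B') h) f
  | tensor_assoc {A B A' B' A'' B'' : List ℕ+} (f : Diagram A B) (g : Diagram A' B')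
      (k : Diagram A'' B'') :
      Structural (tensor (tensor f g) k) (tensor f (tensor g k))
  | empty_tensor {A B : List ℕ+} (f : Diagram A B) : Structural (tensor (id []) f) f
  | tensor_empty {A B : List ℕ+} (f : Diagram A B) : Structural (tensor f (id [])) f
  | id_tensor_id (A B : List ℕ+) : Structural (tensor (id A) (id B)) (id (A ++ B))
  | interchange {A B B' C D E E' F : List ℕ+} (f : Diagram A B) (g : Diagram B' C)
      (f' : Diagram D E) (g' : Diagram E' F) (h : B = B') (h' : E = E') :
      Structural (comp (tensor f f') (tensor g g') (by rw [h, h']))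
        (tensor (comp f g h) (comp f' g' h'))
  | swap_swap (a b : ℕ+) : Structural (comp (swap a b) (swap b a) rfl) (id [a, b])
  | braid_natural {A B C D : List ℕ+} (f : Diagram A B) (g : Diagram C D) :
      Structural (comp (tensor f g) (braid B D) rfl) (comp (braid A C) (tensor g f) rfl)
  | cap_swap (a : ℕ+) : Structural (comp (cap a) (swap a a) rfl) (cap a)
  | snake_left (a : ℕ+) :
      Structural (comp (tensor (cap a) (id [a])) (tensor (id [a]) (cup a)) rfl) (id [a])
  | snake_right (a : ℕ+) :
      Structural (comp (tensor (id [a]) (cap a)) (tensor (cup a) (id [a])) rfl) (id [a])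
  /-- two adjacent outputs of a Z-spider may be exchanged -/
  | Z_swap_outputs (a : ℕ+) (r : ℂ) (n k l : ℕ) :
      Structural
        (comp (Z a r n (k + (2 + l)))
          (tensor (id (List.replicate k a)) (tensor (swap a a) (id (List.replicate l a))))
          (by simp [← List.replicate_append_replicate, List.replicate_succ]))
        (Z a r n (k + (2 + l)))
  /-- two adjacent inputs of a Z-spider may be exchanged -/
  | Z_swap_inputs (a : ℕ+) (r : ℂ) (m k l : ℕ) :
      Structural
        (comp (tensor (id (List.replicate k a)) (tensor (swap a a) (id (List.replicate l a))))
          (Z a r (k + (2 + l)) m)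
          (by simp [← List.replicate_append_replicate, List.replicate_succ]))
        (Z a r (k + (2 + l)) m)
  /-- an input of a Z-spider may be bent into an output -/
  | Z_bend (a : ℕ+) (r : ℂ) (n m : ℕ) :
      Structural
        (comp (tensor (cap a) (id (List.replicate n a))) (tensor (id [a]) (Z a r (n + 1) m)) rfl)
        (Z a r n (m + 1))
  /-- two adjacent outputs of a W-node may be exchanged -/
  | W_swap_outputs (a : ℕ+) (bs : List ℕ+) (b b' : ℕ+) (bs' : List ℕ+)
      (h : ∀ x ∈ bs ++ ([b, b'] ++ bs'), x ≤ a) (h' : ∀ x ∈ bs ++ ([b', b] ++ bs'), x ≤ a) :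
      Structural
        (comp (W a (bs ++ ([b, b'] ++ bs')) h) (tensor (id bs) (tensor (swap b b') (id bs'))) rfl)
        (W a (bs ++ ([b', b] ++ bs')) h')

/-! ### The equations of the theory -/

/-- The names of the twelve equations (equation schemas). -/
inductive Rule
  /-- `(s)` -/
  | s
  /-- `(a)` -/
  | a
  /-- `(o)` -/
  | o
  /-- `(id)` -/
  | id
  /-- `(b₁)` -/
  | b1
  /-- `(b₂)` -/
  | b2
  /-- `(+)` -/
  | plus
  /-- `(cp)` -/
  | cp
  /-- `(h)` -/
  | h
  /-- `(ℓ)` -/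
  | l
  /-- `(i)` -/
  | i
  /-- `(u)` -/
  | u

/-- `Instance R D₁ D₂`: the equation `D₁ = D₂` is an instance of the schema `R`. -/
inductive Instance : Rule → {A B A' B' : List ℕ+} → Diagram A B → Diagram A' B' → Prop
  /-- two Z-spiders joined by a wire merge, and their parameters are multiplied -/
  | s (a : ℕ+) (r t : ℂ) (n m n' m' : ℕ) :
      Instance .s
        (comp (tensor (Z a r n (m + 1)) (id (List.replicate n' a)))
          (tensor (id (List.replicate m a)) (Z a t (1 + n') m'))
          (by simp [← List.replicate_append_replicate]))
        (Z a (r * t) (n + n') (m + m'))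
  /-- a W-node on an output of capacity `b` of another one merges with it, provided that the
  capacity `b` does not restrict the flow: `b = c` or `b ≥ ∑ aᵢ` -/
  | a (c b : ℕ+) (as ds ds' : List ℕ+) (hc : ∀ x ∈ ds ++ ([b] ++ ds'), x ≤ c)
      (hb : ∀ x ∈ as, x ≤ b) (hcap : b = c ∨ (as.map PNat.val).sum ≤ b)
      (hc' : ∀ x ∈ ds ++ (as ++ ds'), x ≤ c) :
      Instance .a
        (comp (W c (ds ++ ([b] ++ ds')) hc) (tensor (id ds) (tensor (W b as hb) (id ds'))) rfl)
        (W c (ds ++ (as ++ ds')) hc')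
  /-- a `1 → 1` W-node `c → b` followed by a W-node `b → (a₁, …, aₙ)` is a W-node
  `c → (a₁, …, aₙ)` whose outputs are copied by Z-spiders, the copies being merged into a wire of
  capacity `b` which is then erased by a Z-spider -/
  | o (c b : ℕ+) (as : List ℕ+) (hbc : ∀ x ∈ [b], x ≤ c) (hab : ∀ x ∈ as, x ≤ b)
      (hac : ∀ x ∈ as, x ≤ c) :
      Instance .o
        (comp (W c [b] hbc) (W b as hab) rfl)
        (comp (comp (comp (comp (W c as hac)
                (par (fun x => [x]) (fun x => [x, x]) (fun x => Z x 1 1 2) as) (by simp))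
              (transpose (fun x _ => x) (List.range 2) as) (by simp [List.range_succ]))
            (tensor (id as) (coW b as hab)) (by simp [List.range_succ]))
          (tensor (id as) (Z b 1 1 0)) rfl)
  /-- the `1 → 1` W-node with equal capacities is a wire -/
  | id (a : ℕ+) (h : ∀ x ∈ [a], x ≤ a) : Instance .id (W a [a] h) (Diagram.id [a])
  /-- bialgebra between Z-spiders and W-nodes, for `n ≠ 0` -/
  | b1 (b : ℕ+) (r : ℂ) (n : ℕ) (hn : n ≠ 0) (as : List ℕ+) (h : ∀ x ∈ as, x ≤ b) :
      Instance .b1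
        (comp (Z b r n 1) (W b as h) rfl)
        (comp (comp (par (fun _ => [b]) (fun _ => as) (fun _ => W b as h) (List.range n))
            (transpose (fun _ x => x) as (List.range n)) (by simp))
          (par (List.replicate n) (List.replicate 1) (fun x => Z x r n 1) as) (by simp))
  /-- bialgebra between W-nodes: `c ≥ min (∑ aᵢ) (∑ bⱼ)` on the left-hand side, and the wires on
  the right-hand side have capacities `min aᵢ bⱼ` -/
  | b2 (c : ℕ+) (as bs : List ℕ+) (ha : ∀ x ∈ as, x ≤ c) (hb : ∀ x ∈ bs, x ≤ c)
      (hcap : min (as.map PNat.val).sum (bs.map PNat.val).sum ≤ c) :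
      Instance .b2
        (comp (coW c as ha) (W c bs hb) rfl)
        (comp (comp
            (par (fun x => [x]) (fun x => bs.map fun y => min x y)
              (fun x => W x (bs.map fun y => min x y) (by simp)) as)
            (transpose (fun x y => min x y) bs as) rfl)
          (par (fun y => as.map fun x => min x y) (fun y => [y])
            (fun y => coW y (as.map fun x => min x y) (by simp)) bs) rfl)
  /-- sum of parameters -/
  | plus (a : ℕ+) (r t : ℂ) (h : ∀ x ∈ [a, a], x ≤ a) :
      Instance .plus
        (comp (W a [a, a] h) (tensor (Z a r 1 0) (Z a t 1 0)) rfl)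
        (Z a (r + t) 1 0)
  /-- a Z-spider copies `|1⟩` and produces its parameter as a global scalar -/
  | cp (a : ℕ+) (r : ℂ) (n : ℕ) :
      Instance .cp
        (comp (one a) (Z a r 1 n) rfl)
        (tensor (scalar r) (par (fun _ => []) (fun _ => [a]) (fun _ => one a) (List.range n)))
  /-- a Z-spider joined to an upside-down W-node of output capacity `a` by more than `a` wires
  disconnects -/
  | h (a b : ℕ+) (n : ℕ) (hn : (a : ℕ) < n) (hab : ∀ x ∈ List.replicate n b, x ≤ a)
      (he : ∀ x ∈ [], x ≤ b) :
      Instance .h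
        (comp (Z b 1 1 n) (coW a (List.replicate n b) hab) rfl)
        (tensor (W b [] he) (Z a 0 0 1))
  /-- removal of a loop on a Z-spider of capacity `1` -/
  | l (n : ℕ) :
      Instance .l (comp (Z 1 1 n 2) (cup 1) rfl) (Z 1 1 n 0)
  /-- `|1⟩` injected into a wire of larger capacity is `|1⟩` -/
  | i (a b : ℕ+) (h : ∀ x ∈ [b], x ≤ a) :
      Instance .i (comp (one b) (coW a [b] h) rfl) (one a)
  /-- the `0 → 1` Z-spider of capacity `a` is obtained from `|a⟩`, distributed over two wires by a
  W-node, one of the two being erased by a Z-spider with a loop -/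
  | u (a : ℕ+) (hk : a.natPred + 1 ≤ (a : ℕ)) (h : ∀ x ∈ [a, a], x ≤ a) :
      Instance .u
        (Z a 1 0 1)
        (tensor (scalar (1 / (Nat.factorial a : ℂ)))
          (comp (comp (ket a.natPred a hk) (W a [a, a] h) rfl)
            (tensor (Diagram.id [a]) (comp (Z a 1 1 2) (cup a) rfl)) rfl))

/-- `Derivable S D₁ D₂`: the equation `D₁ = D₂` can be derived from the structural equations and all
the instances of the schemas in `S`, applied anywhere inside a diagram. -/
inductive Derivable (S : Set Rule) : {A B A' B' : List ℕ+} → Diagram A B → Diagram A' B' → Prop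
  | structural {A B A' B' : List ℕ+} {f : Diagram A B} {g : Diagram A' B'} :
      Structural f g → Derivable S f g
  | rule {A B A' B' : List ℕ+} {f : Diagram A B} {g : Diagram A' B'} (R : Rule) :
      R ∈ S → Instance R f g → Derivable S f g
  | refl {A B : List ℕ+} (f : Diagram A B) : Derivable S f f
  | symm {A B A' B' : List ℕ+} {f : Diagram A B} {g : Diagram A' B'} :
      Derivable S f g → Derivable S g f
  | trans {A B A' B' A'' B'' : List ℕ+} {f : Diagram A B} {g : Diagram A' B'}
      {k : Diagram A'' B''} : Derivable S f g → Derivable S g k → Derivable S f k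
  | comp {A B C D A' B' C' D' : List ℕ+} {f : Diagram A B} {g : Diagram C D}
      {f' : Diagram A' B'} {g' : Diagram C' D'} (h : B = C) (h' : B' = C') :
      Derivable S f f' → Derivable S g g' →
      Derivable S (Diagram.comp f g h) (Diagram.comp f' g' h')
  | tensor {A B C D A' B' C' D' : List ℕ+} {f : Diagram A B} {g : Diagram C D}
      {f' : Diagram A' B'} {g' : Diagram C' D'} :
      Derivable S f f' → Derivable S g g' →
      Derivable S (Diagram.tensor f g) (Diagram.tensor f' g')

end ZWf

/-!
For each schema, one of its instances is separated from all the consequences of the other eleven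
schemas by an invariant of diagrams.

For `(s)`, `(cp)` and `(u)` the invariant is syntactic: the occurrence of a generator of a certain
kind, which all the other equations preserve (`Derivable.uses_iff`).

For the other schemas it is an interpretation of diagrams by tensors over a commutative semiring,
up to invertible scalars. The interpretations used here (`Interp`) share a common shape: wires are
labelled by finitely many elements of an additive monoid, upside-down W-nodes add up labels, cups
are diagonal, and Z-spiders are given by commutative Frobenius algebras, one for each of the
sectors into which the labels are partitioned. All of them satisfy the structural equations
(`Interp.eqv_of_structural`), and each schema holds as soon as the data satisfy simple numerical
conditions (the lemmas `Interp.eqv_s`, `Interp.eqv_a`, …). The intended model has labels `0, …, a`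
on a wire of capacity `a`, with weights given by factorials.

* Changing the weights, the arities of W-nodes, the parameters of Z-spiders or the states `|1⟩` in
  this model (`fock`) violates exactly one of `(a)`, `(b₂)`, `(+)`, `(ℓ)` and `(i)`.
* The analogous model over the Boolean semiring (`boolean`) does the same for `(o)`, `(id)` and
  `(h)`.
* For `(b₁)`, Z-spiders are needed which are not diagonal. Labels count particles of size one and
  `p` kinds of particles of size two, the sectors are given by the total size, and the
  coefficients are in a field of characteristic `p` (`bosonic`). The sector of a given size
  carries a local Frobenius algebra, so that a Z-spider may turn two particles of size two and of
  the same kind into two particles of size one, which a W-node separates, while no particle of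
  size two passes through a W-node with outputs of capacity one. A loop counts the labels of a
  sector, hence `(u)` forces this number to be one: it is so modulo `p`, because the kinds of
  particles may be permuted cyclically (`Config.card_sector`). The model satisfies each equation
  only when `p` is large with respect to its capacities, and when the parameters of its Z-spiders
  have been mapped to characteristic `p`. As a derivation uses finitely many equations, it is
  enough that every finite set of complex numbers has such reductions for arbitrarily large `p`
  (`Reduction.good_nonempty`), a consequence of the Nullstellensatz over the integers.
-/

namespace ZWf

open Diagram (comp tensor swap cup cap scalar ofEq slide braid cups coW ket par interleave transpose)

noncomputable section

/-! ### Indicator functions -/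

section Ind

variable (K : Type) [CommSemiring K]

/-- The indicator of a proposition, as an element of a semiring. -/
def ind (p : Prop) : K := open Classical in if p then 1 else 0

variable {K}

theorem ind_pos {p : Prop} (h : p) : ind K p = 1 := by simp [ind, h]

theorem ind_neg {p : Prop} (h : ¬p) : ind K p = 0 := by simp [ind, h]

theorem ind_and (p q : Prop) : ind K (p ∧ q) = ind K p * ind K q := by
  by_cases hp : p <;> by_cases hq : q <;> simp [ind, hp, hq]

theorem ind_congr {p q : Prop} (h : p ↔ q) : ind K p = ind K q := by rw [propext h]

theorem ind_mul_congr {p : Prop} {a b : K} (h : p → a = b) : ind K p * a = ind K p * b := by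
  by_cases hp : p
  · rw [h hp]
  · simp [ind_neg hp]

theorem sum_ind_mul {α : Type} (s : Finset α) (a : α) (ha : a ∈ s) (F : α → K) :
    ∑ y ∈ s, ind K (y = a) * F y = F a := by
  rw [Finset.sum_eq_single_of_mem a ha (fun b _ hb => by simp [ind_neg hb])]
  simp [ind_pos]

theorem sum_ind_mul' {α : Type} (s : Finset α) (a : α) (ha : a ∈ s) (F : α → K) :
    ∑ y ∈ s, ind K (a = y) * F y = F a := by
  simp_rw [eq_comm (a := a)]
  exact sum_ind_mul s a ha F

theorem ind_cons {X : Type} (a b : X) (x y : List X) :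
    ind K (a :: x = b :: y) = ind K (a = b) * ind K (x = y) := by
  rw [← ind_and]; exact ind_congr (by simp)

theorem append_eq_append_iff_of_length {X : Type} {x x' y y' : List X} (h : x.length = x'.length) :
    x ++ y = x' ++ y' ↔ x = x' ∧ y = y' :=
  ⟨fun e => List.append_inj e h, fun e => by rw [e.1, e.2]⟩

theorem ind_append {X : Type} {x x' y y' : List X} (h : x.length = x'.length) :
    ind K (x ++ y = x' ++ y') = ind K (x = x') * ind K (y = y') := by
  rw [← ind_and]; exact ind_congr (append_eq_append_iff_of_length h)

end Ind

/-! ### Labellings -/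

section States

variable {C X : Type} (S : C → Finset X)

/-- The labellings of a list `A`, an entry `a` being labelled by an element of `S a`.  For a list of
capacities these are the labellings of the wires; for a list of lists of capacities and the map
`states S` they are matrices of labels. -/
def states : List C → Finset (List X)
  | [] => {[]}
  | a :: A => (S a ×ˢ states A).map
      ⟨fun p => p.1 :: p.2, fun p q h => by simpa [Prod.ext_iff] using h⟩

variable {S}

@[simp] theorem states_nil : states S [] = {[]} := rfl

theorem mem_states_cons {a : C} {A : List C} {l : List X} :
    l ∈ states S (a :: A) ↔ ∃ p ∈ S a, ∃ x ∈ states S A, l = p :: x := by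
  simp only [states, Finset.mem_map, Finset.mem_product, Prod.exists]
  constructor
  · rintro ⟨p, x, ⟨hp, hx⟩, rfl⟩; exact ⟨p, hp, x, hx, rfl⟩
  · rintro ⟨p, hp, x, hx, rfl⟩; exact ⟨p, x, ⟨hp, hx⟩, rfl⟩

@[simp] theorem cons_mem_states {a : C} {A : List C} {p : X} {x : List X} :
    p :: x ∈ states S (a :: A) ↔ p ∈ S a ∧ x ∈ states S A := by
  simp [mem_states_cons]

theorem length_of_mem {A : List C} {x : List X} (h : x ∈ states S A) : x.length = A.length := by
  induction A generalizing x with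
  | nil => simp at h; simp [h]
  | cons a A ih =>
    obtain ⟨p, _, y, hy, rfl⟩ := mem_states_cons.1 h
    simp [ih hy]

theorem mem_states_append {A B : List C} {l : List X} :
    l ∈ states S (A ++ B) ↔ ∃ x ∈ states S A, ∃ y ∈ states S B, l = x ++ y := by
  induction A generalizing l with
  | nil => simp
  | cons a A ih =>
    rw [List.cons_append, mem_states_cons, ]
    constructor
    · rintro ⟨p, hp, x, hx, rfl⟩
      obtain ⟨u, hu, v, hv, rfl⟩ := ih.1 hx
      exact ⟨p :: u, by simp [hp, hu], v, hv, rfl⟩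
    · rintro ⟨x, hx, y, hy, rfl⟩
      obtain ⟨p, hp, u, hu, rfl⟩ := mem_states_cons.1 hx
      exact ⟨p, hp, u ++ y, ih.2 ⟨u, hu, y, hy, rfl⟩, rfl⟩

theorem append_mem_states {A B : List C} {x y : List X} (hx : x ∈ states S A)
    (hy : y ∈ states S B) : x ++ y ∈ states S (A ++ B) :=
  mem_states_append.2 ⟨x, hx, y, hy, rfl⟩

theorem mem_states_singleton {a : C} {l : List X} :
    l ∈ states S [a] ↔ ∃ p ∈ S a, l = [p] := by
  simp [mem_states_cons]

theorem mem_states_pair {a b : C} {l : List X} :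
    l ∈ states S [a, b] ↔ ∃ p ∈ S a, ∃ q ∈ S b, l = [p, q] := by
  simp only [mem_states_cons, states_nil, Finset.mem_singleton]
  constructor
  · rintro ⟨p, hp, x, ⟨q, hq, y, rfl, rfl⟩, rfl⟩; exact ⟨p, hp, q, hq, rfl⟩
  · rintro ⟨p, hp, q, hq, rfl⟩; exact ⟨p, hp, [q], ⟨q, hq, [], rfl, rfl⟩, rfl⟩

theorem mem_states_replicate {a : C} {n : ℕ} {l : List X} :
    l ∈ states S (List.replicate n a) ↔ l.length = n ∧ ∀ p ∈ l, p ∈ S a := by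
  induction n generalizing l with
  | zero => simp; rintro rfl; simp
  | succ n ih =>
    rw [List.replicate_succ]
    cases l with
    | nil => simp [mem_states_cons]
    | cons p l => simp [ih]; tauto

theorem reverse_mem_states {A : List C} {x : List X} (h : x ∈ states S A) :
    x.reverse ∈ states S A.reverse := by
  induction A generalizing x with
  | nil => simp at h; simp [h]
  | cons a A ih =>
    obtain ⟨p, hp, y, hy, rfl⟩ := mem_states_cons.1 h
    rw [List.reverse_cons, List.reverse_cons]
    exact append_mem_states (ih hy) (by simp [hp])

variable {K : Type} [AddCommMonoid K]

theorem sum_states_cons (a : C) (A : List C) (F : List X → K) :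
    ∑ x ∈ states S (a :: A), F x = ∑ p ∈ S a, ∑ x ∈ states S A, F (p :: x) := by
  rw [states, Finset.sum_map, Finset.sum_product]
  rfl

theorem sum_states_append (A B : List C) (F : List X → K) :
    ∑ x ∈ states S (A ++ B), F x = ∑ x ∈ states S A, ∑ y ∈ states S B, F (x ++ y) := by
  induction A generalizing F with
  | nil => simp
  | cons a A ih => simp [sum_states_cons, ih]

theorem sum_states_singleton (a : C) (F : List X → K) :
    ∑ x ∈ states S [a], F x = ∑ p ∈ S a, F [p] := by
  simp [sum_states_cons]

theorem sum_states_pair (a b : C) (F : List X → K) :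
    ∑ x ∈ states S [a, b], F x = ∑ p ∈ S a, ∑ q ∈ S b, F [p, q] := by
  simp [sum_states_cons]

end States

/-! ### Interpretations -/

/-- The data of an interpretation of diagrams by tensors.  A wire of capacity `a` is labelled by the
elements of a finite set `S a` of an additive monoid `X`, and a cup pairs each label `x` with
  itself,
with weight `g a x` (a cap has the inverse weight `gi a x`).  The upside-down W-nodes add up labels;
a W-node is then the transpose of this, for the pairing given by the cups.  When the arity `n` of a
W-node does not satisfy `Q n`, only its entries with all labels zero are kept.
The labels are partitioned into sectors by an idempotent `π`; a Z-spider is the sum over the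
sectors of a tensor `T` on the labels of this sector, weighted by the character `ρ`. -/
structure Interp (K X : Type) [CommSemiring K] [AddCommMonoid X] where
  /-- the labels of a wire -/
  S : ℕ+ → Finset X
  /-- the weights of a cup -/
  g : ℕ+ → X → K
  /-- the weights of a cap -/
  gi : ℕ+ → X → K
  /-- the arities of the W-nodes which are not restricted to the label zero -/
  Q : ℕ → Prop
  /-- the sector of a label, represented by one of its elements -/
  π : X → X
  /-- the contribution of the parameter of a Z-spider in each sector -/
  ρ : X → ℂ → K
  /-- the tensor of a Z-spider in each sector, all its legs being outputs -/
  T : ℕ+ → X → List X → K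
  /-- the label of the state `|1⟩` -/
  one : ℕ+ → X
  /-- the values of global scalars -/
  sc : ℂ → K
  g_mul_gi : ∀ a x, g a x * gi a x = 1
  T_perm : ∀ a k l l', l.Perm l' → T a k l = T a k l'

namespace Interp

variable {K X : Type} [CommSemiring K] [AddCommMonoid X] (M : Interp K X)

/-- The tensor of an upside-down W-node: the label `k` of the output is the sum of the others. -/
def merge (x : List X) (k : X) : K := ind K (x.sum = k) * ind K (M.Q x.length ∨ k = 0)

/-- The tensor of a Z-spider, all its legs being outputs. -/
def Zt (a : ℕ+) (r : ℂ) (l : List X) : K := open Classical in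
  ∑ k ∈ M.S a with M.π k = k, ind K (∀ x ∈ l, M.π x = k) * (M.ρ k r * M.T a k l)

/-- The weight of nested cups on the wires `A`. -/
def wt (A : List ℕ+) (x : List X) : K := (List.zipWith M.g A x).prod

/-- The weight of nested caps on the wires `A`. -/
def wti (A : List ℕ+) (x : List X) : K := (List.zipWith M.gi A x).prod

/-- The entries of the tensor interpreting a diagram. -/
def eval : {A B : List ℕ+} → Diagram A B → List X → List X → K
  | _, _, .id _, x, z => ind K (x = z)
  | _, _, @Diagram.comp _ B _ _ f g _, x, z => ∑ y ∈ states M.S B, eval f x y * eval g y z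
  | _, _, @Diagram.tensor A B _ _ f g, x, z =>
      eval f (x.take A.length) (z.take B.length) * eval g (x.drop A.length) (z.drop B.length)
  | _, _, .swap _ _, x, z => ind K (z = x.reverse)
  | _, _, .cup a, x, _ => match x with
    | [p, q] => ind K (p = q) * M.g a p
    | _ => 0
  | _, _, .cap a, _, z => match z with
    | [p, q] => ind K (p = q) * M.gi a p
    | _ => 0
  | _, _, .Z a r _ _, x, z => (x.map (M.g a)).prod * M.Zt a r (x ++ z)
  | _, _, .W a bs _, x, z => match x with
    | [k] => M.merge z k * M.g a k * M.wti bs z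
    | _ => 0
  | _, _, .one a, _, z => ind K (z = [M.one a])
  | _, _, .scalar r, _, _ => M.sc r

/-- Two diagrams of the same type whose tensors are proportional. -/
def Eqv {A B A' B' : List ℕ+} (D : Diagram A B) (D' : Diagram A' B') : Prop :=
  A = A' ∧ B = B' ∧ ∃ c : Kˣ, ∀ x ∈ states M.S A, ∀ z ∈ states M.S B,
    M.eval D x z = c * M.eval D' x z

variable {M}

theorem Eqv.of_eq {A B A' B' : List ℕ+} {D : Diagram A B} {D' : Diagram A' B'} (hA : A = A')
    (hB : B = B') (h : ∀ x ∈ states M.S A, ∀ z ∈ states M.S B, M.eval D x z = M.eval D' x z) :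
    M.Eqv D D' :=
  ⟨hA, hB, 1, by simpa using h⟩

theorem Eqv.refl {A B : List ℕ+} (D : Diagram A B) : M.Eqv D D := .of_eq rfl rfl fun _ _ _ _ => rfl

theorem Eqv.symm {A B A' B' : List ℕ+} {D : Diagram A B} {D' : Diagram A' B'} (h : M.Eqv D D') :
    M.Eqv D' D := by
  obtain ⟨rfl, rfl, c, h⟩ := h
  exact ⟨rfl, rfl, c⁻¹, fun x hx z hz => by rw [h x hx z hz, ← mul_assoc]; simp⟩

theorem Eqv.trans {A B A' B' A'' B'' : List ℕ+} {D : Diagram A B} {D' : Diagram A' B'}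
    {D'' : Diagram A'' B''} (h : M.Eqv D D') (h' : M.Eqv D' D'') : M.Eqv D D'' := by
  obtain ⟨rfl, rfl, c, h⟩ := h
  obtain ⟨rfl, rfl, c', h'⟩ := h'
  exact ⟨rfl, rfl, c * c', fun x hx z hz => by
    rw [h x hx z hz, h' x hx z hz, ← mul_assoc, Units.val_mul]⟩

variable (M)

/-! ### Evaluation of composites -/

theorem eval_id (A : List ℕ+) (x z : List X) : M.eval (.id A) x z = ind K (x = z) := rfl

theorem eval_comp {A B B' C : List ℕ+} (f : Diagram A B) (g : Diagram B' C) (h : B = B')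
    (x z : List X) :
    M.eval (comp f g h) x z = ∑ y ∈ states M.S B, M.eval f x y * M.eval g y z := by
  rw [eval]

theorem eval_tensor {A B C D : List ℕ+} (f : Diagram A B) (g : Diagram C D) {x x' z z' : List X}
    (hx : x.length = A.length) (hz : z.length = B.length) :
    M.eval (tensor f g) (x ++ x') (z ++ z') = M.eval f x z * M.eval g x' z' := by
  rw [eval, List.take_left' hx, List.take_left' hz, List.drop_left' hx, List.drop_left' hz]

theorem eval_tensor_id {A C D : List ℕ+} (g : Diagram C D) {x x' z z' : List X}
    (hx : x.length = A.length) (hz : z.length = A.length) :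
    M.eval (tensor (.id A) g) (x ++ x') (z ++ z') = ind K (x = z) * M.eval g x' z' := by
  rw [eval_tensor M _ _ hx hz, eval_id]

theorem eval_comp_left {A B B' C : List ℕ+} (f : Diagram A B) (g : Diagram B' C) (h : B = B')
    {x w z : List X} (hf : ∀ y ∈ states M.S B, M.eval f x y = ind K (y = w))
    (hw : w ∈ states M.S B) : M.eval (comp f g h) x z = M.eval g w z := by
  rw [eval_comp, Finset.sum_congr rfl (fun y hy => by rw [hf y hy])]
  exact sum_ind_mul _ _ hw _

theorem eval_comp_right {A B B' C : List ℕ+} (f : Diagram A B) (g : Diagram B' C) (h : B = B')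
    {x w z : List X} (hg : ∀ y ∈ states M.S B, M.eval g y z = ind K (y = w))
    (hw : w ∈ states M.S B) : M.eval (comp f g h) x z = M.eval f x w := by
  rw [eval_comp, Finset.sum_congr rfl (fun y hy => by rw [hg y hy, mul_comm])]
  exact sum_ind_mul _ _ hw _

theorem eval_comp_assoc {A B B' C C' D : List ℕ+} (f : Diagram A B) (g : Diagram B' C)
    (k : Diagram C' D) (h : B = B') (h' : C = C') (x z : List X) :
    M.eval (comp (comp f g h) k h') x z = M.eval (comp f (comp g k h') h) x z := by
  simp only [eval_comp, Finset.sum_mul, Finset.mul_sum]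
  rw [Finset.sum_comm]
  simp only [mul_assoc]

theorem eval_ofEq {A B : List ℕ+} (h : A = B) {x z : List X} (hx : x ∈ states M.S A) :
    M.eval (ofEq h) x z = ind K (z = x) := by
  rw [ofEq, eval_comp_left M _ _ h (w := x) (fun y _ => by rw [eval_id]; exact ind_congr eq_comm)
    hx, eval_id]
  exact ind_congr eq_comm

theorem eval_ofEq_comp {A B B' C : List ℕ+} (h : A = B) (g : Diagram B' C) (h' : B = B')
    {x z : List X} (hx : x ∈ states M.S A) : M.eval (comp (ofEq h) g h') x z = M.eval g x z :=
  eval_comp_left M _ _ h' (fun _ _ => eval_ofEq M h hx) (h ▸ hx)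

theorem eval_comp_ofEq {A B B' C : List ℕ+} (f : Diagram A B) (h : B' = C) (h' : B = B')
    {x z : List X} (hz : z ∈ states M.S C) : M.eval (comp f (ofEq h) h') x z = M.eval f x z :=
  eval_comp_right M _ _ h' (fun y hy => by rw [eval_ofEq M h (h' ▸ hy)]; exact ind_congr eq_comm)
    (h' ▸ h ▸ hz)

theorem eval_swap (a b : ℕ+) (p q : X) (z : List X) :
    M.eval (swap a b) [p, q] z = ind K (z = [q, p]) := rfl

theorem eval_cup (a : ℕ+) (p q : X) (z : List X) :
    M.eval (cup a) [p, q] z = ind K (p = q) * M.g a p := rfl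

theorem eval_cap (a : ℕ+) (p q : X) (x : List X) :
    M.eval (cap a) x [p, q] = ind K (p = q) * M.gi a p := rfl

theorem eval_Z (a : ℕ+) (r : ℂ) (n m : ℕ) (x z : List X) :
    M.eval (.Z a r n m) x z = (x.map (M.g a)).prod * M.Zt a r (x ++ z) := rfl

theorem eval_W (a : ℕ+) (bs : List ℕ+) (h : ∀ b ∈ bs, b ≤ a) (k : X) (z : List X) :
    M.eval (.W a bs h) [k] z = M.merge z k * M.g a k * M.wti bs z := rfl

theorem eval_one (a : ℕ+) (x z : List X) : M.eval (.one a) x z = ind K (z = [M.one a]) := rfl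

theorem eval_scalar (r : ℂ) (x z : List X) : M.eval (scalar r) x z = M.sc r := rfl

theorem eval_slide (a : ℕ+) (B : List ℕ+) {p : X} {y z : List X} (hp : p ∈ M.S a)
    (hy : y ∈ states M.S B) (hz : z ∈ states M.S (B ++ [a])) :
    M.eval (slide a B) (p :: y) z = ind K (z = y ++ [p]) := by
  induction B generalizing y z with
  | nil =>
    simp at hy; subst hy
    exact ind_congr eq_comm
  | cons b B ih =>
    obtain ⟨q, hq, y, hy', rfl⟩ := mem_states_cons.1 hy
    obtain ⟨q', hq', z, hz', rfl⟩ := mem_states_cons.1 hz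
    rw [slide, eval_comp_left M (w := q :: p :: y)]
    · refine (eval_tensor_id M (A := [b]) (slide a B) (x := [q]) (x' := p :: y) (z := [q'])
        (z' := z) rfl rfl).trans ?_
      rw [ih hy' hz', ← ind_and]
      exact ind_congr (by simp [eq_comm])
    · intro w hw
      obtain ⟨u, hu, v, hv, rfl⟩ := mem_states_append (A := [b, a]).1 hw
      have := length_of_mem hu
      rw [show p :: q :: y = [p, q] ++ y from rfl, eval_tensor M _ _ rfl this, eval_swap, eval_id,
        show q :: p :: y = [q, p] ++ y from rfl, ind_append (by simpa using this)]
      congr 1; exact ind_congr eq_comm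
    · simp [hp, hq, hy']

theorem eval_braid (A B : List ℕ+) {x y z : List X} (hx : x ∈ states M.S A)
    (hy : y ∈ states M.S B) (hz : z ∈ states M.S (B ++ A)) :
    M.eval (braid A B) (x ++ y) z = ind K (z = y ++ x) := by
  induction A generalizing x z with
  | nil =>
    simp at hx; subst hx
    rw [braid, eval_ofEq M _ (by simpa using hy)]
    simp
  | cons a A ih =>
    obtain ⟨p, hp, x, hx', rfl⟩ := mem_states_cons.1 hx
    rw [braid, eval_comp_ofEq M _ _ _ hz, eval_comp_left M (w := p :: (y ++ x))]
    · obtain ⟨u, hu, v, hv, rfl⟩ := mem_states_append.1 hz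
      obtain ⟨q, hq, v, hv', rfl⟩ := mem_states_cons.1 hv
      rw [show p :: (y ++ x) = (p :: y) ++ x from rfl, show u ++ q :: v = (u ++ [q]) ++ v by simp,
        eval_tensor M _ _ (by simp [length_of_mem hy]) (by simp [length_of_mem hu]),
        eval_slide M a B hp hy (append_mem_states hu (by simp [hq])), eval_id, ← ind_and,
        show y ++ p :: x = (y ++ [p]) ++ x by simp]
      refine ind_congr ?_
      rw [append_eq_append_iff_of_length (x := u ++ [q])
        (by simp [length_of_mem hu, length_of_mem hy]),
        append_eq_append_iff_of_length (x := u) (by simp [length_of_mem hu, length_of_mem hy]),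
        eq_comm (a := x)]
    · intro w hw
      obtain ⟨q, hq, w, hw', rfl⟩ := mem_states_cons.1 hw
      refine (eval_tensor_id M (A := [a]) (braid A B) (x := [p]) (x' := x ++ y) (z := [q])
        (z' := w) rfl rfl).trans ?_
      rw [ih hx' hw', ← ind_and]
      exact ind_congr (by simp [eq_comm])
    · simp [hp, append_mem_states hy hx']

theorem wt_cons (a : ℕ+) (A : List ℕ+) (p : X) (x : List X) :
    M.wt (a :: A) (p :: x) = M.g a p * M.wt A x := by simp [wt]

theorem wti_cons (a : ℕ+) (A : List ℕ+) (p : X) (x : List X) :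
    M.wti (a :: A) (p :: x) = M.gi a p * M.wti A x := by simp [wti]

theorem wti_append {A B : List ℕ+} {x y : List X} (h : x.length = A.length) :
    M.wti (A ++ B) (x ++ y) = M.wti A x * M.wti B y := by
  simp [wti, List.zipWith_append h.symm]

@[simp] theorem wti_nil : M.wti [] [] = 1 := rfl

@[simp] theorem wt_nil : M.wt [] [] = 1 := rfl

theorem wt_mul_wti {A : List ℕ+} {x : List X} (h : x.length = A.length) :
    M.wt A x * M.wti A x = 1 := by
  induction A generalizing x with
  | nil => simp [wt, wti]
  | cons a A ih =>
    cases x with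
    | nil => simp at h
    | cons p x =>
      rw [wt_cons, wti_cons, mul_mul_mul_comm, M.g_mul_gi, ih (by simpa using h), one_mul]

theorem wti_reverse {A : List ℕ+} {x : List X} (h : x.length = A.length) :
    M.wti A.reverse x.reverse = M.wti A x := by
  rw [wti, wti, ← List.reverse_zipWith h.symm, List.prod_reverse]

theorem eval_cups (A : List ℕ+) {x y : List X} (hx : x ∈ states M.S A)
    (hy : y ∈ states M.S A.reverse) :
    M.eval (cups A) (x ++ y) [] = ind K (y = x.reverse) * M.wt A x := by
  induction A generalizing x y with
  | nil => simp at hx hy; subst hx hy; simp [cups, eval_id, ind_pos]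
  | cons a A ih =>
    obtain ⟨p, hp, x, hx', rfl⟩ := mem_states_cons.1 hx
    rw [List.reverse_cons] at hy
    obtain ⟨y, hy', w, hw, rfl⟩ := mem_states_append.1 hy
    obtain ⟨q, hq, rfl⟩ := mem_states_singleton.1 hw
    have hmem : p :: x ++ (y ++ [q]) ∈ states M.S (a :: A ++ (a :: A).reverse) :=
      append_mem_states (by simp [hp, hx']) (by
        rw [List.reverse_cons]; exact append_mem_states hy' hw)
    have key : ∀ w ∈ states M.S [a, a], M.eval (tensor (.id [a]) (tensor (cups A) (.id [a])))
        (p :: x ++ (y ++ [q])) w = ind K (w = [p, q]) * (ind K (y = x.reverse) * M.wt A x) := by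
      intro w hw
      obtain ⟨p', hp', q', hq', rfl⟩ := mem_states_pair.1 hw
      rw [show p :: x ++ (y ++ [q]) = [p] ++ ((x ++ y) ++ [q]) by simp,
        show [p', q'] = [p'] ++ ([] ++ [q']) from rfl, eval_tensor_id M _ rfl rfl,
        eval_tensor M _ _ (by simp [length_of_mem hx', length_of_mem hy']) rfl, ih hx' hy', eval_id,
        show [p'] ++ ([] ++ [q']) = [p'] ++ [q'] from rfl, show [p, q] = [p] ++ [q] from rfl,
        ind_append (x := [p']) (x' := [p]) rfl, eq_comm (a := [p']), eq_comm (a := [q'])]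
      ring
    rw [cups, eval_comp]
    rw [Finset.sum_congr rfl fun w hw => by rw [eval_ofEq_comp M _ _ _ hmem, key w hw, mul_assoc]]
    rw [sum_ind_mul _ _ (by simp [hp, hq]), eval_cup, wt_cons, List.reverse_cons,
      ind_append (by simp [length_of_mem hx', length_of_mem hy'])]
    rw [show ind K ([q] = [p]) = ind K (p = q) from ind_congr (by simp [eq_comm])]
    ring

theorem merge_perm {x y : List X} (h : x.Perm y) (k : X) : M.merge x k = M.merge y k := by
  rw [merge, merge, h.sum_eq, h.length_eq]

/-- The upside-down W-nodes add up labels. -/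
theorem eval_coW (a : ℕ+) (bs : List ℕ+) (h : ∀ b ∈ bs, b ≤ a) {x : List X} {k : X}
    (hx : x ∈ states M.S bs) (hk : k ∈ M.S a) : M.eval (coW a bs h) x [k] = M.merge x k := by
  have e1 : ∀ w ∈ states M.S (bs ++ [a, a]), M.eval (tensor (.id bs) (cap a)) x w
      = ∑ p ∈ M.S a, ind K (w = x ++ [p, p]) * M.gi a p := by
    intro w hw
    obtain ⟨u, hu, v, hv, rfl⟩ := mem_states_append.1 hw
    obtain ⟨p, hp, q, hq, rfl⟩ := mem_states_pair.1 hv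
    have hl := length_of_mem hu
    rw [show M.eval (tensor (.id bs) (cap a)) x (u ++ [p, q])
      = M.eval (tensor (.id bs) (cap a)) (x ++ []) (u ++ [p, q]) by simp,
      eval_tensor_id M _ (length_of_mem hx) hl, eval_cap,
      ]
    have : ∀ p', ind K (u ++ [p, q] = x ++ [p', p']) * M.gi a p'
        = ind K (p' = p) * (ind K (x = u) * (ind K (p = q) * M.gi a p')) := by
      intro p'
      rw [← mul_assoc (ind K (x = u)), ← mul_assoc, ← ind_and, ← ind_and]
      congr 1
      refine ind_congr ?_
      rw [append_eq_append_iff_of_length (by simp [length_of_mem hx, hl])]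
      simp only [List.cons.injEq, and_true]
      constructor
      · rintro ⟨rfl, rfl, rfl⟩; simp
      · rintro ⟨rfl, rfl, rfl⟩; simp
    rw [Finset.sum_congr rfl fun p' _ => this p', sum_ind_mul _ _ hp]
  have e2 : ∀ w ∈ states M.S (bs ++ (bs.reverse ++ [a])), ∀ p ∈ M.S a,
      M.eval (tensor (.id bs) (tensor (.W a bs.reverse (by simpa using h)) (.id [a]))) (x ++ [p, p])
        w = ∑ y ∈ states M.S bs.reverse, ind K (w = x ++ (y ++ [p])) *
          (M.merge y p * M.g a p * M.wti bs.reverse y) := by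
    intro w hw p hp
    obtain ⟨u, hu, v, hv, rfl⟩ := mem_states_append.1 hw
    obtain ⟨v, hv', q, hq, rfl⟩ := mem_states_append.1 hv
    have hl := length_of_mem hu
    rw [eval_tensor_id M _ (length_of_mem hx) hl, show [p, p] = [p] ++ [p] from rfl,
      eval_tensor M _ _ (x := [p]) rfl (length_of_mem hv'), eval_W, eval_id]
    have : ∀ y ∈ states M.S bs.reverse, ind K (u ++ (v ++ q) = x ++ (y ++ [p]))
        = ind K (y = v) * (ind K (x = u) * ind K ([p] = q)) := by
      intro y hy
      rw [ind_append (by simp [length_of_mem hx, hl]),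
        ind_append (by rw [length_of_mem hv', length_of_mem hy]),
        eq_comm (a := u), eq_comm (a := v), eq_comm (a := q)]
      ring
    rw [Finset.sum_congr rfl fun y hy => by rw [this y hy, mul_assoc], sum_ind_mul _ _ hv']
    ring
  have e3 : ∀ y ∈ states M.S bs.reverse, ∀ p ∈ M.S a,
      M.eval (tensor (cups bs) (.id [a])) (x ++ (y ++ [p])) [k]
        = ind K (y = x.reverse) * (ind K (p = k) * M.wt bs x) := by
    intro y hy p hp
    rw [← List.append_assoc, show [k] = [] ++ [k] from rfl,
      eval_tensor M _ _ (by simp [length_of_mem hx, length_of_mem hy]) rfl, eval_cups M bs hx hy,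
      eval_id, show ind K ([p] = [k]) = ind K (p = k) from ind_congr (by simp)]
    ring
  have hx' := reverse_mem_states hx
  have e4 : ∀ p ∈ M.S a, M.eval (comp (tensor (.id bs)
      (tensor (.W a bs.reverse (by simpa using h)) (.id [a]))) (tensor (cups bs) (.id [a])) (by
        simp))
        (x ++ [p, p]) [k] = ind K (p = k) * (M.merge x p * M.g a p) := by
    intro p hp
    rw [eval_comp, Finset.sum_congr rfl fun w hw => by rw [e2 w hw p hp, Finset.sum_mul],
      Finset.sum_comm]
    simp_rw [mul_assoc (ind K (_ = x ++ (_ ++ [p])))]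
    rw [Finset.sum_congr rfl fun y hy => by
      rw [sum_ind_mul _ _ (append_mem_states hx (append_mem_states hy (by simp [hp]))),
        e3 y hy p hp, mul_left_comm], sum_ind_mul _ _ hx', wti_reverse M (length_of_mem hx),
      M.merge_perm (List.reverse_perm x)]
    calc _ = ind K (p = k) * (M.merge x p * M.g a p) * (M.wt bs x * M.wti bs x) := by ring
      _ = _ := by rw [M.wt_mul_wti (length_of_mem hx), mul_one]
  rw [coW, eval_comp_assoc, eval_comp_assoc, eval_ofEq_comp M _ _ _ hx, eval_comp,
    Finset.sum_congr rfl fun w hw => by rw [e1 w hw, Finset.sum_mul], Finset.sum_comm]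
  simp_rw [mul_assoc (ind K (_ = x ++ [_, _]))]
  rw [Finset.sum_congr rfl fun p hp => by
    rw [sum_ind_mul _ _ (append_mem_states hx (by simp [hp])), e4 p hp, mul_left_comm],
    sum_ind_mul _ _ hk]
  calc _ = M.merge x k * (M.g a k * M.gi a k) := by ring
    _ = _ := by rw [M.g_mul_gi, mul_one]

end Interp

namespace Interp

/-! ### Soundness of the structural equations -/

section Structural

variable {K X : Type} [CommSemiring K] [AddCommMonoid X] {M : Interp K X}

theorem Eqv.comp {A B C D A' B' C' D' : List ℕ+} {f : Diagram A B} {g : Diagram C D}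
    {f' : Diagram A' B'} {g' : Diagram C' D'} (h : B = C) (h' : B' = C') (hf : M.Eqv f f')
    (hg : M.Eqv g g') : M.Eqv (comp f g h) (comp f' g' h') := by
  subst h h'
  obtain ⟨rfl, rfl, c, hf⟩ := hf
  obtain ⟨-, rfl, d, hg⟩ := hg
  refine ⟨rfl, rfl, c * d, fun x hx z hz => ?_⟩
  rw [eval_comp, eval_comp, Finset.mul_sum]
  refine Finset.sum_congr rfl fun y hy => ?_
  rw [hf x hx y hy, hg y hy z hz, Units.val_mul]
  ring

theorem Eqv.tensor {A B C D A' B' C' D' : List ℕ+} {f : Diagram A B} {g : Diagram C D}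
    {f' : Diagram A' B'} {g' : Diagram C' D'} (hf : M.Eqv f f') (hg : M.Eqv g g') :
    M.Eqv (tensor f g) (tensor f' g') := by
  obtain ⟨rfl, rfl, c, hf⟩ := hf
  obtain ⟨rfl, rfl, d, hg⟩ := hg
  refine ⟨rfl, rfl, c * d, fun x hx z hz => ?_⟩
  obtain ⟨x, hx1, x', hx2, rfl⟩ := mem_states_append.1 hx
  obtain ⟨z, hz1, z', hz2, rfl⟩ := mem_states_append.1 hz
  rw [eval_tensor M _ _ (length_of_mem hx1) (length_of_mem hz1),
    eval_tensor M _ _ (length_of_mem hx1) (length_of_mem hz1), hf x hx1 z hz1, hg x' hx2 z' hz2,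
    Units.val_mul]
  ring

variable (M)

theorem Zt_perm (a : ℕ+) (r : ℂ) {l l' : List X} (h : l.Perm l') : M.Zt a r l = M.Zt a r l' := by
  rw [Zt, Zt]
  refine Finset.sum_congr rfl fun k _ => ?_
  rw [M.T_perm a k l l' h, ind_congr (forall_congr' fun x => by rw [h.mem_iff])]

theorem eval_tensor_swap (a b : ℕ+) (A B : List ℕ+) {p q : X} {u v z : List X}
    (hu : u ∈ states M.S A) (hz : z ∈ states M.S (A ++ ([b, a] ++ B))) :
    M.eval (tensor (.id A) (tensor (swap a b) (.id B))) (u ++ ([p, q] ++ v)) z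
      = ind K (z = u ++ ([q, p] ++ v)) := by
  obtain ⟨u', hu', w, hw, rfl⟩ := mem_states_append.1 hz
  obtain ⟨w, hw', v', hv', rfl⟩ := mem_states_append.1 hw
  have e : M.eval (tensor (swap a b) (.id B)) ([p, q] ++ v) (w ++ v')
      = ind K (w = [q, p]) * ind K (v = v') :=
    eval_tensor M (swap a b) (.id B) (x := [p, q]) rfl (length_of_mem hw')
  have e1 : u'.length = u.length := (length_of_mem hu').trans (length_of_mem hu).symm
  have e2 : w.length = [q, p].length := by simpa using length_of_mem hw'
  refine (eval_tensor_id M _ (length_of_mem hu) (length_of_mem hu')).trans ?_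
  refine (congrArg _ e).trans ?_
  rw [ind_append e1, ind_append e2, eq_comm (a := u), eq_comm (a := v)]

theorem eval_tensor_swap' (a b : ℕ+) (A B : List ℕ+) {p q : X} {u v z : List X}
    (hu : u ∈ states M.S A) (hz : z ∈ states M.S (A ++ ([a, b] ++ B))) :
    M.eval (tensor (.id A) (tensor (swap a b) (.id B))) z (u ++ ([p, q] ++ v))
      = ind K (z = u ++ ([q, p] ++ v)) := by
  obtain ⟨u', hu', w, hw, rfl⟩ := mem_states_append.1 hz
  obtain ⟨w, hw', v', hv', rfl⟩ := mem_states_append.1 hw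
  obtain ⟨p', _, q', _, rfl⟩ := mem_states_pair.1 hw'
  have e : M.eval (tensor (swap a b) (.id B)) ([p', q'] ++ v') ([p, q] ++ v)
      = ind K ([p, q] = [q', p']) * ind K (v' = v) :=
    eval_tensor M (swap a b) (.id B) (x := [p', q']) (z := [p, q]) rfl rfl
  rw [eval_tensor_id M _ (length_of_mem hu') (length_of_mem hu), e, ind_append (by
    rw [length_of_mem hu, length_of_mem hu']), ind_append (x := [p', q']) (x' := [q, p]) rfl]
  congr 2
  exact ind_congr (by simp [eq_comm, and_comm])

theorem replicate_eq (a : ℕ+) (k l : ℕ) :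
    List.replicate (k + (2 + l)) a = List.replicate k a ++ ([a, a] ++ List.replicate l a) := by
  simp [← List.replicate_append_replicate, List.replicate_succ]

theorem perm_swap_mid {X : Type} (u v : List X) (p q : X) :
    (u ++ ([p, q] ++ v)).Perm (u ++ ([q, p] ++ v)) :=
  (List.Perm.swap q p v).append_left u

theorem eqv_tensor_assoc {A B A' B' A'' B'' : List ℕ+} (f : Diagram A B) (g : Diagram A' B')
    (k : Diagram A'' B'') : M.Eqv (tensor (tensor f g) k) (tensor f (tensor g k)) := by
  refine .of_eq (by simp) (by simp) fun x hx z hz => ?_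
  obtain ⟨x, hx', x3, hx3, rfl⟩ := mem_states_append.1 hx
  obtain ⟨x1, hx1, x2, hx2, rfl⟩ := mem_states_append.1 hx'
  obtain ⟨z, hz', z3, hz3, rfl⟩ := mem_states_append.1 hz
  obtain ⟨z1, hz1, z2, hz2, rfl⟩ := mem_states_append.1 hz'
  rw [eval_tensor M _ _ (by simp [length_of_mem hx1, length_of_mem hx2])
    (by simp [length_of_mem hz1, length_of_mem hz2]),
    eval_tensor M _ _ (length_of_mem hx1) (length_of_mem hz1), List.append_assoc,
    List.append_assoc, eval_tensor M _ _ (length_of_mem hx1) (length_of_mem hz1),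
    eval_tensor M _ _ (length_of_mem hx2) (length_of_mem hz2), mul_assoc]

theorem eqv_tensor_empty {A B : List ℕ+} (f : Diagram A B) : M.Eqv (tensor f (.id [])) f := by
  refine .of_eq (by simp) (by simp) fun x hx z hz => ?_
  rw [List.append_nil] at hx hz
  have := eval_tensor M f (.id []) (x' := []) (z' := []) (length_of_mem hx) (length_of_mem hz)
  simp only [List.append_nil] at this
  exact this.trans (by rw [eval_id, ind_pos rfl, mul_one])

theorem eqv_id_tensor_id (A B : List ℕ+) :
    M.Eqv (tensor (.id A) (.id B)) (.id (A ++ B)) := by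
  refine .of_eq rfl rfl fun x hx z hz => ?_
  obtain ⟨x, hx1, x', hx2, rfl⟩ := mem_states_append.1 hx
  obtain ⟨z, hz1, z', hz2, rfl⟩ := mem_states_append.1 hz
  rw [eval_tensor_id M _ (length_of_mem hx1) (length_of_mem hz1), eval_id, eval_id, ind_append]
  rw [length_of_mem hx1, length_of_mem hz1]

theorem eqv_interchange {A B B' C D E E' F : List ℕ+} (f : Diagram A B) (g : Diagram B' C)
    (f' : Diagram D E) (g' : Diagram E' F) (h : B = B') (h' : E = E') :
    M.Eqv (comp (tensor f f') (tensor g g') (by rw [h, h']))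
      (tensor (comp f g h) (comp f' g' h')) := by
  refine .of_eq rfl rfl fun x hx z hz => ?_
  obtain ⟨x, hx1, x', hx2, rfl⟩ := mem_states_append.1 hx
  obtain ⟨z, hz1, z', hz2, rfl⟩ := mem_states_append.1 hz
  subst h h'
  rw [eval_tensor M _ _ (length_of_mem hx1) (length_of_mem hz1), eval_comp, eval_comp, eval_comp,
    sum_states_append, Finset.sum_mul_sum]
  refine Finset.sum_congr rfl fun y hy => Finset.sum_congr rfl fun y' hy' => ?_
  rw [eval_tensor M _ _ (length_of_mem hx1) (length_of_mem hy),
    eval_tensor M _ _ (length_of_mem hy) (length_of_mem hz1), mul_mul_mul_comm]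

theorem eqv_braid_natural {A B C D : List ℕ+} (f : Diagram A B) (g : Diagram C D) :
    M.Eqv (comp (tensor f g) (braid B D) rfl) (comp (braid A C) (tensor g f) rfl) := by
  refine .of_eq rfl rfl fun x hx z hz => ?_
  obtain ⟨x, hx1, x', hx2, rfl⟩ := mem_states_append.1 hx
  obtain ⟨z, hz1, z', hz2, rfl⟩ := mem_states_append.1 hz
  rw [eval_comp_left M (braid A C) _ _ (w := x' ++ x) (fun y hy => eval_braid M _ _ hx1 hx2 hy)
    (append_mem_states hx2 hx1), eval_comp_right M _ (braid B D) _ (w := z' ++ z) ?_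
    (append_mem_states hz2 hz1), eval_tensor M _ _ (length_of_mem hx1) (length_of_mem hz2),
    eval_tensor M _ _ (length_of_mem hx2) (length_of_mem hz1), mul_comm]
  intro y hy
  obtain ⟨y, hy1, y', hy2, rfl⟩ := mem_states_append.1 hy
  rw [eval_braid M _ _ hy1 hy2 hz, ind_append, ind_append, eq_comm (a := z), eq_comm (a := z'),
    mul_comm]
  · rw [length_of_mem hy1, length_of_mem hz2]
  · rw [length_of_mem hz1, length_of_mem hy2]

theorem eqv_cap_swap (a : ℕ+) : M.Eqv (comp (cap a) (swap a a) rfl) (cap a) := by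
  refine .of_eq rfl rfl fun x _ z hz => ?_
  obtain ⟨p, hp, q, hq, rfl⟩ := mem_states_pair.1 hz
  rw [eval_comp_right M _ _ _ (w := [q, p]) ?_ (by simp [hp, hq]), eval_cap, eval_cap]
  · by_cases h : p = q
    · rw [h]
    · rw [ind_neg h, ind_neg (Ne.symm h), zero_mul, zero_mul]
  · intro y hy
    obtain ⟨p', _, q', _, rfl⟩ := mem_states_pair.1 hy
    rw [eval_swap]
    exact ind_congr (by simp [eq_comm, and_comm])

theorem eqv_snake_left (a : ℕ+) :
    M.Eqv (comp (tensor (cap a) (.id [a])) (tensor (.id [a]) (cup a)) rfl) (.id [a]) := by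
  refine .of_eq rfl rfl fun x hx z hz => ?_
  obtain ⟨p, hp, rfl⟩ := mem_states_singleton.1 hx
  obtain ⟨q, hq, rfl⟩ := mem_states_singleton.1 hz
  have h1 : ∀ u v w, M.eval (tensor (cap a) (.id [a])) [p] [u, v, w]
      = ind K (u = v) * M.gi a u * ind K ([p] = [w]) := fun u v w =>
    eval_tensor M (cap a) (.id [a]) (x := []) (z := [u, v]) (x' := [p]) (z' := [w]) rfl rfl
  have h2 : ∀ u v w, M.eval (tensor (.id [a]) (cup a)) [u, v, w] [q]
      = ind K ([u] = [q]) * (ind K (v = w) * M.g a v) := fun u v w =>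
    eval_tensor_id M (A := [a]) (cup a) (x := [u]) (z := [q]) (x' := [v, w]) (z' := []) rfl rfl
  rw [eval_comp]
  refine (sum_states_append [a, a] [a] _).trans ?_
  rw [sum_states_pair]
  have key : ∀ u ∈ M.S a, ∀ v ∈ M.S a, ∑ w ∈ states M.S [a],
      M.eval (tensor (cap a) (.id [a])) [p] ([u, v] ++ w) *
        M.eval (tensor (.id [a]) (cup a)) ([u, v] ++ w) [q]
      = ind K (v = p) * (ind K (u = v) * (M.gi a u * (ind K ([u] = [q]) * M.g a v))) := by
    intro u hu v hv
    rw [sum_states_singleton]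
    rw [Finset.sum_congr rfl fun w _ => show _ = ind K (w = p) * (ind K (v = w) *
      (ind K (u = v) * (M.gi a u * (ind K ([u] = [q]) * M.g a v)))) from ?_, sum_ind_mul _ _ hp]
    refine (congrArg₂ (· * ·) (h1 u v w) (h2 u v w)).trans ?_
    rw [show ind K ([p] = [w]) = ind K (w = p) from ind_congr (by simp [eq_comm])]
    ring
  rw [Finset.sum_congr rfl fun u hu => Finset.sum_congr rfl fun v hv => key u hu v hv,
    Finset.sum_congr rfl fun u hu => sum_ind_mul _ _ hp _, sum_ind_mul _ _ hp, mul_left_comm,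
    mul_comm (M.gi a p), M.g_mul_gi, mul_one]
  rfl

theorem eqv_snake_right (a : ℕ+) :
    M.Eqv (comp (tensor (.id [a]) (cap a)) (tensor (cup a) (.id [a])) rfl) (.id [a]) := by
  refine .of_eq rfl rfl fun x hx z hz => ?_
  obtain ⟨p, hp, rfl⟩ := mem_states_singleton.1 hx
  obtain ⟨q, hq, rfl⟩ := mem_states_singleton.1 hz
  have h1 : ∀ u v w, M.eval (tensor (.id [a]) (cap a)) [p] [u, v, w]
      = ind K ([p] = [u]) * (ind K (v = w) * M.gi a v) := fun u v w =>
    eval_tensor_id M (A := [a]) (cap a) (x := [p]) (z := [u]) (x' := []) (z' := [v, w]) rfl rfl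
  have h2 : ∀ u v w, M.eval (tensor (cup a) (.id [a])) [u, v, w] [q]
      = ind K (u = v) * M.g a u * ind K ([w] = [q]) := fun u v w =>
    eval_tensor M (cup a) (.id [a]) (x := [u, v]) (z := []) (x' := [w]) (z' := [q]) rfl rfl
  rw [eval_comp]
  refine (sum_states_append [a, a] [a] _).trans ?_
  rw [sum_states_pair]
  have key : ∀ u ∈ M.S a, ∀ v ∈ M.S a, ∑ w ∈ states M.S [a],
      M.eval (tensor (.id [a]) (cap a)) [p] ([u, v] ++ w) *
        M.eval (tensor (cup a) (.id [a])) ([u, v] ++ w) [q]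
      = ind K (u = p) * (ind K (u = v) * (M.gi a v * (ind K ([v] = [q]) * M.g a u))) := by
    intro u hu v hv
    rw [sum_states_singleton]
    rw [Finset.sum_congr rfl fun w _ => show _ = ind K (v = w) * (ind K (u = p) *
      (ind K (u = v) * (M.gi a v * (ind K ([w] = [q]) * M.g a u)))) from ?_, sum_ind_mul' _ _ hv]
    refine (congrArg₂ (· * ·) (h1 u v w) (h2 u v w)).trans ?_
    rw [show ind K ([p] = [u]) = ind K (u = p) from ind_congr (by simp [eq_comm])]
    ring
  rw [Finset.sum_congr rfl fun u hu => Finset.sum_congr rfl fun v hv => key u hu v hv]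
  simp_rw [← Finset.mul_sum]
  rw [sum_ind_mul _ _ hp, sum_ind_mul' _ _ hp, mul_left_comm,
    mul_comm (M.gi a p), M.g_mul_gi, mul_one]
  rfl

theorem eqv_Z_swap_outputs (a : ℕ+) (r : ℂ) (n k l : ℕ) :
    M.Eqv (comp (.Z a r n (k + (2 + l)))
      (tensor (.id (List.replicate k a)) (tensor (swap a a) (.id (List.replicate l a))))
      (replicate_eq a k l)) (.Z a r n (k + (2 + l))) := by
  refine .of_eq rfl (replicate_eq a k l).symm fun x hx z hz => ?_
  obtain ⟨u, hu, w, hw, rfl⟩ := mem_states_append.1 hz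
  obtain ⟨w, hw', v, hv, rfl⟩ := mem_states_append.1 hw
  obtain ⟨p, hp, q, hq, rfl⟩ := mem_states_pair.1 hw'
  rw [eval_comp_right M _ _ _ (w := u ++ ([q, p] ++ v)) (fun y hy => ?_), eval_Z, eval_Z,
    Zt_perm M a r ((perm_swap_mid u v q p).append_left x)]
  · rw [replicate_eq]
    exact append_mem_states hu (append_mem_states (by simp [hp, hq]) hv)
  · rw [replicate_eq] at hy
    exact eval_tensor_swap' M a a _ _ hu hy

theorem eqv_Z_swap_inputs (a : ℕ+) (r : ℂ) (m k l : ℕ) :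
    M.Eqv (comp (tensor (.id (List.replicate k a)) (tensor (swap a a) (.id (List.replicate l a))))
      (.Z a r (k + (2 + l)) m) (replicate_eq a k l).symm) (.Z a r (k + (2 + l)) m) := by
  refine .of_eq (replicate_eq a k l).symm rfl fun x hx z hz => ?_
  obtain ⟨u, hu, w, hw, rfl⟩ := mem_states_append.1 hx
  obtain ⟨w, hw', v, hv, rfl⟩ := mem_states_append.1 hw
  obtain ⟨p, hp, q, hq, rfl⟩ := mem_states_pair.1 hw'
  rw [eval_comp_left M _ _ _ (w := u ++ ([q, p] ++ v)) (fun y hy => ?_), eval_Z, eval_Z,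
    Zt_perm M a r ((perm_swap_mid u v q p).append_right z),
    ((perm_swap_mid u v q p).map (M.g a)).prod_eq]
  · exact append_mem_states hu (append_mem_states (by simp [hp, hq]) hv)
  · exact eval_tensor_swap M a a _ _ hu hy

theorem eqv_Z_bend (a : ℕ+) (r : ℂ) (n m : ℕ) :
    M.Eqv (comp (tensor (cap a) (.id (List.replicate n a)))
      (tensor (.id [a]) (.Z a r (n + 1) m)) rfl) (.Z a r n (m + 1)) := by
  refine .of_eq rfl rfl fun x hx z hz => ?_
  obtain ⟨p, hp, z, hz', rfl⟩ := mem_states_cons.1 hz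
  have h1 : ∀ u v, ∀ w ∈ states M.S (List.replicate n a),
      M.eval (tensor (cap a) (.id (List.replicate n a))) x ([u, v] ++ w)
      = ind K (u = v) * M.gi a u * ind K (x = w) := fun u v w _ =>
    eval_tensor M (cap a) (.id (List.replicate n a)) (x := []) (z := [u, v]) (x' := x) (z' := w)
      rfl rfl
  have h2 : ∀ u v w, M.eval (tensor (.id [a]) (.Z a r (n + 1) m)) ([u, v] ++ w) (p :: z)
      = ind K ([u] = [p]) * (((v :: w).map (M.g a)).prod * M.Zt a r (v :: w ++ z)) :=
    fun u v w => eval_tensor_id M (A := [a]) (.Z a r (n + 1) m) (x := [u]) (z := [p])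
      (x' := v :: w) (z' := z) rfl rfl
  rw [eval_comp]
  refine (sum_states_append [a, a] (List.replicate n a) _).trans ?_
  rw [sum_states_pair]
  have key : ∀ u ∈ M.S a, ∀ v ∈ M.S a, ∑ w ∈ states M.S (List.replicate n a),
      M.eval (tensor (cap a) (.id (List.replicate n a))) x ([u, v] ++ w) *
        M.eval (tensor (.id [a]) (.Z a r (n + 1) m)) ([u, v] ++ w) (p :: z)
      = ind K (u = v) * (ind K (u = p) * (M.gi a u *
        (((v :: x).map (M.g a)).prod * M.Zt a r (v :: x ++ z)))) := by
    intro u hu v hv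
    rw [Finset.sum_congr rfl fun w hw => show _ = ind K (x = w) * (ind K (u = v) *
      (ind K (u = p) * (M.gi a u *
        (((v :: w).map (M.g a)).prod * M.Zt a r (v :: w ++ z))))) from ?_]
    · exact sum_ind_mul' _ _ hx _
    rw [h1 u v w hw, h2, show ind K ([u] = [p]) = ind K (u = p) from ind_congr (by simp)]
    generalize ((v :: w).map (M.g a)).prod * M.Zt a r (v :: w ++ z) = t
    ring
  rw [Finset.sum_congr rfl fun u hu => Finset.sum_congr rfl fun v hv => key u hu v hv,
    Finset.sum_congr rfl fun u hu => sum_ind_mul' _ _ hu _, sum_ind_mul _ _ hp, eval_Z,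
    List.map_cons, List.prod_cons,
    ← Zt_perm M a r (l := p :: x ++ z) (l' := x ++ p :: z) List.perm_middle.symm,
    ← mul_assoc, ← mul_assoc, mul_comm (M.gi a p), M.g_mul_gi, one_mul]

theorem eqv_W_swap_outputs (a : ℕ+) (bs : List ℕ+) (b b' : ℕ+) (bs' : List ℕ+)
    (h : ∀ x ∈ bs ++ ([b, b'] ++ bs'), x ≤ a) (h' : ∀ x ∈ bs ++ ([b', b] ++ bs'), x ≤ a) :
    M.Eqv (comp (.W a (bs ++ ([b, b'] ++ bs')) h)
      (tensor (.id bs) (tensor (swap b b') (.id bs'))) rfl) (.W a (bs ++ ([b', b] ++ bs')) h') := by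
  refine .of_eq rfl rfl fun x hx z hz => ?_
  obtain ⟨k, hk, rfl⟩ := mem_states_singleton.1 hx
  obtain ⟨u, hu, w, hw, rfl⟩ := mem_states_append.1 hz
  obtain ⟨w, hw', v, hv, rfl⟩ := mem_states_append.1 hw
  obtain ⟨p, hp, q, hq, rfl⟩ := mem_states_pair.1 hw'
  rw [eval_comp_right M _ _ _ (w := u ++ ([q, p] ++ v)) (fun y hy => ?_), eval_W, eval_W,
    merge_perm M (perm_swap_mid u v p q), wti_append M (length_of_mem hu),
    wti_append M (length_of_mem hu), wti_append M rfl, wti_append M rfl]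
  · simp only [wti_cons, wti_nil]
    ring
  · exact append_mem_states hu (append_mem_states (by simp [hp, hq]) hv)
  · exact eval_tensor_swap' M b b' _ _ hu hy

/-- Every structural equation holds in every interpretation. -/
theorem eqv_of_structural {A B A' B' : List ℕ+} {f : Diagram A B} {g : Diagram A' B'}
    (h : Structural f g) : M.Eqv f g := by
  cases h with
  | comp_assoc f g k h h' => exact .of_eq rfl rfl fun x _ z _ => eval_comp_assoc M f g k h h' x z
  | id_comp f h =>
    exact .of_eq h rfl fun x hx z _ =>
      eval_comp_left M _ _ h (fun y _ => by rw [eval_id]; exact ind_congr eq_comm) hx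
  | comp_id f h =>
    exact .of_eq rfl h.symm fun x _ z hz =>
      eval_comp_right M _ _ h (fun y _ => by rw [eval_id]) (h ▸ hz)
  | tensor_assoc f g k => exact eqv_tensor_assoc M f g k
  | empty_tensor f =>
    refine .of_eq rfl rfl fun x hx z hz => ?_
    refine (eval_tensor_id M (A := []) g (x := []) (x' := x) (z := []) (z' := z) rfl rfl).trans ?_
    rw [ind_pos rfl, one_mul]
  | tensor_empty f => exact eqv_tensor_empty M _
  | id_tensor_id A B => exact eqv_id_tensor_id M A B
  | interchange f g f' g' h h' => exact eqv_interchange M f g f' g' h h'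
  | swap_swap a b =>
    refine .of_eq rfl rfl fun x hx z hz => ?_
    obtain ⟨p, hp, q, hq, rfl⟩ := mem_states_pair.1 hx
    rw [eval_comp_left M _ _ _ (fun y _ => eval_swap M a b p q y) (by simp [hp, hq]), eval_swap,
      eval_id]
    exact ind_congr eq_comm
  | braid_natural f g => exact eqv_braid_natural M f g
  | cap_swap a => exact eqv_cap_swap M a
  | snake_left a => exact eqv_snake_left M a
  | snake_right a => exact eqv_snake_right M a
  | Z_swap_outputs a r n k l => exact eqv_Z_swap_outputs M a r n k l
  | Z_swap_inputs a r m k l => exact eqv_Z_swap_inputs M a r m k l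
  | Z_bend a r n m => exact eqv_Z_bend M a r n m
  | W_swap_outputs a bs b b' bs' h h' => exact eqv_W_swap_outputs M a bs b b' bs' h h'

end Structural

end Interp

/-- Induction on derivations: a family of interpretations, indexed by `ι`, in which every instance
of every schema of `S` holds eventually along a filter. -/
theorem eventually_eqv_of_derivable {ι : Type*} {K X : ι → Type} [∀ i, CommSemiring (K i)]
    [∀ i, AddCommMonoid (X i)] (M : ∀ i, Interp (K i) (X i)) (l : Filter ι) {S : Set Rule}
    (hS : ∀ R ∈ S, ∀ {A B A' B' : List ℕ+} {f : Diagram A B} {g : Diagram A' B'},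
      Instance R f g → ∀ᶠ i in l, (M i).Eqv f g)
    {A B A' B' : List ℕ+} {f : Diagram A B} {g : Diagram A' B'} (h : Derivable S f g) :
    ∀ᶠ i in l, (M i).Eqv f g := by
  induction h with
  | structural h => exact .of_forall fun i => (M i).eqv_of_structural h
  | rule R hR h => exact hS R hR h
  | refl f => exact .of_forall fun i => .refl f
  | symm _ ih => exact ih.mono fun i h => h.symm
  | trans _ _ ih ih' => filter_upwards [ih, ih'] with i h h' using h.trans h'
  | comp h h' _ _ ih ih' => filter_upwards [ih, ih'] with i hf hg using hf.comp h h' hg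
  | tensor _ _ ih ih' => filter_upwards [ih, ih'] with i hf hg using hf.tensor hg

theorem eqv_of_derivable {K X : Type} [CommSemiring K] [AddCommMonoid X] (M : Interp K X)
    {S : Set Rule} (hS : ∀ R ∈ S, ∀ {A B A' B' : List ℕ+} {f : Diagram A B} {g : Diagram A' B'},
      Instance R f g → M.Eqv f g)
    {A B A' B' : List ℕ+} {f : Diagram A B} {g : Diagram A' B'} (h : Derivable S f g) :
    M.Eqv f g := by
  simpa using eventually_eqv_of_derivable (ι := Unit) (fun _ => M) ⊤
    (fun R hR {_ _ _ _ _ _} h => by simpa using hS R hR h) h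

namespace Interp

/-! ### Conditions under which an interpretation satisfies an equation -/

section Rules

variable {K X : Type} [CommSemiring K] [AddCommMonoid X]

/-- The compatibility of the labels of wires and of their sectors with addition. -/
structure Graded (M : Interp K X) : Prop where
  zero_mem : ∀ a, 0 ∈ M.S a
  add_mem : ∀ {a b c : ℕ+} {x y : X}, x ∈ M.S a → y ∈ M.S b → a + b ≤ c → x + y ∈ M.S c
  mem_of_add_mem : ∀ {a : ℕ+} {x y : X}, x + y ∈ M.S a → x ∈ M.S a
  eq_zero_of_add : ∀ {x y : X}, x + y = 0 → x = 0
  mono : ∀ {a b : ℕ+}, a ≤ b → M.S a ⊆ M.S b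
  π_π : ∀ x, M.π (M.π x) = M.π x
  π_add : ∀ x y, M.π (x + y) = M.π x + M.π y
  π_mem : ∀ {a x}, M.π x ∈ M.S a ↔ x ∈ M.S a
  pure_of_add : ∀ {x y}, M.π (x + y) = x + y → M.π x = x
  eq_zero_of_π : ∀ {x}, M.π x = 0 → x = 0

/-- The laws of the Z-spider tensors of capacity `a` in each sector: those of a special commutative
Frobenius algebra, except that the removal of loops is not required. -/
structure Fused (M : Interp K X) (a : ℕ+) : Prop where
  fuse : ∀ k ∈ M.S a, M.π k = k → ∀ l l' : List X, (∀ x ∈ l, x ∈ M.S a ∧ M.π x = k) →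
    (∀ x ∈ l', x ∈ M.S a ∧ M.π x = k) →
    open Classical in ∑ p ∈ M.S a with M.π p = k, M.T a k (l ++ [p]) * M.g a p * M.T a k (p :: l')
      = M.T a k (l ++ l')
  unit : ∀ k ∈ M.S a, M.π k = k → ∀ l : List X, (∀ x ∈ l, x ∈ M.S a ∧ M.π x = k) →
    M.T a k (k :: l) = M.T a k l
  pair : ∀ k ∈ M.S a, M.π k = k → ∀ x ∈ M.S a, M.π x = k → ∀ y ∈ M.S a, M.π y = k →
    M.T a k [x, y] = ind K (x = y) * M.gi a x

variable {M : Interp K X}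

theorem Graded.π_zero (hM : M.Graded) : M.π 0 = 0 :=
  hM.pure_of_add (y := M.π 0) (by rw [zero_add, hM.π_π])

theorem Graded.mem_of_add_mem' (hM : M.Graded) {a : ℕ+} {x y : X} (h : x + y ∈ M.S a) :
    y ∈ M.S a :=
  hM.mem_of_add_mem (y := x) (by rwa [add_comm])

theorem Graded.eq_zero_of_add' (hM : M.Graded) {x y : X} (h : x + y = 0) : y = 0 :=
  hM.eq_zero_of_add (y := x) (by rwa [add_comm])

theorem Graded.add_eq_zero (hM : M.Graded) {x y : X} : x + y = 0 ↔ x = 0 ∧ y = 0 :=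
  ⟨fun h => ⟨hM.eq_zero_of_add h, hM.eq_zero_of_add' h⟩, by rintro ⟨rfl, rfl⟩; simp⟩

theorem Graded.sum_mem (hM : M.Graded) {as : List ℕ+} {x : List X} (hx : x ∈ states M.S as)
    {b : ℕ+} (h : (as.map PNat.val).sum ≤ b) : x.sum ∈ M.S b := by
  induction as generalizing x b with
  | nil => simp at hx; subst hx; simpa using hM.zero_mem b
  | cons a as ih =>
    obtain ⟨p, hp, y, hy, rfl⟩ := mem_states_cons.1 hx
    rw [List.map_cons, List.sum_cons] at h
    rw [List.sum_cons]
    rcases Nat.eq_zero_or_pos (as.map PNat.val).sum with h0 | h0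
    · cases as with
      | nil =>
        simp at hy
        subst hy
        simp only [List.map_nil, List.sum_nil, add_zero] at h ⊢
        exact hM.mono h hp
      | cons b as => simp at h0
    · refine hM.add_mem (b := ⟨_, h0⟩) hp (ih hy le_rfl) ?_
      exact h

theorem Graded.mem_of_mem_sum (hM : M.Graded) {a : ℕ+} {x : List X} {p : X} (hp : p ∈ x)
    (h : x.sum ∈ M.S a) : p ∈ M.S a := by
  induction x with
  | nil => simp at hp
  | cons q x ih =>
    rw [List.sum_cons] at h
    rcases List.mem_cons.1 hp with rfl | hp
    · exact hM.mem_of_add_mem h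
    · exact ih hp (hM.mem_of_add_mem' h)

theorem Graded.sum_eq_zero (hM : M.Graded) {x : List X} : x.sum = 0 ↔ ∀ p ∈ x, p = 0 := by
  induction x with
  | nil => simp
  | cons q x ih => rw [List.sum_cons, hM.add_eq_zero, ih]; simp

theorem Graded.π_sum (hM : M.Graded) (x : List X) : M.π x.sum = (x.map M.π).sum := by
  induction x with
  | nil => simpa using hM.π_zero
  | cons q x ih => rw [List.sum_cons, hM.π_add, ih, List.map_cons, List.sum_cons]

theorem Graded.pure_of_sum (hM : M.Graded) {x : List X} (h : M.π x.sum = x.sum) :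
    ∀ p ∈ x, M.π p = p := by
  induction x with
  | nil => simp
  | cons q x ih =>
    rw [List.sum_cons] at h
    have h' := h
    rw [add_comm] at h'
    simp only [List.mem_cons, forall_eq_or_imp]
    exact ⟨hM.pure_of_add h, ih (hM.pure_of_add h')⟩

/-- The label of one leg of a Z-spider determines the sector of the others. -/
theorem Graded.Zt_cons (hM : M.Graded) {a : ℕ+} (r : ℂ) {p : X} (hp : p ∈ M.S a) (l : List X) :
    M.Zt a r (p :: l) =
      ind K (∀ x ∈ l, M.π x = M.π p) * (M.ρ (M.π p) r * M.T a (M.π p) (p :: l)) := by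
  classical
  rw [Zt, Finset.sum_eq_single_of_mem (M.π p)]
  · congr 1
    exact ind_congr (by simp)
  · exact Finset.mem_filter.2 ⟨hM.π_mem.2 hp, hM.π_π p⟩
  · intro k _ hk
    rw [ind_neg, zero_mul]
    intro h
    exact hk (h p (by simp)).symm

theorem Fused.T_replicate {a : ℕ+} (hF : M.Fused a) {k : X} (hk : k ∈ M.S a) (hk' : M.π k = k)
    (n : ℕ) : M.T a k (List.replicate (n + 1) k) = M.gi a k := by
  induction n with
  | zero =>
    rw [zero_add, List.replicate_one, ← hF.unit k hk hk' [k] (by simp [hk, hk']),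
      hF.pair k hk hk' k hk hk' k hk hk', ind_pos rfl, one_mul]
  | succ n ih =>
    rw [List.replicate_succ, hF.unit k hk hk' _ ?_, ih]
    intro x hx
    rw [List.eq_of_mem_replicate hx]
    exact ⟨hk, hk'⟩

theorem Fused.T_singleton {a : ℕ+} (hF : M.Fused a) {k : X} (hk : k ∈ M.S a) (hk' : M.π k = k)
    {x : X} (hx : x ∈ M.S a) (hx' : M.π x = k) : M.T a k [x] = ind K (x = k) * M.gi a k := by
  rw [← hF.unit k hk hk' [x] (by simp [hx, hx']), hF.pair k hk hk' k hk hk' x hx hx']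
  congr 1
  exact ind_congr eq_comm

/-- A Z-spider with one leg. -/
theorem Fused.Zt_singleton {a : ℕ+} (hM : M.Graded) (hF : M.Fused a) (r : ℂ) {x : X}
    (hx : x ∈ M.S a) : M.Zt a r [x] = ind K (M.π x = x) * (M.ρ x r * M.gi a x) := by
  rw [hM.Zt_cons r hx, hF.T_singleton (hM.π_mem.2 hx) (hM.π_π x) hx rfl, ind_pos (by simp), one_mul,
    mul_left_comm, ind_congr (eq_comm (a := x))]
  exact ind_mul_congr fun h => by rw [h]

theorem Fused.g_mul_Zt_singleton {a : ℕ+} (hM : M.Graded) (hF : M.Fused a) (r : ℂ) {x : X}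
    (hx : x ∈ M.S a) : M.g a x * M.Zt a r [x] = ind K (M.π x = x) * M.ρ x r := by
  rw [hF.Zt_singleton hM r hx]
  calc _ = ind K (M.π x = x) * M.ρ x r * (M.g a x * M.gi a x) := by ring
    _ = _ := by rw [M.g_mul_gi, mul_one]

theorem Fused.sum_Zt_mul_Zt {a : ℕ+} (hM : M.Graded) (hF : M.Fused a) {r t : ℂ}
    (hρ : ∀ k ∈ M.S a, M.π k = k → M.ρ k (r * t) = M.ρ k r * M.ρ k t) {l l' : List X}
    (hl : ∀ x ∈ l, x ∈ M.S a) (hl' : ∀ x ∈ l', x ∈ M.S a) :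
    ∑ p ∈ M.S a, M.Zt a r (l ++ [p]) * M.g a p * M.Zt a t (p :: l') = M.Zt a (r * t) (l ++ l') := by
  classical
  rw [← Finset.sum_fiberwise_of_maps_to (s := M.S a) (t := {k ∈ M.S a | M.π k = k}) (g := M.π)
    (fun p hp => Finset.mem_filter.2 ⟨hM.π_mem.2 hp, hM.π_π p⟩), Zt]
  refine Finset.sum_congr (by congr) fun k hk => ?_
  obtain ⟨hk, hk'⟩ := Finset.mem_filter.1 hk
  have key : ∀ p ∈ M.S a, M.π p = k → M.Zt a r (l ++ [p]) * M.g a p * M.Zt a t (p :: l')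
      = ind K (∀ x ∈ l ++ l', M.π x = k) * (M.ρ k (r * t) *
        (M.T a k (l ++ [p]) * M.g a p * M.T a k (p :: l'))) := by
    intro p hp hpk
    rw [Zt_perm M a r (l' := p :: l) List.perm_append_comm, hM.Zt_cons r hp, hM.Zt_cons t hp, hpk,
      M.T_perm a k (p :: l) (l ++ [p]) (List.perm_append_comm (l₁ := [p])),
      hρ k hk hk', ind_congr (List.forall_mem_append (p := fun x => M.π x = k)), ind_and]
    ring
  rw [Finset.sum_congr rfl fun p hp => key p (Finset.mem_filter.1 hp).1 (Finset.mem_filter.1 hp).2,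
    ← Finset.mul_sum, ← Finset.mul_sum]
  refine ind_mul_congr fun h => ?_
  rw [← hF.fuse k hk hk' l l' (fun x hx => ⟨hl x hx, h x (by simp [hx])⟩)
    (fun x hx => ⟨hl' x hx, h x (by simp [hx])⟩)]

theorem mem_of_mem_states_replicate {a : ℕ+} {n : ℕ} {l : List X}
    (h : l ∈ states M.S (List.replicate n a)) : ∀ p ∈ l, p ∈ M.S a :=
  (mem_states_replicate.1 h).2

theorem eqv_s (hM : M.Graded) {a : ℕ+} (hF : M.Fused a) {r t : ℂ}
    (hρ : ∀ k ∈ M.S a, M.π k = k → M.ρ k (r * t) = M.ρ k r * M.ρ k t) (n m n' m' : ℕ) (h) :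
    M.Eqv (comp (tensor (.Z a r n (m + 1)) (.id (List.replicate n' a)))
      (tensor (.id (List.replicate m a)) (.Z a t (1 + n') m')) h)
      (.Z a (r * t) (n + n') (m + m')) := by
  refine .of_eq (by simp [← List.replicate_append_replicate])
    (by simp [← List.replicate_append_replicate]) fun x hx z hz => ?_
  obtain ⟨x, hx1, x', hx2, rfl⟩ := mem_states_append.1 hx
  obtain ⟨z, hz1, z', hz2, rfl⟩ := mem_states_append.1 hz
  have e : List.replicate (m + 1) a ++ List.replicate n' a
      = List.replicate m a ++ ([a] ++ List.replicate n' a) := by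
    rw [List.replicate_succ', List.append_assoc]
  have h1 : ∀ u ∈ states M.S (List.replicate m a), ∀ p, ∀ v,
      M.eval (tensor (.Z a r n (m + 1)) (.id (List.replicate n' a))) (x ++ x') (u ++ ([p] ++ v))
      = (x.map (M.g a)).prod * M.Zt a r (x ++ (u ++ [p])) * ind K (x' = v) := by
    intro u hu p v
    have := eval_tensor M (.Z a r n (m + 1)) (.id (List.replicate n' a)) (x := x) (x' := x')
      (z := u ++ [p]) (z' := v) (length_of_mem hx1) (by simpa using length_of_mem hu)
    rw [List.append_assoc] at this
    exact this
  have h2 : ∀ u ∈ states M.S (List.replicate m a), ∀ p v,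
      M.eval (tensor (.id (List.replicate m a)) (.Z a t (1 + n') m')) (u ++ ([p] ++ v)) (z ++ z')
      = ind K (u = z) * ((([p] ++ v).map (M.g a)).prod * M.Zt a t ([p] ++ v ++ z')) :=
    fun u hu p v => eval_tensor_id M _ (length_of_mem hu) (length_of_mem hz1)
  rw [eval_comp]
  refine (Finset.sum_congr (congrArg (states M.S) e) fun _ _ => rfl).trans
    ((sum_states_append (List.replicate m a) ([a] ++ List.replicate n' a) _).trans ?_)
  have h3 : ∀ u ∈ states M.S (List.replicate m a),
      ∑ y ∈ states M.S ([a] ++ List.replicate n' a),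
        M.eval (tensor (.Z a r n (m + 1)) (.id (List.replicate n' a))) (x ++ x') (u ++ y) *
        M.eval (tensor (.id (List.replicate m a)) (.Z a t (1 + n') m')) (u ++ y) (z ++ z')
      = ind K (u = z) * (((x ++ x').map (M.g a)).prod *
        ∑ p ∈ M.S a, M.Zt a r ((x ++ u) ++ [p]) * M.g a p * M.Zt a t (p :: (x' ++ z'))) := by
    intro u hu
    rw [sum_states_append, sum_states_singleton, Finset.mul_sum, Finset.mul_sum]
    refine Finset.sum_congr rfl fun p hp => ?_
    rw [Finset.sum_congr rfl fun v hv => show _ = ind K (x' = v) * (ind K (u = z) *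
      (((x ++ v).map (M.g a)).prod *
        (M.Zt a r ((x ++ u) ++ [p]) * M.g a p * M.Zt a t (p :: (v ++ z'))))) from ?_]
    · exact sum_ind_mul' _ _ hx2 _
    rw [h1 u hu p v, h2 u hu p v, List.map_append, List.prod_append, List.map_append,
      List.prod_append, List.map_singleton, List.prod_singleton, List.append_assoc x u [p],
      List.append_assoc [p], List.singleton_append]
    ring
  rw [Finset.sum_congr rfl h3]
  refine (sum_ind_mul _ _ hz1 _).trans ?_
  rw [hF.sum_Zt_mul_Zt hM hρ, eval_Z]
  · congr 1
    refine Zt_perm M _ _ ?_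
    rw [List.append_assoc, List.append_assoc]
    refine List.Perm.append_left _ ?_
    rw [← List.append_assoc, ← List.append_assoc]
    exact List.perm_append_comm.append_right _
  · simp only [List.mem_append]
    rintro y (hy | hy)
    exacts [mem_of_mem_states_replicate hx1 y hy, mem_of_mem_states_replicate hz1 y hy]
  · simp only [List.mem_append]
    rintro y (hy | hy)
    exacts [mem_of_mem_states_replicate hx2 y hy, mem_of_mem_states_replicate hz2 y hy]

theorem eqv_W_id (hQ : M.Q 1) (a : ℕ+) (h) : M.Eqv (.W a [a] h) (.id [a]) := by
  refine .of_eq rfl rfl fun x hx z hz => ?_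
  obtain ⟨k, hk, rfl⟩ := mem_states_singleton.1 hx
  obtain ⟨p, hp, rfl⟩ := mem_states_singleton.1 hz
  rw [eval_W, wti_cons, wti_nil, eval_id, merge, List.length_singleton, List.sum_singleton,
    ind_pos (Or.inl hQ : M.Q 1 ∨ k = 0), mul_one, mul_one, mul_assoc,
    show ind K ([k] = [p]) = ind K (p = k) from ind_congr (by simp [eq_comm]),
    ← mul_one (ind K (p = k)), mul_assoc, one_mul]
  exact ind_mul_congr fun h => by rw [h, M.g_mul_gi]

theorem merge_splice (hM : M.Graded) (hQ : (∀ n, M.Q n) ∨ ∀ n, ¬M.Q n) {u v w : List X} {k : X}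
    {b : ℕ+} (hw : (u ++ (w ++ v)).sum = k → w.sum ∈ M.S b) :
    ∑ p ∈ M.S b, M.merge (u ++ ([p] ++ v)) k * M.merge w p = M.merge (u ++ (w ++ v)) k := by
  have e : (u ++ (w ++ v)).sum = (u ++ ([w.sum] ++ v)).sum := by simp
  by_cases h : (u ++ (w ++ v)).sum = k
  · rw [Finset.sum_eq_single_of_mem _ (hw h)]
    · rw [merge, merge, merge, ← e]
      rcases hQ with hQ | hQ
      · simp [ind_pos, hQ, h]
      · simp only [hQ, false_or, ind_pos h, one_mul]
        rw [← ind_and, ← ind_and]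
        refine ind_congr (K := K) (p := k = 0 ∧ True ∧ w.sum = 0) ⟨fun h => h.1, fun h0 => ⟨h0,
          trivial, ?_⟩⟩
        rw [← h, List.sum_append, List.sum_append, hM.add_eq_zero, hM.add_eq_zero] at h0
        exact h0.2.1
    · intro p _ hp
      rw [merge, merge, ind_neg (p := w.sum = p) (Ne.symm hp)]
      simp
  · rw [merge, ind_neg h, zero_mul]
    refine Finset.sum_eq_zero fun p _ => ?_
    by_cases hp : w.sum = p
    · subst hp
      rw [merge, ← e, ind_neg h]
      simp
    · rw [merge, merge, ind_neg hp]
      simp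

theorem eqv_a (hM : M.Graded) (hQ : (∀ n, M.Q n) ∨ ∀ n, ¬M.Q n) (c b : ℕ+) (as ds ds' : List ℕ+)
    (hc : ∀ x ∈ ds ++ ([b] ++ ds'), x ≤ c) (hb : ∀ x ∈ as, x ≤ b)
    (hcap : b = c ∨ (as.map PNat.val).sum ≤ b) (hc' : ∀ x ∈ ds ++ (as ++ ds'), x ≤ c) :
    M.Eqv (comp (.W c (ds ++ ([b] ++ ds')) hc) (tensor (.id ds) (tensor (.W b as hb) (.id ds')))
      rfl)
        (.W c (ds ++ (as ++ ds')) hc') := by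
  refine .of_eq rfl rfl fun x hx z hz => ?_
  obtain ⟨k, hk, rfl⟩ := mem_states_singleton.1 hx
  obtain ⟨u, hu, w', hw', rfl⟩ := mem_states_append.1 hz
  obtain ⟨w, hw, v, hv, rfl⟩ := mem_states_append.1 hw'
  rw [eval_comp, sum_states_append]
  have h1 : ∀ u' ∈ states M.S ds, ∀ p ∈ M.S b, ∀ v' ∈ states M.S ds',
      M.eval (tensor (.id ds) (tensor (.W b as hb) (.id ds'))) (u' ++ ([p] ++ v')) (u ++ (w ++ v))
      = ind K (u' = u) * (M.merge w p * M.g b p * M.wti as w * ind K (v' = v)) := by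
    intro u' hu' p hp v' hv'
    refine (eval_tensor_id M _ (length_of_mem hu') (length_of_mem hu)).trans ?_
    exact congrArg _ (eval_tensor M (.W b as hb) (.id ds') (x := [p]) rfl (length_of_mem hw))
  have h2 : ∀ u' ∈ states M.S ds, ∑ y ∈ states M.S ([b] ++ ds'),
      M.eval (.W c (ds ++ ([b] ++ ds')) hc) [k] (u' ++ y) *
      M.eval (tensor (.id ds) (tensor (.W b as hb) (.id ds'))) (u' ++ y) (u ++ (w ++ v))
      = ind K (u' = u) * (M.g c k * M.wti ds u' * M.wti as w * M.wti ds' v *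
        ∑ p ∈ M.S b, M.merge (u' ++ ([p] ++ v)) k * M.merge w p) := by
    intro u' hu'
    rw [sum_states_append, sum_states_singleton, Finset.mul_sum, Finset.mul_sum]
    refine Finset.sum_congr rfl fun p hp => ?_
    rw [Finset.sum_congr rfl fun v' hv' => show _ = ind K (v' = v) * (ind K (u' = u) *
      (M.g c k * M.wti ds u' * M.wti as w * M.wti ds' v' *
        (M.merge (u' ++ ([p] ++ v')) k * M.merge w p))) from ?_]
    · exact sum_ind_mul _ _ hv _
    rw [h1 u' hu' p hp v' hv', eval_W, wti_append M (length_of_mem hu'), wti_append M rfl, wti_cons,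
      wti_nil]
    calc _ = (ind K (v' = v) * (ind K (u' = u) *
      (M.g c k * M.wti ds u' * M.wti as w * M.wti ds' v' *
        (M.merge (u' ++ ([p] ++ v')) k * M.merge w p)))) * (M.g b p * M.gi b p) := by ring
      _ = _ := by rw [M.g_mul_gi, mul_one]
  rw [Finset.sum_congr rfl h2]
  refine (sum_ind_mul _ _ hu _).trans ?_
  rw [merge_splice hM hQ, eval_W, wti_append M (length_of_mem hu), wti_append M (length_of_mem hw)]
  · ring
  · intro h
    rcases hcap with rfl | hcap
    · rw [← h, List.sum_append, List.sum_append] at hk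
      exact hM.mem_of_add_mem (hM.mem_of_add_mem' hk)
    · exact hM.sum_mem hw hcap

theorem eqv_plus (hM : M.Graded) {a : ℕ+} (hF : M.Fused a) {r t : ℂ}
    (hρ : ∀ k ∈ M.S a, M.π k = k → ∑ x ∈ M.S a, ∑ y ∈ M.S a, ind K (x + y = k) *
      (M.g a k * M.gi a x * M.gi a y * M.ρ x r * M.ρ y t) * ind K (M.Q 2 ∨ k = 0)
        = M.ρ k (r + t)) (h) :
    M.Eqv (comp (.W a [a, a] h) (tensor (.Z a r 1 0) (.Z a t 1 0)) rfl) (.Z a (r + t) 1 0) := by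
  refine .of_eq rfl rfl fun x hx z hz => ?_
  obtain ⟨k, hk, rfl⟩ := mem_states_singleton.1 hx
  obtain rfl : z = [] := by simpa using hz
  have h1 : ∀ x y, M.eval (tensor (.Z a r 1 0) (.Z a t 1 0)) [x, y] []
      = M.g a x * M.Zt a r [x] * (M.g a y * M.Zt a t [y]) := by
    intro x y
    refine (eval_tensor M (.Z a r 1 0) (.Z a t 1 0) (x := [x]) (x' := [y]) (z := []) (z' := [])
      rfl rfl).trans ?_
    rw [eval_Z, eval_Z]
    simp
  rw [eval_comp, sum_states_pair, eval_Z, List.map_singleton, List.prod_singleton, List.append_nil,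
    hF.g_mul_Zt_singleton hM _ hk]
  have h2 : ∀ x ∈ M.S a, ∀ y ∈ M.S a, M.eval (.W a [a, a] h) [k] [x, y] *
      M.eval (tensor (.Z a r 1 0) (.Z a t 1 0)) [x, y] []
      = ind K (M.π k = k) * (ind K (x + y = k) *
      (M.g a k * M.gi a x * M.gi a y * M.ρ x r * M.ρ y t) * ind K (M.Q 2 ∨ k = 0)) := by
    intro x hx y hy
    rw [h1, hF.g_mul_Zt_singleton hM _ hx, hF.g_mul_Zt_singleton hM _ hy, eval_W, wti_cons,
      wti_cons, wti_nil, merge, List.sum_cons, List.sum_singleton]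
    have : ind K (x + y = k) * (ind K (M.π x = x) * ind K (M.π y = y))
        = ind K (x + y = k) * ind K (M.π k = k) := by
      rw [← ind_and]
      refine ind_mul_congr ?_
      rintro rfl
      refine ind_congr ⟨fun h => by rw [hM.π_add, h.1, h.2], fun h => ⟨hM.pure_of_add h, ?_⟩⟩
      rw [add_comm] at h
      exact hM.pure_of_add h
    calc _ = (ind K (x + y = k) * (ind K (M.π x = x) * ind K (M.π y = y))) *
          ((M.g a k * M.gi a x * M.gi a y * M.ρ x r * M.ρ y t) * ind K (M.Q 2 ∨ k = 0)) := by
          simp only [List.length_cons, List.length_nil, zero_add, one_add_one_eq_two]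
          ring
      _ = _ := by rw [this]; ring
  rw [Finset.sum_congr rfl fun x hx => Finset.sum_congr rfl fun y hy => h2 x hx y hy]
  simp_rw [← Finset.mul_sum]
  exact ind_mul_congr fun h => hρ k hk h

theorem flatMap_const_singleton {α : Type} (l : List α) (a : ℕ+) :
    (l.flatMap fun _ => [a]) = List.replicate l.length a := by
  induction l with
  | nil => rfl
  | cons i l ih => rw [List.flatMap_cons, ih, List.length_cons, List.replicate_succ]; rfl

theorem eval_par_one (a : ℕ+) {α : Type} (l : List α) {z : List X}
    (hz : z ∈ states M.S (List.replicate l.length a)) :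
    M.eval (par (fun _ => []) (fun _ => [a]) (fun _ => .one a) l) [] z
      = ind K (∀ x ∈ z, x = M.one a) := by
  induction l generalizing z with
  | nil =>
    obtain rfl : z = [] := by simpa using hz
    refine (ind_pos rfl).trans (ind_pos ?_).symm
    simp
  | cons i l ih =>
    rw [List.length_cons, List.replicate_succ] at hz
    obtain ⟨p, hp, z, hz', rfl⟩ := mem_states_cons.1 hz
    refine (eval_tensor M (.one a) _ (x := []) (x' := []) (z := [p]) (z' := z) rfl rfl).trans ?_
    rw [eval_one, ih hz', ← ind_and]
    exact ind_congr (by simp)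

theorem eqv_cp (hM : M.Graded) {a : ℕ+} (hF : M.Fused a) (hone : M.one a ∈ M.S a)
    (hpure : ∀ x, M.π x = M.one a ↔ x = M.one a) {r : ℂ}
    (hρ : ∃ c : Kˣ, M.ρ (M.one a) r = c * M.sc r) (n : ℕ) :
    M.Eqv (comp (.one a) (.Z a r 1 n) rfl)
      (tensor (scalar r) (par (fun _ => []) (fun _ => [a]) (fun _ => .one a) (List.range n))) := by
  obtain ⟨c, hc⟩ := hρ
  have e : List.replicate n a = (List.range n).flatMap fun _ => [a] := by
    rw [flatMap_const_singleton, List.length_range]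
  refine ⟨by simp, e, c, fun x hx z hz => ?_⟩
  obtain rfl : x = [] := by simpa using hx
  rw [eval_comp_left M (w := [M.one a]) _ _ _ (fun y _ => M.eval_one a _ _) (by simp [hone])]
  have h1 := eval_tensor M (scalar r)
    (par (fun _ => []) (fun _ => [a]) (fun _ => Diagram.one a) (List.range n)) (x := []) (x' := [])
    (z := []) (z' := z) rfl rfl
  refine Eq.trans ?_ (congrArg _ h1.symm)
  rw [eval_scalar, eval_par_one a _ (by simpa using hz), eval_Z, List.map_singleton,
    List.prod_singleton, List.singleton_append, hM.Zt_cons r hone, (hpure _).2 rfl, hc,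
    ← mul_assoc (c : K), mul_comm _ (ind K _), mul_left_comm, ind_congr
      (forall_congr' fun x => forall_congr' fun _ => hpure x)]
  refine ind_mul_congr fun h => ?_
  obtain rfl : z = List.replicate n (M.one a) :=
    List.eq_replicate_iff.2 ⟨by simpa using length_of_mem hz, h⟩
  rw [← List.replicate_succ, hF.T_replicate hone ((hpure _).2 rfl)]
  calc _ = c * M.sc r * (M.g a (M.one a) * M.gi a (M.one a)) := by ring
    _ = _ := by rw [M.g_mul_gi, mul_one]

theorem eqv_h (hM : M.Graded) {a b : ℕ+} (hFa : M.Fused a) (hFb : M.Fused b) (n : ℕ)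
    (hρ0 : ∀ k ∈ M.S a, M.π k = k → M.ρ k 0 = ind K (k = 0)) (hρ1 : M.ρ 0 1 = 1)
    (hg : M.g a 0 = 1) (hg' : M.g b 0 = 1)
    (hρ : ∀ x ∈ M.S b, M.π x = x → ∀ y ∈ states M.S (List.replicate n b), (∀ p ∈ y, M.π p = x) →
      y.sum ∈ M.S a → x = 0 ∨ M.ρ x 1 = 0) (hab) (he) :
    M.Eqv (comp (.Z b 1 1 n) (coW a (List.replicate n b) hab) rfl)
      (tensor (.W b [] he) (.Z a 0 0 1)) := by
  refine .of_eq rfl rfl fun x hx z hz => ?_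
  obtain ⟨k, hk, rfl⟩ := mem_states_singleton.1 hx
  obtain ⟨q, hq, rfl⟩ : ∃ q ∈ M.S a, z = [q] := mem_states_singleton.1 hz
  have hgi : ∀ c, M.g c 0 = 1 → M.gi c 0 = 1 := fun c h => by
    rw [← M.g_mul_gi c 0, h, one_mul]
  have hR : M.eval (tensor (.W b [] he) (.Z a 0 0 1)) [k] [q] = ind K (k = 0) * ind K (q = 0) := by
    refine (eval_tensor M (.W b [] he) (.Z a 0 0 1) (x := [k]) (x' := []) (z := []) (z' := [q])
      rfl rfl).trans ?_
    rw [eval_W, eval_Z, List.map_nil, List.prod_nil, one_mul, List.nil_append,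
      hFa.Zt_singleton hM _ hq, wti_nil, mul_one, merge, ← ind_and]
    congr 1
    · rw [ind_congr (q := k = 0) ⟨fun h => h.1.symm, fun h => ⟨h.symm, .inr h⟩⟩]
      refine (ind_mul_congr fun h => ?_).trans (mul_one _)
      rw [h, hg']
    · by_cases h : q = 0
      · subst h
        rw [ind_pos hM.π_zero, hρ0 _ hq hM.π_zero, hgi a hg]
        simp
      · by_cases h' : M.π q = q
        · rw [hρ0 _ hq h', ind_neg h]
          simp
        · rw [ind_neg h', ind_neg h, zero_mul]
  rw [hR, eval_comp]
  have hL : ∀ y ∈ states M.S (List.replicate n b),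
      M.eval (.Z b 1 1 n) [k] y * M.eval (coW a (List.replicate n b) hab) y [q]
      = ind K (y = List.replicate n 0) * (ind K (k = 0) * ind K (q = 0)) := by
    intro y hy
    rw [eval_Z, eval_coW M _ _ _ hy hq, List.map_singleton, List.prod_singleton,
      List.singleton_append, hM.Zt_cons 1 hk]
    by_cases hk0 : k = 0
    · subst hk0
      rw [hM.π_zero, ind_congr (q := y = List.replicate n 0), hg', hρ1, ind_pos rfl, one_mul,
        one_mul, one_mul, mul_assoc]
      · refine ind_mul_congr ?_
        rintro rfl
        rw [← List.replicate_succ, hFb.T_replicate hk hM.π_zero, hgi b hg', one_mul, merge,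
          ← ind_and]
        exact ind_congr ⟨fun h => by simpa [eq_comm] using h.1, fun h => ⟨by simp [h], .inr h⟩⟩
      · rw [List.eq_replicate_iff]
        refine ⟨fun h => ⟨by simpa using length_of_mem hy, fun p hp => hM.eq_zero_of_π (h p hp)⟩,
          fun h p hp => by rw [h.2 p hp, hM.π_zero]⟩
    · rw [ind_neg hk0, zero_mul, mul_zero]
      by_cases h : ∀ p ∈ y, M.π p = M.π k
      · by_cases hs : y.sum = q
        · rcases hρ (M.π k) (hM.π_mem.2 hk) (hM.π_π k) y hy h (hs ▸ hq) with h0 | h0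
          · exact absurd (hM.eq_zero_of_π h0) hk0
          · rw [h0]
            simp
        · rw [merge, ind_neg hs]
          simp
      · rw [ind_neg h]
        simp
  rw [Finset.sum_congr rfl hL]
  refine sum_ind_mul _ _ ?_ _
  rw [mem_states_replicate]
  exact ⟨by simp, fun p hp => by rw [List.eq_of_mem_replicate hp]; exact hM.zero_mem b⟩

theorem eqv_l (hM : M.Graded) (hF : M.Fused 1) (hpure : ∀ x ∈ M.S 1, M.π x = x)
    (hg : ∀ x ∈ M.S 1, M.g 1 x = 1) (n : ℕ) :
    M.Eqv (comp (.Z 1 1 n 2) (cup 1) rfl) (.Z 1 1 n 0) := by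
  classical
  refine .of_eq rfl rfl fun x hx z hz => ?_
  obtain rfl : z = [] := by simpa using hz
  have hx' := mem_of_mem_states_replicate hx
  rw [eval_comp]
  refine (sum_states_pair 1 1 _).trans ?_
  have h1 : ∀ p ∈ M.S 1, ∑ q ∈ M.S 1, M.eval (.Z 1 1 n 2) x [p, q] * M.eval (cup 1) [p, q] []
      = (x.map (M.g 1)).prod * (ind K (∀ y ∈ x, M.π y = p) * (M.ρ p 1 * M.T 1 p x)) := by
    intro p hp
    rw [Finset.sum_congr rfl fun q _ => show _ = ind K (p = q) * ((x.map (M.g 1)).prod *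
      M.Zt 1 1 (x ++ [p, q]) * M.g 1 p) by rw [eval_Z, eval_cup]; ring, sum_ind_mul' _ _ hp,
      hg p hp, mul_one, Zt_perm M 1 1 (l' := p :: p :: x) List.perm_append_comm,
      hM.Zt_cons 1 hp, hpure p hp, ind_congr (q := ∀ y ∈ x, M.π y = p) (by simp [hpure p hp])]
    congr 1
    refine ind_mul_congr fun h => ?_
    rw [hF.unit p hp (hpure p hp), hF.unit p hp (hpure p hp)]
    · exact fun y hy => ⟨hx' y hy, h y hy⟩
    · simp only [List.mem_cons, forall_eq_or_imp]
      exact ⟨⟨hp, hpure p hp⟩, fun y hy => ⟨hx' y hy, h y hy⟩⟩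
  rw [Finset.sum_congr rfl h1, ← Finset.mul_sum, eval_Z, List.append_nil, Zt]
  congr 1
  refine Finset.sum_congr ?_ fun _ _ => rfl
  rw [Finset.filter_true_of_mem fun k hk => hpure k hk]

theorem eqv_i (a b : ℕ+) (h) (hone : M.one b ∈ M.S b) (heq : M.one a = M.one b)
    (hQ : M.Q 1 ∨ M.one b = 0) : M.Eqv (comp (.one b) (coW a [b] h) rfl) (.one a) := by
  refine .of_eq rfl rfl fun x hx z hz => ?_
  obtain ⟨q, hq, rfl⟩ := mem_states_singleton.1 hz
  rw [eval_comp_left M (w := [M.one b]) _ _ _ (fun y _ => M.eval_one b _ _) (by simp [hone]),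
    eval_coW M _ _ _ (by simp [hone]) hq, merge, eval_one, ← ind_and, heq]
  refine ind_congr ⟨fun h => by simpa [eq_comm] using h.1, fun h => ?_⟩
  obtain rfl : q = M.one b := by simpa using h
  simpa using hQ

theorem Graded.nsmul_mem (hM : M.Graded) {x : X} (hx : x ∈ M.S 1) (k : ℕ) :
    (k + 1) • x ∈ M.S k.succPNat := by
  induction k with
  | zero => rw [zero_add, one_nsmul]; exact hx
  | succ k ih =>
    rw [succ_nsmul]
    exact hM.add_mem ih hx le_rfl

theorem eval_ket (hM : M.Graded) (hone : M.one 1 ∈ M.S 1) (hQ : M.Q 2 ∨ M.one 1 = 0) (k : ℕ)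
    (h : k + 1 ≤ (k.succPNat : ℕ)) {z : List X} (hz : z ∈ states M.S [k.succPNat]) :
    M.eval (ket k k.succPNat h) [] z = ind K (z = [(k + 1) • M.one 1]) := by
  induction k generalizing z with
  | zero =>
    rw [zero_add, one_nsmul]
    rfl
  | succ k ih =>
    obtain ⟨q, hq, rfl⟩ := mem_states_singleton.1 hz
    have hk := hM.nsmul_mem hone k
    rw [ket, eval_comp_left M (w := [(k + 1) • M.one 1, M.one 1])]
    · rw [eval_coW M _ _ _ (by simp [hk, hone]) hq, merge, ← ind_and, succ_nsmul _ (k + 1)]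
      refine ind_congr ⟨fun h => by simpa [eq_comm] using h.1, fun h => ?_⟩
      obtain rfl : q = (k + 1) • M.one 1 + M.one 1 := by simpa using h
      refine ⟨by simp, hQ.imp id fun h => ?_⟩
      simp [h]
    · intro y hy
      obtain ⟨p, hp, q, hq, rfl⟩ : ∃ p ∈ M.S k.succPNat, ∃ q ∈ M.S 1, y = [p, q] :=
        mem_states_pair.1 hy
      refine (eval_tensor M (ket k k.succPNat le_rfl) (.one 1) (x := []) (x' := []) (z := [p])
        (z' := [q]) rfl rfl).trans ?_
      refine (congrArg₂ (· * ·) (ih le_rfl (mem_states_singleton.2 ⟨p, hp, rfl⟩))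
        (M.eval_one 1 [] [q])).trans ?_
      rw [← ind_and]
      exact ind_congr (by simp)
    · exact mem_states_pair.2 ⟨_, hk, _, hone, rfl⟩

/-- A loop on a Z-spider, on the labels which represent a sector. -/
theorem eval_loop (hM : M.Graded) {a : ℕ+} (hF : M.Fused a) {w : X} (hw : w ∈ M.S a)
    (hw' : M.π w = w)
    (hcard : open Classical in ((({q ∈ M.S a | M.π q = w}.card : ℕ)) : K) = 1) :
    M.eval (comp (.Z a 1 1 2) (cup a) rfl) [w] [] = M.g a w * M.ρ w 1 := by
  classical
  rw [eval_comp]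
  refine (sum_states_pair a a _).trans ?_
  have h1 : ∀ p ∈ M.S a, ∑ q ∈ M.S a, M.eval (.Z a 1 1 2) [w] [p, q] * M.eval (cup a) [p, q] []
      = if M.π p = w then M.g a w * M.ρ w 1 else 0 := by
    intro p hp
    rw [Finset.sum_congr rfl fun q _ => show _ = ind K (p = q) * (M.g a w *
      M.Zt a 1 (w :: [p, q]) * M.g a p) by
        rw [eval_Z, eval_cup, List.map_singleton, List.prod_singleton, List.singleton_append]; ring,
      sum_ind_mul' _ _ hp, hM.Zt_cons 1 hw, hw']
    by_cases h : M.π p = w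
    · rw [if_pos h, ind_pos (by simp [h]), one_mul, hF.unit w hw hw',
        hF.pair w hw hw' p hp h p hp h,
        ind_pos rfl, one_mul]
      · calc _ = M.g a w * M.ρ w 1 * (M.g a p * M.gi a p) := by ring
          _ = _ := by rw [M.g_mul_gi, mul_one]
      · simp [hp, h]
    · rw [if_neg h, ind_neg (by simp [h])]
      simp
  rw [Finset.sum_congr rfl h1, ← Finset.sum_filter, Finset.sum_const, nsmul_eq_mul, hcard, one_mul]

theorem eqv_u (hM : M.Graded) {a : ℕ+} (hF : M.Fused a) (hone : M.one 1 ∈ M.S 1)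
    (hpure : M.π (M.one 1) = M.one 1) (hQ : M.Q 2 ∨ M.one 1 = 0)
    (hcard : ∀ w ∈ M.S a, M.π w = w →
      open Classical in ((({q ∈ M.S a | M.π q = w}.card : ℕ)) : K) = 1)
    (hρ : ∃ c : Kˣ, ∀ y ∈ M.S a, ind K (M.π y = y) * M.ρ y 1
      = c * (M.sc (1 / (Nat.factorial a : ℂ)) * M.g a ((a : ℕ) • M.one 1) *
        ∑ w ∈ M.S a, ind K (y + w = (a : ℕ) • M.one 1) * M.ρ w 1)) (hk) (h) :
    M.Eqv (.Z a 1 0 1) (tensor (scalar (1 / (Nat.factorial a : ℂ)))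
          (comp (comp (ket a.natPred a hk) (.W a [a, a] h) rfl)
            (tensor (.id [a]) (comp (.Z a 1 1 2) (cup a) rfl)) rfl)) := by
  obtain ⟨k, rfl⟩ : ∃ k : ℕ, a = k.succPNat := ⟨a.natPred, (PNat.succPNat_natPred a).symm⟩
  obtain ⟨c, hc⟩ := hρ
  refine ⟨rfl, rfl, c, fun x hx z hz => ?_⟩
  obtain rfl : x = [] := by simpa using hx
  obtain ⟨y, hy, rfl⟩ : ∃ y ∈ M.S k.succPNat, z = [y] := mem_states_singleton.1 hz
  rw [eval_Z, List.map_nil, List.prod_nil, one_mul, List.nil_append, hF.Zt_singleton hM 1 hy]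
  refine Eq.trans ?_ (congrArg _ (eval_tensor M (scalar _) _ (x := []) (x' := []) (z := [])
    (z' := [y]) rfl rfl).symm)
  set m := ((k.succPNat : ℕ)) • M.one 1 with hm
  have hmem : m ∈ M.S k.succPNat := hM.nsmul_mem hone k
  have hmpure : M.π m = m := by
    rw [hm]
    induction (k.succPNat : ℕ) with
    | zero => simpa using hM.π_zero
    | succ n ih => rw [succ_nsmul, hM.π_add, ih, hpure]
  have hQm : M.Q 2 ∨ m = 0 := hQ.imp id fun h => by rw [hm, h, nsmul_zero]
  have hket : ∀ z ∈ states M.S [k.succPNat], M.eval (ket (k.succPNat).natPred k.succPNat hk) [] z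
      = ind K (z = [m]) := by
    intro z hz
    have := eval_ket hM hone hQ k le_rfl hz
    simp only [Nat.natPred_succPNat]
    exact this
  have h1 : M.eval (comp (comp (ket (k.succPNat).natPred k.succPNat hk) (.W k.succPNat _ h) rfl)
      (tensor (.id [k.succPNat]) (comp (.Z k.succPNat 1 1 2) (cup k.succPNat) rfl)) rfl) [] [y]
      = M.g k.succPNat m * M.gi k.succPNat y * ∑ w ∈ M.S k.succPNat,
        ind K (y + w = m) * M.ρ w 1 := by
    rw [eval_comp, sum_states_pair]
    have h2 : ∀ p ∈ M.S k.succPNat, ∑ w ∈ M.S k.succPNat,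
        M.eval (comp (ket (k.succPNat).natPred k.succPNat hk) (.W k.succPNat _ h) rfl) [] [p, w] *
        M.eval (tensor (.id [k.succPNat]) (comp (.Z k.succPNat 1 1 2) (cup k.succPNat) rfl)) [p, w]
          [y] = ind K (p = y) * (M.g k.succPNat m * M.gi k.succPNat p *
            ∑ w ∈ M.S k.succPNat, ind K (p + w = m) * M.ρ w 1) := by
      intro p hp
      rw [Finset.mul_sum, Finset.mul_sum]
      refine Finset.sum_congr rfl fun w hw => ?_
      rw [eval_comp_left M _ _ _ hket (by simp [hmem]), eval_W, wti_cons, wti_cons, wti_nil, merge]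
      refine (congrArg _ (eval_tensor M (.id [k.succPNat])
        (comp (.Z k.succPNat 1 1 2) (cup k.succPNat) rfl) (x := [p]) (x' := [w]) (z := [y])
        (z' := []) rfl rfl)).trans ?_
      rw [eval_id, List.sum_cons, List.sum_singleton, show ind K (M.Q [p,
        w].length ∨ m = 0) = 1 from ind_pos hQm, mul_one,
        show ind K ([p] = [y]) = ind K (p = y) from ind_congr (by simp)]
      have h3 : ind K (p + w = m) * (M.g k.succPNat m * (M.gi k.succPNat p * (M.gi k.succPNat w *
        1)) *
          (ind K (p = y) * M.eval (comp (.Z k.succPNat 1 1 2) (cup k.succPNat) rfl) [w] []))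
          = ind K (p + w = m) * (M.g k.succPNat m * (M.gi k.succPNat p * (M.gi k.succPNat w * 1)) *
          (ind K (p = y) * (M.g k.succPNat w * M.ρ w 1))) := by
        refine ind_mul_congr fun e => ?_
        have hw' : M.π w = w := by
          rw [← e, add_comm] at hmpure
          exact hM.pure_of_add hmpure
        rw [eval_loop hM hF hw hw' (hcard w hw hw')]
      calc _ = _ := by rw [mul_assoc (ind K (p + w = m)), mul_assoc (ind K (p + w = m))]
           _ = _ := h3
           _ = ind K (p = y) * (M.g k.succPNat m * M.gi k.succPNat p * (ind K (p + w = m) * M.ρ w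
             1))
              * (M.g k.succPNat w * M.gi k.succPNat w) := by ring
           _ = _ := by rw [M.g_mul_gi, mul_one]
    rw [Finset.sum_congr rfl h2, sum_ind_mul _ _ hy]
  rw [h1, eval_scalar, ← mul_assoc, hc y hy]
  ring

end Rules

end Interp

/-! ### Matrices of labels -/

section Matrices

variable {C X : Type} {S : C → Finset X}

theorem flatten_mem_states {L : List (List C)} {ms : List (List X)}
    (h : ms ∈ states (states S) L) : ms.flatten ∈ states S L.flatten := by
  induction L generalizing ms with
  | nil => simp at h; simp [h]
  | cons A L ih =>
    obtain ⟨u, hu, v, hv, rfl⟩ := mem_states_cons.1 h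
    exact append_mem_states hu (ih hv)

theorem sum_states_flatten {K : Type} [AddCommMonoid K] (L : List (List C)) (F : List X → K) :
    ∑ x ∈ states S L.flatten, F x = ∑ ms ∈ states (states S) L, F ms.flatten := by
  induction L generalizing F with
  | nil => simp
  | cons A L ih =>
    rw [List.flatten_cons, sum_states_append, sum_states_cons]
    exact Finset.sum_congr rfl fun u _ => ih _

/-- The transpose of a matrix given by the list of its rows, the columns being indexed by `J`. -/
def transposeL {β : Type} (J : List β) : List (List X) → List (List X)
  | [] => J.map fun _ => []
  | r :: rs => List.zipWith List.cons r (transposeL J rs)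

theorem zipWith_cons_mem {β : Type} {J : List β} {g : β → C} {k : β → List C} {u : List X}
    {ms : List (List X)} (hu : u ∈ states S (J.map g)) (hms : ms ∈ states (states S) (J.map k)) :
    List.zipWith List.cons u ms ∈ states (states S) (J.map fun j => g j :: k j) := by
  induction J generalizing u ms with
  | nil => simp at hu; subst hu; simp
  | cons j J ih =>
    obtain ⟨p, hp, u, hu', rfl⟩ := mem_states_cons.1 hu
    obtain ⟨m, hm, ms, hms', rfl⟩ := mem_states_cons.1 hms
    rw [List.zipWith_cons_cons, List.map_cons]
    exact cons_mem_states.2 ⟨cons_mem_states.2 ⟨hp, hm⟩, ih hu' hms'⟩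

theorem transposeL_mem {α β : Type} {f : α → β → C} {I : List α} {J : List β} {ms : List (List X)}
    (hms : ms ∈ states (states S) (I.map fun i => J.map (f i))) :
    transposeL J ms ∈ states (states S) (J.map fun j => I.map fun i => f i j) := by
  induction I generalizing ms with
  | nil =>
    obtain rfl : ms = [] := by simpa using hms
    clear hms
    rw [transposeL]
    induction J with
    | nil => simp
    | cons j J ih => simpa using ih
  | cons i I ih =>
    obtain ⟨m, hm, ms, hms', rfl⟩ := mem_states_cons.1 hms
    exact zipWith_cons_mem hm (ih hms')

end Matrices

namespace Interp

section Wiring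

variable {K X : Type} [CommSemiring K] [AddCommMonoid X] (M : Interp K X)

/-- On the input `x`, the diagram `f` has the single output `w`, with weight one. -/
def Sends {A B : List ℕ+} (f : Diagram A B) (x w : List X) : Prop :=
  w ∈ states M.S B ∧ ∀ z ∈ states M.S B, M.eval f x z = ind K (z = w)

variable {M}

theorem Sends.comp {A B B' D : List ℕ+} {f : Diagram A B} {g : Diagram B' D} (h : B = B')
    {x w v : List X} (hf : M.Sends f x w) (hg : M.Sends g w v) : M.Sends (comp f g h) x v :=
  ⟨hg.1, fun z hz => by rw [eval_comp_left M f g h hf.2 hf.1, hg.2 z hz]⟩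

theorem Sends.tensor {A B A' B' : List ℕ+} {f : Diagram A B} {g : Diagram A' B'}
    {x w x' w' : List X} (hx : x ∈ states M.S A) (hf : M.Sends f x w) (hg : M.Sends g x' w') :
    M.Sends (tensor f g) (x ++ x') (w ++ w') := by
  refine ⟨append_mem_states hf.1 hg.1, fun z hz => ?_⟩
  obtain ⟨z, hz1, z', hz2, rfl⟩ := mem_states_append.1 hz
  rw [eval_tensor M _ _ (length_of_mem hx) (length_of_mem hz1), hf.2 z hz1, hg.2 z' hz2, ind_append]
  rw [length_of_mem hz1, length_of_mem hf.1]

theorem Sends.id {A : List ℕ+} {x : List X} (hx : x ∈ states M.S A) : M.Sends (.id A) x x :=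
  ⟨hx, fun _ _ => ind_congr eq_comm⟩

theorem Sends.ofEq {A B : List ℕ+} (h : A = B) {x : List X} (hx : x ∈ states M.S A) :
    M.Sends (ofEq h) x x :=
  ⟨h ▸ hx, fun _ _ => eval_ofEq M h hx⟩

theorem Sends.braid {A B : List ℕ+} {x y : List X} (hx : x ∈ states M.S A)
    (hy : y ∈ states M.S B) : M.Sends (braid A B) (x ++ y) (y ++ x) :=
  ⟨append_mem_states hy hx, fun _ hz => eval_braid M A B hx hy hz⟩

theorem sends_interleave {β : Type} (g : β → ℕ+) (k : β → List ℕ+) (J : List β) {u : List X}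
    {ms : List (List X)} (hu : u ∈ states M.S (J.map g))
    (hms : ms ∈ states (states M.S) (J.map k)) :
    M.Sends (interleave g k J) (u ++ ms.flatten) (List.zipWith List.cons u ms).flatten := by
  induction J generalizing u ms with
  | nil =>
    obtain rfl : u = [] := by simpa using hu
    obtain rfl : ms = [] := by simpa using hms
    exact Sends.id (by simp)
  | cons j J ih =>
    obtain ⟨p, hp, u, hu', rfl⟩ := mem_states_cons.1 hu
    obtain ⟨m, hm, ms, hms', rfl⟩ := mem_states_cons.1 hms
    have hfl : ms.flatten ∈ states M.S (J.flatMap k) := flatten_mem_states hms'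
    have hp' : [p] ∈ states M.S [g j] := by simp [hp]
    have h1 : M.Sends (Diagram.tensor (.id [g j]) (Diagram.tensor (Diagram.braid (J.map g) (k j))
        (.id (J.flatMap k)))) ([p] ++ ((u ++ m) ++ ms.flatten)) ([p] ++ ((m ++ u) ++ ms.flatten)) :=
      (Sends.id hp').tensor hp' ((Sends.braid hu' hm).tensor (append_mem_states hu' hm)
        (Sends.id hfl))
    have hpm : p :: m ∈ states M.S (g j :: k j) := by simp [hp, hm]
    have h2 : M.Sends (Diagram.tensor (.id (g j :: k j)) (interleave g k J))
        ((p :: m) ++ (u ++ ms.flatten)) ((p :: m) ++ (List.zipWith List.cons u ms).flatten) :=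
      (Sends.id hpm).tensor hpm (ih hu' hms')
    have e1 : (p :: u) ++ (m :: ms).flatten = [p] ++ ((u ++ m) ++ ms.flatten) := by simp
    have e2 : [p] ++ ((m ++ u) ++ ms.flatten) = (p :: m) ++ (u ++ ms.flatten) := by simp
    rw [e1]
    rw [e2] at h1
    refine Sends.comp _ (Sends.comp _ (Sends.ofEq _ ?_) h1) h2
    have := append_mem_states hp' (append_mem_states (append_mem_states hu' hm) hfl)
    simpa using this

theorem sends_transpose {α β : Type} (f : α → β → ℕ+) (J : List β) (I : List α)
    {ms : List (List X)} (hms : ms ∈ states (states M.S) (I.map fun i => J.map (f i))) :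
    M.Sends (transpose f J I) ms.flatten (transposeL J ms).flatten := by
  induction I generalizing ms with
  | nil =>
    obtain rfl : ms = [] := by simpa using hms
    have := Sends.ofEq (M := M) (show ([] : List ℕ+).flatMap (fun i : ℕ+ => [i]) =
      J.flatMap fun _ => [] by simp) (x := []) (by simp)
    have e : (transposeL J ([] : List (List X))).flatten = [] := by simp [transposeL]
    rw [e]
    exact this
  | cons i I ih =>
    obtain ⟨m, hm, ms, hms', rfl⟩ := mem_states_cons.1 hms
    exact Sends.comp _ ((Sends.id hm).tensor hm (ih hms'))
      (sends_interleave _ _ _ hm (transposeL_mem hms'))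

variable (M)

theorem eval_comp_transpose {α β : Type} (f : α → β → ℕ+) (J : List β) (I : List α)
    {A B B' D : List ℕ+} (P : Diagram A B) (Q : Diagram B' D) (h) (h') (x z : List X) :
    M.eval (comp (comp P (transpose f J I) h) Q h') x z
      = ∑ ms ∈ states (states M.S) (I.map fun i => J.map (f i)),
        M.eval P x ms.flatten * M.eval Q (transposeL J ms).flatten z := by
  rw [eval_comp_assoc, eval_comp]
  subst h
  refine (sum_states_flatten _ _).trans ?_
  refine Finset.sum_congr rfl fun ms hms => ?_
  have := sends_transpose (M := M) f J I hms
  rw [eval_comp_left M _ Q h' this.2 this.1]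

end Wiring

end Interp

namespace Interp

theorem states_mono {C X β : Type} {S : C → Finset X} {f g : β → C} {J : List β}
    (h : ∀ j ∈ J, S (f j) ⊆ S (g j)) : states S (J.map f) ⊆ states S (J.map g) := by
  induction J with
  | nil => simp
  | cons j J ih =>
    intro x hx
    obtain ⟨p, hp, y, hy, rfl⟩ := mem_states_cons.1 hx
    exact cons_mem_states.2 ⟨h j (by simp) hp, ih (fun j hj => h j (by simp [hj])) hy⟩

section MatrixRules

variable {K X : Type} [CommSemiring K] [AddCommMonoid X] {M : Interp K X}

/-! ### The bialgebra between W-nodes -/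

/-- The weight of the paths through the row vectors `ms`, with total labels `x`. -/
def rowWeight (G Gi : X → K) : List X → List (List X) → K
  | p :: x, m :: ms => ind K (m.sum = p) * (G p * (m.map Gi).prod) * rowWeight G Gi x ms
  | _, _ => 1

/-- The sum of the rows of a matrix, the columns being indexed by `J`. -/
def colSum {β : Type} (J : List β) : List (List X) → List X
  | [] => J.map fun _ => 0
  | m :: ms => List.zipWith (· + ·) m (colSum J ms)

theorem wti_eq_prod {Gi : X → K} (hGi : ∀ a x, M.gi a x = Gi x) {A : List ℕ+} {x : List X}
    (h : x.length = A.length) : M.wti A x = (x.map Gi).prod := by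
  induction A generalizing x with
  | nil => rw [List.length_nil, List.length_eq_zero_iff] at h; subst h; rfl
  | cons a A ih =>
    cases x with
    | nil => simp at h
    | cons p x => rw [wti_cons, ih (by simpa using h), hGi, List.map_cons, List.prod_cons]

theorem eval_par_W {G Gi : X → K} (hG : ∀ a x, M.g a x = G x) (hGi : ∀ a x, M.gi a x = Gi x)
    (bs : ℕ+ → List ℕ+) (hbs : ∀ x, ∀ y ∈ bs x, y ≤ x) (n : ℕ) (hn : ∀ x, (bs x).length = n)
    (as : List ℕ+) {x : List X} {ms : List (List X)} (hx : x ∈ states M.S as)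
    (hms : ms ∈ states (states M.S) (as.map bs)) :
    M.eval (par (fun x => [x]) bs (fun x => .W x (bs x) (hbs x)) as) x ms.flatten
      = rowWeight G Gi x ms * ind K (∀ p ∈ x, M.Q n ∨ p = 0) := by
  induction as generalizing x ms with
  | nil =>
    obtain rfl : x = [] := by simpa using hx
    obtain rfl : ms = [] := by simpa using hms
    refine (ind_pos rfl).trans ?_
    rw [ind_pos (by simp), rowWeight, mul_one]
    simp
  | cons a as ih =>
    obtain ⟨p, hp, x, hx', rfl⟩ := mem_states_cons.1 hx
    obtain ⟨m, hm, ms, hms', rfl⟩ := mem_states_cons.1 hms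
    refine (eval_tensor M (.W a (bs a) (hbs a)) _ (x := [p]) (z :=
      m) rfl (length_of_mem hm)).trans ?_
    rw [ih hx' hms', eval_W, rowWeight, merge, wti_eq_prod hGi (length_of_mem hm), hG,
      length_of_mem hm, hn,
      ind_congr (List.forall_mem_cons (p := fun p => M.Q n ∨ p = 0) (a := p) (l := x)), ind_and]
    ring

theorem eval_par_coW (as : ℕ+ → List ℕ+) (has : ∀ y, ∀ x ∈ as y, x ≤ y) (n : ℕ)
    (hn : ∀ x, (as x).length = n) (bs : List ℕ+) {ms : List (List X)} {z : List X}
    (hz : z ∈ states M.S bs) (hms : ms ∈ states (states M.S) (bs.map as)) :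
    M.eval (par as (fun y => [y]) (fun y => coW y (as y) (has y)) bs) ms.flatten z
      = ind K (ms.map List.sum = z) * ind K (∀ p ∈ z, M.Q n ∨ p = 0) := by
  induction bs generalizing z ms with
  | nil =>
    obtain rfl : z = [] := by simpa using hz
    obtain rfl : ms = [] := by simpa using hms
    refine (ind_pos rfl).trans ?_
    rw [ind_pos (by simp), ind_pos (by simp), mul_one]
  | cons b bs ih =>
    obtain ⟨p, hp, z, hz', rfl⟩ := mem_states_cons.1 hz
    obtain ⟨m, hm, ms, hms', rfl⟩ := mem_states_cons.1 hms
    refine (eval_tensor M (coW b (as b) (has b)) _ (x := m) (z :=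
      [p]) (length_of_mem hm) rfl).trans ?_
    rw [ih hz' hms', eval_coW M _ _ _ hm hp, merge, length_of_mem hm, hn, List.map_cons, ind_cons,
      ind_congr (List.forall_mem_cons (p := fun p => M.Q n ∨ p = 0) (a := p) (l := z)), ind_and]
    ring

theorem transposeL_map_sum {β : Type} (J : List β) (ms : List (List X)) :
    (transposeL J ms).map List.sum = colSum J ms := by
  induction ms with
  | nil => simp [transposeL, colSum]
  | cons m ms ih =>
    rw [transposeL, colSum, ← ih]
    generalize transposeL J ms = cs
    induction m generalizing cs with
    | nil => simp
    | cons p m ih' => cases cs with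
      | nil => simp
      | cons c cs => simp [ih']

/-- The identity of weights behind the bialgebra between W-nodes, for two inputs and two outputs:
the weights of the `2 × 2` matrices with row sums `x, x'` and column sums `z, z'`. -/
def SquareIdentity (S : Finset X) (G Gi : X → K) : Prop :=
  ∀ x x' z z' : X, x + x' = z + z' → x + x' ∈ S →
    ∑ u ∈ S, ∑ v ∈ S, ∑ u' ∈ S, ∑ v' ∈ S, ind K (u + v = z) * (ind K (u' + v' = z') *
      (ind K (u + u' = x) * (ind K (v + v' = x') * (Gi u * Gi v * Gi u' * Gi v'))))
    = G (x + x') * Gi x * Gi x' * Gi z * Gi z'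

variable {G Gi : X → K}

/-- The square identity for a `2 × n` matrix. -/
theorem sum_two_rows (hM : M.Graded) (hG0 : G 0 = 1) (hGi0 : Gi 0 = 1) (hGG : ∀ x, G x * Gi x = 1)
    {c : ℕ+} (hsq : SquareIdentity (M.S c) G Gi) {bs : List ℕ+} (hbs : ∀ b ∈ bs, b ≤ c) {z : List X}
    (hz : z ∈ states M.S bs) {x x' : X} (hs : x + x' = z.sum → z.sum ∈ M.S c) :
    ∑ m ∈ states M.S bs, ∑ v ∈ states M.S bs, ind K (List.zipWith (· + ·) m v = z) *
      (ind K (m.sum = x) * (ind K (v.sum = x') * ((m.map Gi).prod * (v.map Gi).prod)))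
      = ind K (x + x' = z.sum) * (G (x + x') * Gi x * Gi x' * (z.map Gi).prod) := by
  induction bs generalizing z x x' with
  | nil =>
    obtain rfl : z = [] := by simpa using hz
    simp only [states_nil, Finset.sum_singleton, List.zipWith_nil_right, List.sum_nil, List.map_nil,
      List.prod_nil, mul_one]
    rw [ind_pos trivial, one_mul, ← ind_and, ← mul_one (ind K _),
      ind_congr (q := x + x' = 0) (by rw [hM.add_eq_zero, eq_comm, eq_comm (a := (0 : X))])]
    refine ind_mul_congr fun h => ?_
    obtain ⟨rfl, rfl⟩ := hM.add_eq_zero.1 h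
    simp [hG0, hGi0]
  | cons b bs ih =>
    obtain ⟨q, hq, z, hz', rfl⟩ := mem_states_cons.1 hz
    have hbc : M.S b ⊆ M.S c := hM.mono (hbs b (by simp))
    by_cases h : x + x' = (q :: z).sum
    swap
    · rw [ind_neg h, zero_mul]
      refine Finset.sum_eq_zero fun m hm => Finset.sum_eq_zero fun v hv => ?_
      by_cases h1 : List.zipWith (· + ·) m v = q :: z
      swap
      · rw [ind_neg h1, zero_mul]
      by_cases h2 : m.sum = x
      swap
      · rw [ind_neg h2]; simp
      by_cases h3 : v.sum = x'
      swap
      · rw [ind_neg h3]; simp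
      refine absurd ?_ h
      rw [← h1, ← h2, ← h3, ← List.sum_add_sum_eq_sum_zipWith_of_length_eq]
      rw [length_of_mem hm, length_of_mem hv]
    rw [ind_pos h, one_mul, sum_states_cons]
    have hmem := hs h
    rw [List.sum_cons] at h hmem
    have hxc : x + x' ∈ M.S c := h ▸ hmem
    have hzc := hM.mem_of_add_mem' hmem
    have step : ∀ m0 ∈ M.S b, ∑ m ∈ states M.S bs, ∑ v ∈ states M.S (b :: bs),
        ind K (List.zipWith (· + ·) (m0 :: m) v = q :: z) *
        (ind K ((m0 :: m).sum = x) * (ind K (v.sum = x') *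
          (((m0 :: m).map Gi).prod * (v.map Gi).prod)))
        = ∑ v0 ∈ M.S b, ∑ u' ∈ M.S c, ∑ v' ∈ M.S c, ind K (m0 + v0 = q) * (ind K (u' + v' = z.sum) *
      (ind K (m0 + u' = x) * (ind K (v0 + v' = x') * (Gi m0 * Gi v0 * Gi u' * Gi v')))) *
        (G z.sum * (z.map Gi).prod) := by
      intro m0 _
      simp_rw [sum_states_cons b bs]
      rw [Finset.sum_comm]
      refine Finset.sum_congr rfl fun v0 _ => ?_
      have key : ∀ m ∈ states M.S bs, ∀ v ∈ states M.S bs,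
          ind K (List.zipWith (· + ·) (m0 :: m) (v0 :: v) = q :: z) *
          (ind K ((m0 :: m).sum = x) * (ind K ((v0 :: v).sum = x') *
          (((m0 :: m).map Gi).prod * ((v0 :: v).map Gi).prod)))
          = ∑ u' ∈ M.S c, ∑ v' ∈ M.S c, ind K (m0 + v0 = q) * ind K (m0 + u' = x) *
            ind K (v0 + v' = x') * (Gi m0 * Gi v0) * (ind K (List.zipWith (· + ·) m v = z) *
            (ind K (m.sum = u') * (ind K (v.sum = v') * ((m.map Gi).prod * (v.map Gi).prod)))) := by
        intro m _ v _
        have e1 : ind K ((m0 :: m).sum = x) = ∑ u' ∈ M.S c, ind K (m.sum = u') *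
            ind K (m0 + u' = x) := by
          rw [List.sum_cons]
          by_cases hm : m.sum ∈ M.S c
          · rw [sum_ind_mul' _ _ hm fun u' => ind K (m0 + u' = x)]
          · rw [ind_neg, Finset.sum_eq_zero]
            · intro u' hu'
              rw [ind_neg (by rintro rfl; exact hm hu'), zero_mul]
            · rintro rfl
              exact hm (hM.mem_of_add_mem' (hM.mem_of_add_mem hxc))
        have e2 : ind K ((v0 :: v).sum = x') = ∑ v' ∈ M.S c, ind K (v.sum = v') *
            ind K (v0 + v' = x') := by
          rw [List.sum_cons]
          by_cases hm : v.sum ∈ M.S c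
          · rw [sum_ind_mul' _ _ hm fun u' => ind K (v0 + u' = x')]
          · rw [ind_neg, Finset.sum_eq_zero]
            · intro u' hu'
              rw [ind_neg (by rintro rfl; exact hm hu'), zero_mul]
            · rintro rfl
              exact hm (hM.mem_of_add_mem' (hM.mem_of_add_mem' hxc))
        rw [e1, e2, List.zipWith_cons_cons, ind_cons, List.map_cons, List.map_cons, List.prod_cons,
          List.prod_cons]
        simp_rw [Finset.sum_mul, Finset.mul_sum]
        refine Finset.sum_congr rfl fun u' _ => Finset.sum_congr rfl fun v' _ => ?_
        ring
      rw [Finset.sum_congr rfl fun m hm => Finset.sum_congr rfl fun v hv => key m hm v hv]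
      rw [Finset.sum_congr rfl fun m hm => Finset.sum_comm, Finset.sum_comm]
      refine Finset.sum_congr rfl fun u' _ => ?_
      rw [Finset.sum_congr rfl fun m hm => Finset.sum_comm, Finset.sum_comm]
      refine Finset.sum_congr rfl fun v' _ => ?_
      simp_rw [← Finset.mul_sum]
      rw [ih (fun b hb => hbs b (by simp [hb])) hz' (fun _ => hzc)]
      have e3 : ind K (u' + v' = z.sum) * (G (u' + v') * Gi u' * Gi v' * (z.map Gi).prod)
        = ind K (u' + v' = z.sum) * (G z.sum * Gi u' * Gi v' * (z.map Gi).prod) :=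
        ind_mul_congr fun h => by rw [h]
      rw [e3]
      ring
    rw [Finset.sum_congr rfl step]
    simp_rw [← Finset.sum_mul]
    have hsq' := hsq x x' q z.sum h hxc
    have hext : ∀ F : X → X → K, (∀ u v, u + v ≠ q → F u v = 0) →
        ∑ u ∈ M.S b, ∑ v ∈ M.S b, F u v = ∑ u ∈ M.S c, ∑ v ∈ M.S c, F u v := by
      intro F hF
      refine (Finset.sum_congr rfl fun u _ => Finset.sum_subset hbc fun v _ hv => ?_).trans
        (Finset.sum_subset hbc fun u _ hu => Finset.sum_eq_zero fun v _ => ?_)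
      · exact hF u v (by rintro rfl; exact hv (hM.mem_of_add_mem' hq))
      · exact hF u v (by rintro rfl; exact hu (hM.mem_of_add_mem hq))
    rw [hext]
    · rw [hsq', List.map_cons, List.prod_cons]
      calc _ = G (x + x') * Gi x * Gi x' * (Gi q * (z.map Gi).prod) *
            (G z.sum * Gi z.sum) := by ring
        _ = _ := by rw [hGG, mul_one]
    · intro u v huv
      refine Finset.sum_eq_zero fun u' _ => Finset.sum_eq_zero fun v' _ => ?_
      rw [ind_neg huv, zero_mul]

theorem Graded.mem_states_of_zipWith (hM : M.Graded) {bs : List ℕ+} {m w : List X}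
    (hm : m.length = bs.length) (hw : w.length = bs.length)
    (h : List.zipWith (· + ·) m w ∈ states M.S bs) : w ∈ states M.S bs := by
  induction bs generalizing m w with
  | nil => simp at hw; simp [hw]
  | cons b bs ih =>
    cases m with
    | nil => simp at hm
    | cons u m => cases w with
      | nil => simp at hw
      | cons y w =>
        rw [List.zipWith_cons_cons, cons_mem_states] at h
        rw [cons_mem_states]
        exact ⟨hM.mem_of_add_mem' h.1, ih (by simpa using hm) (by simpa using hw) h.2⟩

theorem mem_states_min {a : ℕ+} {bs : List ℕ+} {m : List X} (hm : m ∈ states M.S bs)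
    (h : ∀ q ∈ m, q ∈ M.S a) : m ∈ states M.S (bs.map fun b => min a b) := by
  induction bs generalizing m with
  | nil => simpa using hm
  | cons b bs ih =>
    obtain ⟨q, hq, m, hm2, rfl⟩ := mem_states_cons.1 hm
    rw [List.map_cons, cons_mem_states]
    refine ⟨?_, ih hm2 fun q hq => h q (by simp [hq])⟩
    rcases min_choice a b with e | e
    · rw [e]; exact h q (by simp)
    · rw [e]; exact hq

theorem rowWeight_sum (hM : M.Graded) (hG0 : G 0 = 1) (hGi0 : Gi 0 = 1) (hGG : ∀ x, G x * Gi x = 1)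
    {c : ℕ+} (hsq : SquareIdentity (M.S c) G Gi) {as bs : List ℕ+} (hbs : ∀ b ∈ bs, b ≤ c)
    {x z : List X} (hx : x ∈ states M.S as) (hz : z ∈ states M.S bs)
    (hs : x.sum = z.sum → z.sum ∈ M.S c) :
    ∑ ms ∈ states (states M.S) (as.map fun a => bs.map fun b => min a b),
      rowWeight G Gi x ms * ind K (colSum bs ms = z)
      = ind K (x.sum = z.sum) * (G x.sum * (z.map Gi).prod) := by
  induction as generalizing x z with
  | nil =>
    obtain rfl : x = [] := by simpa using hx
    simp only [List.map_nil, states_nil, Finset.sum_singleton, rowWeight, one_mul, colSum,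
      List.sum_nil, hG0]
    have e : (bs.map fun _ => (0 : X)) = z ↔ 0 = z.sum := by
      rw [eq_comm (a := (0 : X)), hM.sum_eq_zero, List.map_const', eq_comm, List.eq_replicate_iff]
      simp [length_of_mem hz]
    rw [ind_congr e, ← mul_one (ind K _), mul_assoc, one_mul]
    refine ind_mul_congr fun h => ?_
    symm
    refine List.prod_eq_one fun y hy => ?_
    obtain ⟨p, hp, rfl⟩ := List.mem_map.1 hy
    rw [hM.sum_eq_zero.1 h.symm p hp, hGi0]
  | cons a as ih =>
    obtain ⟨p, hp, x, hx', rfl⟩ := mem_states_cons.1 hx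
    rw [List.map_cons, sum_states_cons]
    have step : ∀ m ∈ states M.S (bs.map fun b => min a b),
        ∑ ms ∈ states (states M.S) (as.map fun a => bs.map fun b => min a b),
        rowWeight G Gi (p :: x) (m :: ms) * ind K (colSum bs (m :: ms) = z)
        = ∑ v ∈ states M.S bs, ind K (List.zipWith (· + ·) m v = z) *
      (ind K (m.sum = p) * (ind K (v.sum = x.sum) * ((m.map Gi).prod * (v.map Gi).prod))) *
        (G p * G x.sum) := by
      intro m hm
      have hlen := length_of_mem hm
      rw [List.length_map] at hlen
      have key : ∀ ms ∈ states (states M.S) (as.map fun a => bs.map fun b => min a b),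
          rowWeight G Gi (p :: x) (m :: ms) * ind K (colSum bs (m :: ms) = z)
          = ∑ v ∈ states M.S bs, ind K (List.zipWith (· + ·) m v = z) * (ind K (m.sum = p) *
            (G p * (m.map Gi).prod)) * (rowWeight G Gi x ms * ind K (colSum bs ms = v)) := by
        intro ms hms
        have hl : (colSum bs ms).length = bs.length := by
          have := length_of_mem (transposeL_mem hms)
          rw [← transposeL_map_sum, List.length_map, this, List.length_map]
        have e : ind K (colSum bs (m :: ms) = z) = ∑ v ∈ states M.S bs,
            ind K (colSum bs ms = v) * ind K (List.zipWith (· + ·) m v = z) := by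
          rw [colSum]
          by_cases hv : colSum bs ms ∈ states M.S bs
          · rw [sum_ind_mul' _ _ hv fun v => ind K (List.zipWith (· + ·) m v = z)]
          · rw [ind_neg, Finset.sum_eq_zero]
            · intro v hv'
              rw [ind_neg (by rintro rfl; exact hv hv'), zero_mul]
            · rintro rfl
              apply hv
              exact hM.mem_states_of_zipWith hlen hl hz
        rw [e, rowWeight, Finset.mul_sum]
        refine Finset.sum_congr rfl fun v _ => ?_
        ring
      rw [Finset.sum_congr rfl key, Finset.sum_comm]
      refine Finset.sum_congr rfl fun v hv => ?_
      rw [← Finset.mul_sum]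
      by_cases h : List.zipWith (· + ·) m v = z
      swap
      · rw [ind_neg h]; simp
      by_cases h' : m.sum = p
      swap
      · rw [ind_neg h']; simp
      rw [ih hx' hv]
      · have e3 : ind K (x.sum = v.sum) = ind K (v.sum = x.sum) := ind_congr eq_comm
        rw [e3]
        ring
      · intro h''
        have := hs (by
          rw [← h, ← List.sum_add_sum_eq_sum_zipWith_of_length_eq, List.sum_cons, h', h'']
          rw [hlen, length_of_mem hv])
        rw [← h, ← List.sum_add_sum_eq_sum_zipWith_of_length_eq] at this
        · exact hM.mem_of_add_mem' this
        · rw [hlen, length_of_mem hv]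
    rw [Finset.sum_congr rfl step]
    have hsub : states M.S (bs.map fun b => min a b) ⊆ states M.S bs := by
      have := states_mono (S := M.S) (J := bs) (f := fun b => min a b) (g := fun b => b)
        fun b _ => hM.mono (min_le_right a b)
      rwa [List.map_id'] at this
    rw [Finset.sum_subset hsub]
    · simp_rw [← Finset.sum_mul]
      rw [sum_two_rows hM hG0 hGi0 hGG hsq hbs hz, List.sum_cons]
      · calc _ = ind K (p + x.sum = z.sum) * (G (p + x.sum) * (z.map Gi).prod) *
            ((G p * Gi p) * (G x.sum * Gi x.sum)) := by ring
          _ = _ := by rw [hGG, hGG, mul_one, mul_one]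
      · exact hs
    · intro m hm hm'
      refine Finset.sum_eq_zero fun v _ => ?_
      by_cases h1 : List.zipWith (· + ·) m v = z
      swap
      · rw [ind_neg h1, zero_mul, zero_mul]
      by_cases h2 : m.sum = p
      swap
      · rw [ind_neg h2]; simp
      exfalso
      apply hm'
      exact mem_states_min hm fun q hq => hM.mem_of_mem_sum hq (h2 ▸ hp)

theorem eqv_b2 (hM : M.Graded) (hG : ∀ a x, M.g a x = G x) (hGi : ∀ a x, M.gi a x = Gi x)
    (hG0 : G 0 = 1) (c : ℕ+) (hsq : SquareIdentity (M.S c) G Gi) (as bs : List ℕ+) (ha) (hb)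
    (hcap : min (as.map PNat.val).sum (bs.map PNat.val).sum ≤ c)
    (h1 : ∀ x, ∀ w ∈ bs.map (fun y => min x y), w ≤ x)
    (h2 : ∀ y, ∀ w ∈ as.map (fun x => min x y), w ≤ y) :
    M.Eqv (comp (coW c as ha) (.W c bs hb) rfl)
        (comp (comp
            (par (fun x => [x]) (fun x => bs.map fun y => min x y)
              (fun x => .W x (bs.map fun y => min x y) (h1 x)) as)
            (transpose (fun x y => min x y) bs as) rfl)
          (par (fun y => as.map fun x => min x y) (fun y => [y])
            (fun y => coW y (as.map fun x => min x y) (h2 y)) bs) rfl) := by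
  have hGG : ∀ x, G x * Gi x = 1 := fun x => by rw [← hG 1, ← hGi 1, M.g_mul_gi]
  have hGi0 : Gi 0 = 1 := by rw [← hGG 0, hG0, one_mul]
  refine .of_eq (by simp) (by simp) fun x hx z hz => ?_
  have hxs : x.sum = z.sum → z.sum ∈ M.S c := by
    intro h
    rcases min_le_iff.1 hcap with h' | h'
    · rw [← h]; exact hM.sum_mem hx h'
    · exact hM.sum_mem hz h'
  rw [eval_comp_transpose]
  have h3 : ∀ ms ∈ states (states M.S) (as.map fun i => bs.map fun y => min i y),
      M.eval (par (fun x => [x]) (fun x => bs.map fun y => min x y)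
        (fun x => .W x (bs.map fun y => min x y) (h1 x)) as) x ms.flatten *
      M.eval (par (fun y => as.map fun x => min x y) (fun y => [y])
        (fun y => coW y (as.map fun x => min x y) (h2 y)) bs) (transposeL bs ms).flatten z
      = rowWeight G Gi x ms * ind K (colSum bs ms = z) *
        (ind K (∀ p ∈ x, M.Q bs.length ∨ p = 0) * ind K (∀ p ∈ z, M.Q as.length ∨ p = 0)) := by
    intro ms hms
    rw [eval_par_W hG hGi (fun x => bs.map fun y => min x y) h1 bs.length (by simp) as hx hms,
      eval_par_coW (fun y => as.map fun x => min x y) h2 as.length (by simp) bs hz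
        (transposeL_mem hms), transposeL_map_sum]
    ring
  rw [Finset.sum_congr rfl h3, ← Finset.sum_mul, rowWeight_sum hM hG0 hGi0 hGG hsq hb hx hz hxs,
    eval_comp, sum_states_singleton]
  have h4 : ∀ k ∈ M.S c, M.eval (coW c as ha) x [k] * M.eval (.W c bs hb) [k] z
      = ind K (x.sum = k) * (ind K (z.sum = k) * (ind K (M.Q as.length ∨ k = 0) *
        (ind K (M.Q bs.length ∨ k = 0) * (G k * (z.map Gi).prod)))) := by
    intro k hk
    rw [eval_coW M _ _ _ hx hk, eval_W, merge, merge, hG, wti_eq_prod hGi (length_of_mem hz),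
      length_of_mem hx, length_of_mem hz]
    ring
  rw [Finset.sum_congr rfl h4]
  by_cases h : x.sum = z.sum
  · have hQ : ∀ (l : List X) (n : ℕ),
        ind K (∀ p ∈ l, M.Q n ∨ p = 0) = ind K (M.Q n ∨ l.sum = 0) := by
      intro l n
      refine ind_congr ?_
      by_cases hn : M.Q n
      · simp [hn]
      · simp only [hn, false_or, hM.sum_eq_zero]
    rw [sum_ind_mul' _ _ (h ▸ hxs h), ind_pos h, ind_pos h.symm, hQ, hQ, h]
    ring
  · rw [ind_neg h, zero_mul, zero_mul]
    refine Finset.sum_eq_zero fun k _ => ?_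
    by_cases h' : x.sum = k
    · rw [ind_neg (p := z.sum = k) (fun h'' => h (h'.trans h''.symm))]
      simp
    · rw [ind_neg h', zero_mul]

end MatrixRules

end Interp

namespace Interp

theorem transposeL_eq_iff {X β : Type} (J : List β) (n : ℕ) {ms : List (List X)} {z : List X}
    (hz : z.length = J.length) (hms : ms.length = n) (h : ∀ m ∈ ms, m.length = J.length) :
    transposeL J ms = z.map (List.replicate n) ↔ ms = List.replicate n z := by
  induction ms generalizing n with
  | nil =>
    subst hms
    simp only [transposeL, List.map_const', List.length_nil, List.replicate_zero, ← hz, iff_true]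
    rw [← List.map_const']
    rfl
  | cons m ms ih =>
    obtain ⟨n, rfl⟩ : ∃ k, n = k + 1 := ⟨ms.length, by simp [← hms]⟩
    have hms' : ms.length = n := by simpa using hms
    have e : z.map (List.replicate (n + 1)) =
        List.zipWith List.cons z (z.map (List.replicate n)) := by
      rw [List.zipWith_map_right, List.zipWith_self]
      rfl
    have hl : ∀ ms : List (List X), (∀ m ∈ ms, m.length = J.length) →
        (transposeL J ms).length = J.length := by
      intro ms
      induction ms with
      | nil => simp [transposeL]
      | cons m ms ih => intro h; simp [transposeL, ih fun m hm => h m (by simp [hm]), h m]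
    rw [List.replicate_succ, List.cons.injEq,
      ← ih n hms' fun m hm => h m (by simp [hm]), e, transposeL]
    have hm := h m (by simp)
    have hl' := hl ms fun m hm => h m (by simp [hm])
    have hr : (z.map (List.replicate n)).length = J.length := by simp [hz]
    generalize transposeL J ms = u at hl' ⊢
    generalize z.map (List.replicate n) = v at hr ⊢
    generalize J.length = k at hz hm hl' hr
    clear ih hms hms' h e hl
    induction k generalizing z m u v with
    | zero =>
      rw [List.length_eq_zero_iff] at hz hm hl' hr
      subst hz hm hl' hr
      simp
    | succ k ih =>
      obtain ⟨a, z, rfl⟩ := List.exists_cons_of_length_eq_add_one hz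
      obtain ⟨b, m, rfl⟩ := List.exists_cons_of_length_eq_add_one hm
      obtain ⟨c, u, rfl⟩ := List.exists_cons_of_length_eq_add_one hl'
      obtain ⟨d, v, rfl⟩ := List.exists_cons_of_length_eq_add_one hr
      have := ih (z := z) m u v (by simpa using hz) (by simpa using hm) (by simpa using hl')
        (by simpa using hr)
      simp only [List.zipWith_cons_cons, List.cons.injEq, this]
      tauto

/-- The matrix with columns `y` and `u`. -/
def twoCols {X : Type} (y u : List X) : List (List X) := List.zipWith (fun p q => [p, q]) y u

theorem transposeL_twoCols {X : Type} {y u : List X} (h : y.length = u.length) :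
    transposeL (List.range 2) (twoCols y u) = [y, u] := by
  induction y generalizing u with
  | nil => cases u with
    | nil => rfl
    | cons q u => simp at h
  | cons p y ih => cases u with
    | nil => simp at h
    | cons q u =>
      rw [twoCols, List.zipWith_cons_cons, transposeL]
      change List.zipWith _ _ (transposeL _ (twoCols y u)) = _
      rw [ih (by simpa using h)]
      rfl

theorem twoCols_inj {X : Type} {y u y' u' : List X} (h : y.length = u.length) (h' : y'.length =
    u'.length)
    (e : twoCols y u = twoCols y' u') : y = y' ∧ u = u' := by
  have := transposeL_twoCols h
  rw [e, transposeL_twoCols h'] at this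
  simpa [eq_comm] using this

section CopyRules

variable {K X : Type} [CommSemiring K] [AddCommMonoid X] {M : Interp K X}

/-! ### The bialgebra between Z-spiders and W-nodes -/

/-- The Z-spiders of `M` only have diagonal entries. -/
structure Diag (M : Interp K X) : Prop where
  π_eq : ∀ x, M.π x = x
  T_eq : ∀ a k l, M.T a k l = M.gi a k

theorem Diag.fused (hD : M.Diag) (a : ℕ+) : M.Fused a where
  fuse k hk _ l l' _ _ := by
    classical
    simp_rw [hD.T_eq, hD.π_eq]
    rw [Finset.filter_eq' (M.S a) k, if_pos hk, Finset.sum_singleton, mul_comm (M.gi a k),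
      M.g_mul_gi, one_mul]
  unit k _ _ l _ := by rw [hD.T_eq, hD.T_eq]
  pair k _ _ x _ hx y _ hy := by
    rw [hD.π_eq] at hx hy
    rw [hD.T_eq, hx, hy, ind_pos rfl, one_mul]

theorem Diag.card_sector (hD : M.Diag) {a : ℕ+} {w : X} (hw : w ∈ M.S a) :
    open Classical in ((({q ∈ M.S a | M.π q = w}.card : ℕ)) : K) = 1 := by
  classical
  simp_rw [hD.π_eq]
  rw [Finset.filter_eq' (M.S a) w, if_pos hw, Finset.card_singleton, Nat.cast_one]

theorem Diag.Zt_concat (hD : M.Diag) {a : ℕ+} (r : ℂ) {p : X} (hp : p ∈ M.S a) (l : List X) :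
    M.Zt a r (l ++ [p]) = ind K (∀ x ∈ l, x = p) * (M.ρ p r * M.gi a p) := by
  classical
  rw [Zt, Finset.sum_eq_single_of_mem p (by simp [hp, hD.π_eq])]
  · rw [hD.T_eq]
    congr 1
    exact ind_congr (by simp [hD.π_eq, or_imp])
  · intro k _ hk
    rw [ind_neg, zero_mul]
    intro h
    exact hk ((h p (by simp)).symm.trans (hD.π_eq p))

theorem Diag.eval_Z_one (hD : M.Diag) {a : ℕ+} (r : ℂ) (n : ℕ) {x : List X} (hx : x.length = n)
    {p : X} (hp : p ∈ M.S a) : M.eval (.Z a r n 1) x [p]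
      = ind K (x = List.replicate n p) * (M.g a p ^ n * (M.ρ p r * M.gi a p)) := by
  rw [eval_Z, hD.Zt_concat r hp, mul_left_comm, ind_congr (q := x = List.replicate n p)
    (by rw [List.eq_replicate_iff, and_iff_right hx])]
  refine ind_mul_congr ?_
  rintro rfl
  rw [List.map_replicate, List.prod_replicate]

theorem Diag.eval_par_Z (hD : M.Diag) (r : ℂ) (n : ℕ) (as : List ℕ+) {cs : List (List X)}
    {z : List X} (hcs : cs ∈ states (states M.S) (as.map (List.replicate n)))
    (hz : z ∈ states M.S as) :
    M.eval (par (List.replicate n) (List.replicate 1) (fun x => .Z x r n 1) as) cs.flatten z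
      = ind K (cs = z.map (List.replicate n)) *
        (M.wt as z ^ n * ((z.map fun q => M.ρ q r).prod * M.wti as z)) := by
  induction as generalizing cs z with
  | nil =>
    obtain rfl : z = [] := by simpa using hz
    obtain rfl : cs = [] := by simpa using hcs
    refine (ind_pos rfl).trans ?_
    rw [ind_pos (by simp)]
    simp
  | cons a as ih =>
    obtain ⟨p, hp, z, hz', rfl⟩ := mem_states_cons.1 hz
    obtain ⟨c, hc, cs, hcs', rfl⟩ := mem_states_cons.1 hcs
    refine (eval_tensor M (.Z a r n 1) _ (x := c) (z := [p]) (length_of_mem hc) rfl).trans ?_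
    rw [ih hcs' hz', hD.eval_Z_one r n (by simpa using length_of_mem hc) hp, wt_cons, wti_cons,
      List.map_cons, List.map_cons, List.prod_cons, ind_cons]
    ring

theorem eval_par_W_const (b : ℕ+) (bs : List ℕ+) (h : ∀ x ∈ bs, x ≤ b) {α : Type} (l : List α)
    {x : List X} (hx : x.length = l.length) {z : List X} (hz : z ∈ states M.S bs) :
    M.eval (par (fun _ => [b]) (fun _ => bs) (fun _ => .W b bs h) l) x
        (List.replicate l.length z).flatten
      = (x.map fun p => M.merge z p * M.g b p * M.wti bs z).prod := by
  induction l generalizing x with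
  | nil =>
    obtain rfl : x = [] := by simpa using hx
    exact ind_pos rfl
  | cons i l ih =>
    obtain ⟨p, x, rfl⟩ := List.exists_cons_of_length_eq_add_one hx
    refine (eval_tensor M (.W b bs h) _ (x := [p]) (z := z) rfl (length_of_mem hz)).trans ?_
    rw [ih (by simpa using hx), eval_W, List.map_cons, List.prod_cons]

theorem eqv_b1 (hD : M.Diag) (b : ℕ+) (r : ℂ)
    (hρ : ∀ x y, M.ρ (x + y) r = M.ρ x r * M.ρ y r) (hρ0 : M.ρ 0 r = 1) (n : ℕ) (hn : n ≠ 0)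
    (as : List ℕ+) (h) (h1) (h2) :
    M.Eqv (comp (.Z b r n 1) (.W b as h) rfl)
        (comp (comp (par (fun _ => [b]) (fun _ => as) (fun _ => .W b as h) (List.range n))
            (transpose (fun _ x => x) as (List.range n)) h1)
          (par (List.replicate n) (List.replicate 1) (fun x => .Z x r n 1) as) h2) := by
  refine .of_eq (by rw [flatMap_const_singleton, List.length_range])
    (List.flatMap_singleton' as).symm fun x hx z hz => ?_
  have hxl : x.length = n := by simpa using length_of_mem hx
  have hρs : ∀ z : List X, M.ρ z.sum r = (z.map fun q => M.ρ q r).prod := by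
    intro z
    induction z with
    | nil => simpa using hρ0
    | cons q z ih => rw [List.sum_cons, hρ, ih, List.map_cons, List.prod_cons]
  rw [eval_comp_transpose]
  have hrep : List.replicate n z ∈ states (states M.S) ((List.range n).map fun _ =>
      as.map fun x => x) := by
    rw [List.map_id', List.map_const', List.length_range]
    exact mem_states_replicate.2 ⟨by simp, fun m hm => by rwa [List.eq_of_mem_replicate hm]⟩
  have h4 : ∀ ms ∈ states (states M.S) ((List.range n).map fun _ => as.map fun x => x),
      M.eval (par (fun _ => [b]) (fun _ => as) (fun _ => .W b as h) (List.range n)) x ms.flatten *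
      M.eval (par (List.replicate n) (List.replicate 1) (fun x => .Z x r n 1) as)
        (transposeL as ms).flatten z
      = ind K (ms = List.replicate n z) * (M.eval (par (fun _ => [b]) (fun _ => as)
        (fun _ => .W b as h) (List.range n)) x ms.flatten *
        (M.wt as z ^ n * ((z.map fun q => M.ρ q r).prod * M.wti as z))) := by
    intro ms hms
    have htr := transposeL_mem (f := fun (_ : ℕ) x => x) hms
    have e : (as.map fun j => (List.range n).map fun _ => j) = as.map (List.replicate n) := by
      refine List.map_congr_left fun j _ => ?_
      rw [List.map_const', List.length_range]
    rw [e] at htr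
    rw [hD.eval_par_Z r n as htr hz, ind_congr (transposeL_eq_iff as n (length_of_mem hz)
      (by simpa using length_of_mem hms) ?_)]
    · ring
    · rw [List.map_id', List.map_const', List.length_range, mem_states_replicate] at hms
      exact fun m hm => length_of_mem (hms.2 m hm)
  rw [Finset.sum_congr rfl h4, sum_ind_mul _ _ hrep]
  have h5 := eval_par_W_const (M := M) b as h (List.range n) (x := x) (by simpa using hxl) hz
  rw [List.length_range] at h5
  rw [h5, eval_comp]
  refine (sum_states_singleton b _).trans ?_
  have h6 : ∀ k ∈ M.S b, M.eval (.Z b r n 1) x [k] * M.eval (.W b as h) [k] z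
      = ind K (z.sum = k) * (ind K (x = List.replicate n k) * (ind K (M.Q z.length ∨ k = 0) *
        (M.g b k ^ n * M.ρ k r * M.wti as z))) := by
    intro k hk
    rw [hD.eval_Z_one r n hxl hk, eval_W, merge]
    calc _ = ind K (z.sum = k) * (ind K (x = List.replicate n k) * (ind K (M.Q z.length ∨ k = 0) *
        (M.g b k ^ n * M.ρ k r * M.wti as z))) * (M.g b k * M.gi b k) := by ring
      _ = _ := by rw [M.g_mul_gi, mul_one]
  rw [Finset.sum_congr rfl h6]
  by_cases hxz : x = List.replicate n z.sum
  · have hzb : z.sum ∈ M.S b := by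
      refine mem_of_mem_states_replicate hx _ ?_
      rw [hxz]
      exact List.mem_replicate.2 ⟨hn, rfl⟩
    rw [sum_ind_mul' _ _ hzb, ind_pos hxz, one_mul, hxz, List.map_replicate, List.prod_replicate,
      merge, ind_pos rfl, one_mul, hρs, mul_pow, mul_pow]
    have e1 : ind K (M.Q z.length ∨ z.sum = 0) ^ n = ind K (M.Q z.length ∨ z.sum = 0) := by
      by_cases h : M.Q z.length ∨ z.sum = 0
      · rw [ind_pos h, one_pow]
      · rw [ind_neg h, zero_pow hn]
    have e2 : M.wti as z ^ n * M.wt as z ^ n = 1 := by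
      rw [← mul_pow, mul_comm, M.wt_mul_wti (length_of_mem hz), one_pow]
    rw [e1]
    calc _ = ind K (M.Q z.length ∨ z.sum = 0) * M.g b z.sum ^ n * (M.wti as z ^ n * M.wt as z ^ n) *
        ((z.map fun q => M.ρ q r).prod * M.wti as z) := by rw [e2]; ring
      _ = _ := by ring
  · rw [Finset.sum_eq_zero]
    · have : ∃ p ∈ x, z.sum ≠ p := by
        by_contra! hcon
        exact hxz (List.eq_replicate_iff.2 ⟨hxl, fun p hp => (hcon p hp).symm⟩)
      obtain ⟨p, hp, hpz⟩ := this
      rw [List.prod_eq_zero (List.mem_map.2 ⟨p, hp, by rw [merge, ind_neg hpz]; simp⟩), zero_mul]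
    · intro k hk
      by_cases hk' : z.sum = k
      · rw [ind_neg (p := x = List.replicate n k) (by rwa [← hk'])]
        simp
      · rw [ind_neg hk', zero_mul]

/-! ### Copying the outputs of a W-node -/

theorem exists_twoCols {as : List ℕ+} {ms : List (List X)}
    (hms : ms ∈ states (states M.S) (as.map fun x => [x, x])) :
    ∃ y ∈ states M.S as, ∃ u ∈ states M.S as, ms = twoCols y u := by
  induction as generalizing ms with
  | nil =>
    obtain rfl : ms = [] := by simpa using hms
    exact ⟨[], by simp, [], by simp, rfl⟩
  | cons a as ih =>
    obtain ⟨m, hm, ms, hms', rfl⟩ := mem_states_cons.1 hms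
    obtain ⟨p, hp, q, hq, rfl⟩ := mem_states_pair.1 hm
    obtain ⟨y, hy, u, hu, rfl⟩ := ih hms'
    exact ⟨p :: y, by simp [hp, hy], q :: u, by simp [hq, hu], rfl⟩

theorem twoCols_mem {as : List ℕ+} {y u : List X} (hy : y ∈ states M.S as)
    (hu : u ∈ states M.S as) : twoCols y u ∈ states (states M.S) (as.map fun x => [x, x]) := by
  induction as generalizing y u with
  | nil =>
    obtain rfl : y = [] := by simpa using hy
    simp [twoCols]
  | cons a as ih =>
    obtain ⟨p, hp, y, hy', rfl⟩ := mem_states_cons.1 hy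
    obtain ⟨q, hq, u, hu', rfl⟩ := mem_states_cons.1 hu
    rw [twoCols, List.zipWith_cons_cons, List.map_cons]
    exact cons_mem_states.2 ⟨by simp [hp, hq], ih hy' hu'⟩

/-- A Z-spider `1 → 2`, when the label of its second output represents a sector. -/
theorem Fused.eval_copy (hM : M.Graded) {a : ℕ+} (hF : M.Fused a) {w y u : X} (hw : w ∈ M.S a)
    (hy : y ∈ M.S a) (hu : u ∈ M.S a) (hu' : M.π u = u) :
    M.eval (.Z a 1 1 2) [w] [y, u] = ind K (y = w) * ind K (u = M.π w) * M.ρ u 1 := by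
  rw [eval_Z, List.map_singleton, List.prod_singleton, List.singleton_append,
    Zt_perm M a 1 (l := [w, y, u]) (l' := [u, w, y])
      (List.perm_append_comm (l₁ := [w, y]) (l₂ := [u])),
    hM.Zt_cons 1 hu, hu']
  by_cases h : M.π w = u
  swap
  · rw [ind_neg (p := u = M.π w) (Ne.symm h), ind_neg (by simp [h])]
    simp
  by_cases h2 : M.π y = u
  swap
  · rw [ind_neg (p := y = w) (by rintro rfl; exact h2 h), ind_neg (by simp [h2])]
    simp
  rw [ind_pos (by simp [h, h2]), ind_pos h.symm, hF.unit u hu hu' _ (by simp [hw, hy, h, h2]),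
    hF.pair u hu hu' w hw h y hy h2, ind_congr (eq_comm (a := w))]
  calc _ = ind K (y = w) * M.ρ u 1 * (M.g a w * M.gi a w) := by ring
    _ = _ := by rw [M.g_mul_gi]; ring

theorem eval_par_copy (hM : M.Graded) (as : List ℕ+) (hF : ∀ a ∈ as, M.Fused a) {w y u : List X}
    (hw : w ∈ states M.S as) (hy : y ∈ states M.S as) (hu : u ∈ states M.S as)
    (hu' : ∀ q ∈ u, M.π q = q) :
    M.eval (par (fun x => [x]) (fun x => [x, x]) (fun x => .Z x 1 1 2) as) w (twoCols y u).flatten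
      = ind K (y = w) * ind K (u = w.map M.π) * (u.map fun q => M.ρ q 1).prod := by
  induction as generalizing w y u with
  | nil =>
    obtain rfl : w = [] := by simpa using hw
    obtain rfl : y = [] := by simpa using hy
    obtain rfl : u = [] := by simpa using hu
    refine (ind_pos rfl).trans ?_
    rw [ind_pos rfl, ind_pos (by simp)]
    simp
  | cons a as ih =>
    obtain ⟨p, hp, w, hw', rfl⟩ := mem_states_cons.1 hw
    obtain ⟨q, hq, y, hy', rfl⟩ := mem_states_cons.1 hy
    obtain ⟨s, hs, u, hu2, rfl⟩ := mem_states_cons.1 hu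
    refine (eval_tensor M (.Z a 1 1 2) _ (x := [p]) (z := [q, s]) rfl rfl).trans ?_
    rw [(hF a (by simp)).eval_copy hM hp hq hs (hu' s (by simp))]
    refine (congrArg _ (ih (fun a ha => hF a (by simp [ha])) hw' hy' hu2
      fun q hq => hu' q (by simp [hq]))).trans ?_
    rw [List.map_cons, List.map_cons, List.prod_cons, ind_cons, ind_cons]
    ring

theorem eqv_o (hM : M.Graded) (hQ : ∀ n, M.Q n → M.Q 1) (hρ0 : M.ρ 0 1 = 1)
    (hρ : ∀ n, M.Q n → ∀ x, M.π x = x → M.ρ x 1 = 1) (c b : ℕ+) (as : List ℕ+)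
    (hFb : M.Fused b) (hF : ∀ a ∈ as, M.Fused a) (hbc) (hab) (hac) (h1) (h2) (h3) :
    M.Eqv (comp (.W c [b] hbc) (.W b as hab) rfl)
        (comp (comp (comp (comp (.W c as hac)
                (par (fun x => [x]) (fun x => [x, x]) (fun x => .Z x 1 1 2) as) h1)
              (transpose (fun x _ => x) (List.range 2) as) h2)
            (tensor (.id as) (coW b as hab)) h3)
          (tensor (.id as) (.Z b 1 1 0)) rfl) := by
  refine .of_eq rfl (by simp) fun x hx z hz => ?_
  obtain ⟨k, hk, rfl⟩ := mem_states_singleton.1 hx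
  have hzl := length_of_mem hz
  have hπz : z.map M.π ∈ states M.S as := by
    clear hx hab hac h1 h2 h3 hzl hF
    induction as generalizing z with
    | nil =>
      obtain rfl : z = [] := by simpa using hz
      simp
    | cons a as ih =>
      obtain ⟨p, hp, z, hz', rfl⟩ := mem_states_cons.1 hz
      exact cons_mem_states.2 ⟨hM.π_mem.2 hp, ih _ hz'⟩
  rw [eval_comp_assoc, eval_comp_transpose]
  -- the part of the right-hand side after the permutation of wires
  have hB : ∀ y ∈ states M.S as, ∀ u ∈ states M.S as,
      M.eval (comp (tensor (.id as) (coW b as hab)) (tensor (.id as) (.Z b 1 1 0)) rfl) (y ++ u) z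
      = ind K (y = z) * ∑ q ∈ M.S b, M.merge u q * (ind K (M.π q = q) * M.ρ q 1) := by
    intro y hy u hu
    rw [eval_comp, sum_states_append]
    have : ∀ v ∈ states M.S as, ∑ w ∈ states M.S [b],
        M.eval (tensor (.id as) (coW b as hab)) (y ++ u) (v ++ w) *
        M.eval (tensor (.id as) (.Z b 1 1 0)) (v ++ w) z
        = ind K (v = y) * (ind K (v = z) *
          ∑ q ∈ M.S b, M.merge u q * (ind K (M.π q = q) * M.ρ q 1)) := by
      intro v hv
      rw [sum_states_singleton, Finset.mul_sum, Finset.mul_sum]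
      refine Finset.sum_congr rfl fun q hq => ?_
      have e1 := eval_tensor_id M (coW b as hab) (x' := u) (z' := [q]) (length_of_mem hy)
        (length_of_mem hv)
      have e2 := eval_tensor_id M (.Z b 1 1 0) (x' := [q]) (z' := []) (length_of_mem hv) hzl
      rw [List.append_nil] at e2
      refine (congrArg₂ (· * ·) e1 e2).trans ?_
      rw [eval_coW M _ _ _ hu hq, eval_Z, List.map_singleton, List.prod_singleton, List.append_nil,
        hFb.g_mul_Zt_singleton hM 1 hq, ind_congr (eq_comm (a := y))]
      ring
    rw [Finset.sum_congr rfl this]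
    exact sum_ind_mul _ _ hy _
  have hsum : (z.map M.π).sum ∈ M.S b ↔ z.sum ∈ M.S b := by rw [← hM.π_sum, hM.π_mem]
  have hA : ∀ ms ∈ states (states M.S) (as.map fun x => [x, x]),
      M.eval (comp (.W c as hac) (par (fun x => [x]) (fun x => [x, x]) (fun x => .Z x 1 1 2) as) h1)
        [k] ms.flatten *
      M.eval (comp (tensor (.id as) (coW b as hab)) (tensor (.id as) (.Z b 1 1 0)) rfl)
        (transposeL (List.range 2) ms).flatten z
      = ind K (ms = twoCols z (z.map M.π)) * (M.merge z k * M.g c k * M.wti as z *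
          ind K (z.sum ∈ M.S b)) := by
    intro ms hms
    obtain ⟨y, hy, u, hu, rfl⟩ := exists_twoCols hms
    have hyu : y.length = u.length := (length_of_mem hy).trans (length_of_mem hu).symm
    rw [transposeL_twoCols hyu]
    have e0 : [y, u].flatten = y ++ u := by simp
    rw [e0, hB y hy u hu]
    by_cases hus : u.sum ∈ M.S b ∧ M.π u.sum = u.sum
    · have hu' := hM.pure_of_sum hus.2
      rw [Finset.sum_eq_single_of_mem _ hus.1 (fun q _ hq => by
        rw [merge, ind_neg (Ne.symm hq)]; simp), eval_comp]
      rw [Finset.sum_congr rfl fun w hw => by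
        rw [eval_par_copy hM as hF hw hy hu hu', show ∀ d, d * (ind K (y = w) *
          ind K (u = w.map M.π) * (u.map fun q => M.ρ q 1).prod) = ind K (y = w) * (d *
          ind K (u = w.map M.π) * (u.map fun q => M.ρ q 1).prod) from fun d => by ring],
        sum_ind_mul' _ _ hy]
      by_cases hyz : y = z
      swap
      · rw [ind_neg hyz, ind_neg (fun e => hyz (twoCols_inj hyu (by simp) e).1)]
        simp
      subst hyz
      by_cases huz : u = y.map M.π
      swap
      · rw [ind_neg huz, ind_neg (fun e => huz (twoCols_inj hyu (by simp) e).2)]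
        simp
      subst huz
      rw [ind_pos rfl, ind_pos rfl, ind_pos rfl, ind_pos hus.2, ind_pos (hsum.1 hus.1), eval_W]
      by_cases hyk : y.sum = k
      swap
      · rw [merge, ind_neg hyk]
        simp
      by_cases hQy : M.Q y.length ∨ k = 0
      swap
      · rw [merge, ind_neg hQy]
        simp
      have hQy' : M.Q y.length ∨ (y.map M.π).sum = 0 := by
        refine hQy.imp id fun h => ?_
        rw [← hM.π_sum, hyk, h, hM.π_zero]
      have hone : ∀ q ∈ y.map M.π, M.ρ q 1 = 1 := by
        rcases hQy with h | h
        · exact fun q hq => hρ _ h q (hu' q hq)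
        · intro q hq
          obtain ⟨p, hp, rfl⟩ := List.mem_map.1 hq
          rw [hM.sum_eq_zero.1 (hyk.trans h) p hp, hM.π_zero, hρ0]
      have hone' : M.ρ (y.map M.π).sum 1 = 1 := by
        rcases hQy' with h | h
        · exact hρ _ h _ hus.2
        · rw [h, hρ0]
      rw [List.prod_eq_one (fun t ht => by
        obtain ⟨q, hq, rfl⟩ := List.mem_map.1 ht
        exact hone q hq), hone', merge, merge, List.length_map, ind_pos hQy', ind_pos rfl]
      ring
    · rw [Finset.sum_eq_zero, mul_zero, mul_zero]
      · by_cases hms : twoCols y u = twoCols z (z.map M.π)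
        · obtain ⟨rfl, rfl⟩ := twoCols_inj hyu (by simp) hms
          rw [ind_neg (p := y.sum ∈ M.S b), mul_zero, mul_zero]
          intro h
          refine hus ⟨hsum.2 h, ?_⟩
          rw [← hM.π_sum, hM.π_π]
        · rw [ind_neg hms, zero_mul]
      · intro q hq
        by_cases h : u.sum = q
        · subst h
          rw [ind_neg (p := M.π u.sum = u.sum) fun h => hus ⟨hq, h⟩]
          simp
        · rw [merge, ind_neg h]
          simp
  have hlist : (as.map fun i => (List.range 2).map fun _ => i) = as.map fun x => [x, x] := rfl
  rw [hlist]
  refine Eq.trans ?_ (Finset.sum_congr rfl hA).symm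
  rw [sum_ind_mul _ _ (twoCols_mem hz hπz), eval_comp, sum_states_singleton]
  have h6 : ∀ p ∈ M.S b, M.eval (.W c [b] hbc) [k] [p] * M.eval (.W b as hab) [p] z
      = ind K (p = k) * (ind K (M.Q 1 ∨ k = 0) * (M.merge z k * M.g c k * M.wti as z)) := by
    intro p hp
    rw [eval_W, eval_W, wti_cons, wti_nil, merge, List.sum_singleton, List.length_singleton]
    calc _ = ind K (p = k) * (ind K (M.Q 1 ∨ k = 0) * (M.merge z p * M.g c k * M.wti as z)) *
          (M.g b p * M.gi b p) := by ring
      _ = _ := by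
        rw [M.g_mul_gi, mul_one]
        exact ind_mul_congr fun h => by rw [h]
  rw [Finset.sum_congr rfl h6]
  by_cases hzk : z.sum = k
  swap
  · rw [merge, ind_neg hzk]
    simp
  by_cases hQz : M.Q z.length ∨ k = 0
  swap
  · rw [merge, ind_neg hQz]
    simp
  rw [ind_pos (hQz.imp (hQ _) id), hzk]
  by_cases hkb : k ∈ M.S b
  · rw [sum_ind_mul _ _ hkb, ind_pos hkb]
    ring
  · rw [ind_neg hkb, mul_zero]
    refine Finset.sum_eq_zero fun p hp => ?_
    rw [ind_neg (by rintro rfl; exact hkb hp), zero_mul]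

end CopyRules

end Interp

/-! ### Generators that only one schema can introduce -/

section Uses

variable (pZ : ℕ+ → ℂ → ℕ → ℕ → Prop) (po : Prop) (ps : ℂ → Prop)

/-- The diagram contains a Z-spider satisfying `pZ`, or a scalar satisfying `ps`, or, if `po` holds,
a state `|1⟩`. -/
def Uses : {A B : List ℕ+} → Diagram A B → Prop
  | _, _, comp f g _ => Uses f ∨ Uses g
  | _, _, tensor f g => Uses f ∨ Uses g
  | _, _, .Z a r n m => pZ a r n m
  | _, _, .one _ => po
  | _, _, scalar r => ps r
  | _, _, _ => False

variable {pZ po ps}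

@[simp] theorem uses_id (A : List ℕ+) : ¬Uses pZ po ps (.id A) := fun h => h

@[simp] theorem uses_swap (a b : ℕ+) : ¬Uses pZ po ps (swap a b) := fun h => h

@[simp] theorem uses_cup (a : ℕ+) : ¬Uses pZ po ps (cup a) := fun h => h

@[simp] theorem uses_cap (a : ℕ+) : ¬Uses pZ po ps (cap a) := fun h => h

@[simp] theorem uses_W (a : ℕ+) (bs : List ℕ+) (h) : ¬Uses pZ po ps (.W a bs h) := fun h => h

@[simp] theorem uses_Z (a : ℕ+) (r : ℂ) (n m : ℕ) : Uses pZ po ps (.Z a r n m) ↔ pZ a r n m := .rfl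

@[simp] theorem uses_one (a : ℕ+) : Uses pZ po ps (.one a) ↔ po := .rfl

@[simp] theorem uses_scalar (r : ℂ) : Uses pZ po ps (scalar r) ↔ ps r := .rfl

@[simp] theorem uses_comp {A B C D : List ℕ+} (f : Diagram A B) (g : Diagram C D) (h) :
    Uses pZ po ps (comp f g h) ↔ Uses pZ po ps f ∨ Uses pZ po ps g := .rfl

@[simp] theorem uses_tensor {A B C D : List ℕ+} (f : Diagram A B) (g : Diagram C D) :
    Uses pZ po ps (tensor f g) ↔ Uses pZ po ps f ∨ Uses pZ po ps g := .rfl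

@[simp] theorem uses_ofEq {A B : List ℕ+} (h : A = B) : ¬Uses pZ po ps (ofEq h) := by simp [ofEq]

@[simp] theorem uses_slide (a : ℕ+) (B : List ℕ+) : ¬Uses pZ po ps (slide a B) := by
  induction B with
  | nil => simp [slide]
  | cons b B ih => simpa [slide] using ih

@[simp] theorem uses_braid (A B : List ℕ+) : ¬Uses pZ po ps (braid A B) := by
  induction A with
  | nil => simp [braid]
  | cons a A ih => simpa [braid] using ih

@[simp] theorem uses_cups (A : List ℕ+) : ¬Uses pZ po ps (cups A) := by
  induction A with
  | nil => simp [cups]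
  | cons a A ih => simpa [cups] using ih

@[simp] theorem uses_coW (a : ℕ+) (bs : List ℕ+) (h) : ¬Uses pZ po ps (coW a bs h) := by
  simp [coW]

@[simp] theorem uses_ket (k : ℕ) (a : ℕ+) (h) : Uses pZ po ps (ket k a h) ↔ po := by
  induction k generalizing a with
  | zero => rfl
  | succ k ih => simpa [ket] using (ih k.succPNat (le_refl (k + 1))).1

@[simp] theorem uses_interleave {β : Type} (g : β → ℕ+) (k : β → List ℕ+) (J : List β) :
    ¬Uses pZ po ps (interleave g k J) := by
  induction J with
  | nil => exact fun h => h
  | cons j J ih => simpa [interleave] using ih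

@[simp] theorem uses_transpose {α β : Type} (f : α → β → ℕ+) (J : List β) (I : List α) :
    ¬Uses pZ po ps (transpose f J I) := by
  induction I with
  | nil => simp [transpose]
  | cons i I ih => simpa [transpose] using ih

@[simp] theorem uses_par {α : Type} (dom cod : α → List ℕ+) (f : ∀ x, Diagram (dom x) (cod x))
    (l : List α) : Uses pZ po ps (par dom cod f l) ↔ ∃ x ∈ l, Uses pZ po ps (f x) := by
  induction l with
  | nil => exact ⟨fun h => h.elim, by simp⟩
  | cons i l ih => simp [par, ih]

theorem Structural.uses_iff (hZ : ∀ a r n m, pZ a r (n + 1) m ↔ pZ a r n (m + 1))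
    {A B A' B' : List ℕ+} {f : Diagram A B} {g : Diagram A' B'} (h : Structural f g) :
    Uses pZ po ps f ↔ Uses pZ po ps g := by
  cases h <;> simp [hZ, or_assoc, or_comm, or_left_comm]

theorem Derivable.uses_iff (hZ : ∀ a r n m, pZ a r (n + 1) m ↔ pZ a r n (m + 1)) {S : Set Rule}
    (hS : ∀ R ∈ S, ∀ {A B A' B' : List ℕ+} {f : Diagram A B} {g : Diagram A' B'},
      Instance R f g → (Uses pZ po ps f ↔ Uses pZ po ps g))
    {A B A' B' : List ℕ+} {f : Diagram A B} {g : Diagram A' B'} (h : Derivable S f g) :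
    Uses pZ po ps f ↔ Uses pZ po ps g := by
  induction h with
  | structural h => exact h.uses_iff hZ
  | rule R hR h => exact hS R hR h
  | refl f => rfl
  | symm _ ih => exact ih.symm
  | trans _ _ ih ih' => exact ih.trans ih'
  | comp h h' _ _ ih ih' => exact or_congr ih ih'
  | tensor _ _ ih ih' => exact or_congr ih ih'

end Uses

/-- Only `(s)` relates diagrams with and without a Z-spider of capacity `2`, parameter `1` and no
legs. -/
theorem independent_s : ∃ (A B A' B' : List ℕ+) (D₁ : Diagram A B) (D₂ : Diagram A' B'),
    Instance .s D₁ D₂ ∧ ¬Derivable {R' | R' ≠ .s} D₁ D₂ := by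
  refine ⟨_, _, _, _, _, _, Instance.s 2 1 1 0 0 0 0, fun h => ?_⟩
  have := h.uses_iff (pZ := fun a r n m => a = 2 ∧ r = 1 ∧ n = 0 ∧ m = 0) (po := False)
    (ps := fun _ => False) (by simp) ?_
  · simp at this
  · intro R hR A B A' B' f g h
    cases h <;> simp_all

/-- Only `(cp)` relates diagrams with and without the global scalar `2`. -/
theorem independent_cp : ∃ (A B A' B' : List ℕ+) (D₁ : Diagram A B) (D₂ : Diagram A' B'),
    Instance .cp D₁ D₂ ∧ ¬Derivable {R' | R' ≠ .cp} D₁ D₂ := by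
  refine ⟨_, _, _, _, _, _, Instance.cp 1 2 0, fun h => ?_⟩
  have := h.uses_iff (pZ := fun _ _ _ _ => False) (po := False) (ps := fun r => r = 2) (by simp) ?_
  · simp at this
  · intro R hR A B A' B' f g h
    have h2 : ∀ a : ℕ+, 1 / (Nat.factorial a : ℂ) ≠ 2 := by
      intro a ha
      rw [div_eq_iff (Nat.cast_ne_zero.2 (Nat.factorial_ne_zero _))] at ha
      have : (1 : ℕ) = 2 * Nat.factorial a := by exact_mod_cast ha
      omega
    cases h <;> simp_all

/-- Only `(u)` relates diagrams with and without global scalars or states `|1⟩`. -/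
theorem independent_u : ∃ (A B A' B' : List ℕ+) (D₁ : Diagram A B) (D₂ : Diagram A' B'),
    Instance .u D₁ D₂ ∧ ¬Derivable {R' | R' ≠ .u} D₁ D₂ := by
  refine ⟨_, _, _, _, _, _, Instance.u 1 (by simp) (by simp), fun h => ?_⟩
  have := h.uses_iff (pZ := fun _ _ _ _ => False) (po := True) (ps := fun _ => True) (by simp) ?_
  · simp at this
  · intro R hR A B A' B' f g h
    cases h <;> simp_all

open Interp

/-! ### The square identity for factorials -/

/-- Vandermonde's identity, for weights which agree with `k! t ^ k` for `k ≤ c`. -/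
theorem squareIdentity_nat {K : Type} [Field K] {G : ℕ → K} (hG : ∀ k, G k ≠ 0) {t : K}
    (ht : t ≠ 0) {c : ℕ} (hc : ∀ k ≤ c, G k = k.factorial * t ^ k) {D : Finset ℕ}
    {x x' z z' : ℕ} (h : x + x' = z + z') (hx : x + x' ≤ c) (hD : ∀ u ≤ x + x', u ∈ D) :
    ∑ u ∈ D, ∑ v ∈ D, ∑ u' ∈ D, ∑ v' ∈ D, ind K (u + v = z) * (ind K (u' + v' = z') *
      (ind K (u + u' = x) * (ind K (v + v' = x') *
        ((G u)⁻¹ * (G v)⁻¹ * (G u')⁻¹ * (G v')⁻¹))))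
    = G (x + x') * (G x)⁻¹ * (G x')⁻¹ * (G z)⁻¹ * (G z')⁻¹ := by
  have hf : ∀ k ≤ c, (k.factorial : K) ≠ 0 := fun k hk h0 => hG k (by rw [hc k hk, h0, zero_mul])
  have hch : ∀ a b : ℕ, a + b ≤ c →
      (G a)⁻¹ * (G b)⁻¹ = ((a + b).choose a : K) * (G (a + b))⁻¹ := by
    intro a b hab
    have ha := hf a (by omega)
    have hb := hf b (by omega)
    have e : ((a + b).choose a : K) * (a.factorial * b.factorial) = (a + b).factorial := by
      have := Nat.choose_mul_factorial_mul_factorial (Nat.le_add_right a b)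
      rw [Nat.add_sub_cancel_left] at this
      have := congrArg (Nat.cast (R := K)) this
      push_cast at this
      rw [← mul_assoc, this]
    have hs := hf (a + b) hab
    rw [hc a (by omega), hc b (by omega), hc _ hab, ← e, pow_add]
    rw [← e] at hs
    have := left_ne_zero_of_mul hs
    field_simp
  have key : ∀ u ∈ D, ∀ u' ∈ D, ∑ v ∈ D, ∑ v' ∈ D, ind K (u + v = z) * (ind K (u' + v' = z') *
      (ind K (u + u' = x) * (ind K (v + v' = x') *
        ((G u)⁻¹ * (G v)⁻¹ * (G u')⁻¹ * (G v')⁻¹))))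
      = ind K (u + u' = x) * ((z.choose u : K) * (z'.choose u' : K)) * ((G z)⁻¹ * (G z')⁻¹) := by
    intro u hu u' hu'
    by_cases h1 : u + u' = x
    swap
    · rw [ind_neg h1]; simp
    by_cases h2 : u ≤ z
    swap
    · rw [Nat.choose_eq_zero_of_lt (by omega)]
      simp only [Nat.cast_zero, zero_mul, mul_zero]
      refine Finset.sum_eq_zero fun v _ => Finset.sum_eq_zero fun v' _ => ?_
      rw [ind_neg (by omega), zero_mul]
    by_cases h3 : u' ≤ z'
    swap
    · rw [Nat.choose_eq_zero_of_lt (n := z') (by omega)]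
      simp only [Nat.cast_zero, zero_mul, mul_zero]
      refine Finset.sum_eq_zero fun v _ => Finset.sum_eq_zero fun v' _ => ?_
      rw [ind_neg (p := u' + v' = z') (by omega), zero_mul, mul_zero]
    obtain ⟨v, rfl⟩ := Nat.exists_eq_add_of_le h2
    obtain ⟨v', rfl⟩ := Nat.exists_eq_add_of_le h3
    rw [Finset.sum_eq_single_of_mem v (hD v (by omega)), Finset.sum_eq_single_of_mem v'
      (hD v' (by omega)), ind_pos rfl, ind_pos rfl, ind_pos h1, ind_pos (p := v + v' = x')
      (by omega), one_mul, one_mul, one_mul, one_mul, one_mul, hch u v (by omega), mul_assoc,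
      hch u' v' (by omega)]
    · ring
    · intro w _ hw
      rw [ind_neg (p := u' + w = _) (by omega), zero_mul, mul_zero]
    · intro w _ hw
      refine Finset.sum_eq_zero fun v' _ => ?_
      rw [ind_neg (by omega), zero_mul]
  rw [Finset.sum_congr rfl fun u hu => Finset.sum_comm.trans
    (Finset.sum_congr rfl fun u' hu' => key u hu u' hu')]
  simp_rw [← Finset.sum_mul]
  have hv : ∑ u ∈ D, ∑ u' ∈ D, ind K (u + u' = x) * ((z.choose u : K) * (z'.choose u' : K))
      = ((z + z').choose x : K) := by
    rw [Nat.add_choose_eq, Nat.cast_sum, ← Finset.sum_product']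
    simp only [ind, ite_mul, one_mul, zero_mul]
    rw [← Finset.sum_filter]
    refine Finset.sum_congr ?_ fun _ _ => by push_cast; rfl
    ext ⟨a, b⟩
    rw [Finset.mem_filter, Finset.mem_product, Finset.HasAntidiagonal.mem_antidiagonal]
    exact ⟨fun h => h.2, fun h => ⟨⟨hD a (by omega), hD b (by omega)⟩, h⟩⟩
  rw [hv, ← h, mul_assoc (G (x + x')), hch x x' hx]
  have := hG (x + x')
  field_simp

/-! ### Bosonic interpretations -/

/-- The interpretation with labels `0, …, a` for the wires of capacity `a`, with diagonal Z-spiders.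
It is the usual one, in an orthogonal basis where `k` has norm `k!`,
  modified by a rescaling `lam` of
the weights, a restriction `Q` on the arities of W-nodes, a change `φ` of the parameters of
Z-spiders, and another choice of states `|1⟩` and global scalars. -/
def fock (lam : ℕ+ → ℂˣ) (Q : ℕ → Prop) (φ : ℂ → ℂ) (one : ℕ+ → ℕ) (sc : ℂ → ℂ) : Interp ℂ ℕ where
  S a := Finset.range (a + 1)
  g a k := k.factorial * (lam a : ℂ) ^ k
  gi a k := (k.factorial * (lam a : ℂ) ^ k)⁻¹
  Q := Q
  π x := x
  ρ k r := φ r ^ k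
  T a k _ := (k.factorial * (lam a : ℂ) ^ k)⁻¹
  one := one
  sc := sc
  g_mul_gi a k := mul_inv_cancel₀ (mul_ne_zero (Nat.cast_ne_zero.2 (Nat.factorial_ne_zero k))
    (pow_ne_zero _ (lam a).ne_zero))
  T_perm _ _ _ _ _ := rfl

section Fock

variable {lam : ℕ+ → ℂˣ} {Q : ℕ → Prop} {φ : ℂ → ℂ} {one : ℕ+ → ℕ} {sc : ℂ → ℂ}

theorem mem_fock {a : ℕ+} {x : ℕ} : x ∈ (fock lam Q φ one sc).S a ↔ x ≤ a := by
  rw [← Nat.lt_succ_iff]; exact Finset.mem_range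

theorem fock_graded : (fock lam Q φ one sc).Graded where
  zero_mem a := mem_fock.2 (by omega)
  add_mem {a b c x y} hx hy h := by
    rw [mem_fock] at *
    have : (a : ℕ) + b ≤ c := by exact_mod_cast h
    omega
  mem_of_add_mem h := by rw [mem_fock] at *; omega
  eq_zero_of_add h := by omega
  mono {a b} h x hx := by
    rw [mem_fock] at *
    have : (a : ℕ) ≤ b := by exact_mod_cast h
    omega
  π_π _ := rfl
  π_add _ _ := rfl
  π_mem := .rfl
  pure_of_add _ := rfl
  eq_zero_of_π h := h

theorem fock_diag : (fock lam Q φ one sc).Diag where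
  π_eq _ := rfl
  T_eq _ _ _ := rfl

/-- Sufficient conditions for the equations of a schema to hold in `fock`. -/
def FockSound (lam : ℕ+ → ℂˣ) (Q : ℕ → Prop) (φ : ℂ → ℂ) (one : ℕ+ → ℕ) (sc : ℂ → ℂ) : Rule → Prop
  | .s => ∀ r t, φ (r * t) = φ r * φ t
  | .a => ∀ n, Q n
  | .o => φ 1 = 1 ∧ ∀ n, Q n → Q 1
  | .id => Q 1
  | .b1 => True
  | .b2 => ∀ a, lam a = lam 1
  | .plus => (∀ r t, φ (r + t) = φ r + φ t) ∧ Q 2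
  | .cp => (∀ a, one a ≤ a) ∧ ∀ a r, ∃ c : ℂˣ, φ r ^ one a = c * sc r
  | .h => φ 0 = 0
  | .l => lam 1 = 1
  | .i => Q 1 ∧ (∀ a, one a ≤ a) ∧ ∀ a, one a = one 1
  | .u => one 1 = 1 ∧ φ 1 = 1 ∧ Q 2 ∧ ∀ a : ℕ+, sc (1 / (Nat.factorial a : ℂ)) ≠ 0

theorem sum_eq_mul {x n : ℕ} {y : List ℕ} (hl : y.length = n) (h : ∀ p ∈ y, p = x) :
    y.sum = n * x := by
  rw [List.eq_replicate_of_mem h, hl, List.sum_replicate, smul_eq_mul]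

theorem fock_eqv {R : Rule} (hR : FockSound lam Q φ one sc R) {A B A' B' : List ℕ+}
    {f : Diagram A B} {g : Diagram A' B'} (h : Instance R f g) : (fock lam Q φ one sc).Eqv f g := by
  have hM := fock_graded (lam := lam) (Q := Q) (φ := φ) (one := one) (sc := sc)
  have hD := fock_diag (lam := lam) (Q := Q) (φ := φ) (one := one) (sc := sc)
  have hne : ∀ (a : ℕ+) (k : ℕ), (k.factorial : ℂ) * (lam a : ℂ) ^ k ≠ 0 := fun a k =>
    mul_ne_zero (Nat.cast_ne_zero.2 (Nat.factorial_ne_zero k)) (pow_ne_zero _ (lam a).ne_zero)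
  cases h with
  | s a r t n m n' m' =>
    exact eqv_s hM (hD.fused a) (fun k _ _ => by
      change φ (r * t) ^ k = φ r ^ k * φ t ^ k
      rw [hR, mul_pow]) n m n' m' _
  | a c b as ds ds' hc hb hcap hc' => exact eqv_a hM (.inl hR) c b as ds ds' hc hb hcap hc'
  | o c b _ hbc hab hac =>
    exact eqv_o hM hR.2 (pow_zero _) (fun n _ x _ => by
      change φ 1 ^ x = 1
      rw [hR.1, one_pow]) c b _ (hD.fused b) (fun a _ => hD.fused a) hbc hab hac _ _ _
  | id a h => exact eqv_W_id hR a h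
  | b1 b r n hn _ h =>
    exact eqv_b1 hD b r (fun x y => pow_add _ x y) (pow_zero _) n hn _ h _ _
  | b2 c _ _ ha hb hcap =>
    have hl : ∀ a, lam a = lam 1 := hR
    refine eqv_b2 (G := fun k => k.factorial * (lam 1 : ℂ) ^ k)
      (Gi := fun k => (k.factorial * (lam 1 : ℂ) ^ k)⁻¹) hM (fun a x => ?_) (fun a x => ?_)
      (by simp) c ?_ _ _ ha hb hcap _ _
    · change _ * (lam a : ℂ) ^ x = _
      rw [hl]
    · change (_ * (lam a : ℂ) ^ x)⁻¹ = _
      rw [hl]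
    · intro x x' z z' h hx
      rw [mem_fock] at hx
      exact squareIdentity_nat (hne 1) (lam 1).ne_zero (fun _ _ => rfl) h hx
        fun u hu => mem_fock.2 (hu.trans hx)
  | plus a r t h =>
    refine eqv_plus hM (hD.fused a) (fun k hk _ => ?_) h
    rw [mem_fock] at hk
    have e : ∀ x y : ℕ, ind ℂ (x + y = k) * (k.factorial * (lam a : ℂ) ^ k *
        (x.factorial * (lam a : ℂ) ^ x)⁻¹ * (y.factorial * (lam a : ℂ) ^ y)⁻¹ * φ r ^ x * φ t ^ y) *
        ind ℂ (Q 2 ∨ k = 0) = ind ℂ (x + y = k) * (φ r ^ x * φ t ^ y * (k.choose x : ℂ)) := by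
      intro x y
      rw [ind_pos (p := Q 2 ∨ k = 0) (.inl hR.2), mul_one]
      refine ind_mul_congr ?_
      rintro rfl
      have e : ((x + y).choose x : ℂ) * (x.factorial * y.factorial) = (x + y).factorial := by
        have := Nat.choose_mul_factorial_mul_factorial (Nat.le_add_right x y)
        rw [Nat.add_sub_cancel_left] at this
        rw [← mul_assoc]
        exact_mod_cast this
      have hx := hne a x
      have hy := hne a y
      have hx1 := left_ne_zero_of_mul hx
      have hy1 := left_ne_zero_of_mul hy
      have hl := (lam a).ne_zero
      rw [← e, pow_add]
      field_simp
    refine (Finset.sum_congr rfl fun x _ => Finset.sum_congr rfl fun y _ => e x y).trans ?_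
    change _ = φ (r + t) ^ k
    rw [hR.1, (Commute.all (φ r) (φ t)).add_pow', ← Finset.sum_product']
    simp only [ind, ite_mul, one_mul, zero_mul]
    rw [← Finset.sum_filter]
    refine Finset.sum_congr ?_ fun _ _ => by rw [nsmul_eq_mul, mul_comm]
    ext ⟨x, y⟩
    rw [Finset.mem_filter, Finset.mem_product, Finset.HasAntidiagonal.mem_antidiagonal, mem_fock,
      mem_fock]
    exact ⟨fun h => h.2, fun h => ⟨⟨by omega, by omega⟩, h⟩⟩
  | cp a r n =>
    exact eqv_cp hM (hD.fused a) (mem_fock.2 (hR.1 a)) (fun _ => .rfl) (hR.2 a r) n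
  | h a b n hn hab he =>
    refine eqv_h hM (hD.fused a) (hD.fused b) n (fun k _ _ => ?_) (pow_zero _) ?_ ?_ ?_ hab he
    · change φ 0 ^ k = _
      rw [show φ 0 = 0 from hR]
      by_cases hk : k = 0
      · rw [ind_pos hk, hk, pow_zero]
      · rw [ind_neg hk, zero_pow hk]
    · change ((0 : ℕ).factorial : ℂ) * (lam a : ℂ) ^ 0 = 1
      simp
    · change ((0 : ℕ).factorial : ℂ) * (lam b : ℂ) ^ 0 = 1
      simp
    · intro x _ _ y hy hyx hys
      rw [sum_eq_mul (by simpa using length_of_mem hy) hyx, mem_fock] at hys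
      refine .inl ?_
      by_contra hx
      have := Nat.le_mul_of_pos_right n (Nat.pos_of_ne_zero hx)
      omega
  | l n =>
    refine eqv_l hM (hD.fused 1) (fun _ _ => rfl) (fun x hx => ?_) n
    rw [mem_fock, PNat.one_coe] at hx
    change (x.factorial : ℂ) * (lam 1 : ℂ) ^ x = 1
    rw [show lam 1 = 1 from hR, Nat.factorial_eq_one.2 hx]
    simp
  | i a b h =>
    exact eqv_i a b h (mem_fock.2 (hR.2.1 b)) ((hR.2.2 a).trans (hR.2.2 b).symm)
      (.inl hR.1)
  | u a hk h =>
    obtain ⟨h1, hφ, hQ, hsc⟩ := hR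
    refine eqv_u hM (hD.fused a) (mem_fock.2 h1.le) rfl (.inl hQ)
      (fun w hw _ => hD.card_sector hw) ?_ hk h
    · refine ⟨(Units.mk0 _ (mul_ne_zero (hsc a) (hne a a)))⁻¹, fun y hy => ?_⟩
      rw [mem_fock] at hy
      have e : (a : ℕ) • (fock lam Q φ one sc).one 1 = a := by
        change (a : ℕ) • one 1 = _
        rw [h1, smul_eq_mul, mul_one]
      rw [e, ind_pos (hD.π_eq y), Finset.sum_eq_single_of_mem ((a : ℕ) - y) (mem_fock.2 (by omega))]
      · rw [ind_pos (by omega)]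
        change 1 * φ 1 ^ y = _ * (sc _ * ((a : ℕ).factorial * (lam a : ℂ) ^ (a : ℕ)) *
          (1 * φ 1 ^ ((a : ℕ) - y)))
        rw [hφ, one_pow, one_pow, mul_one, mul_one]
        exact (Units.inv_mul (Units.mk0 _ _)).symm
      · intro w _ hw
        rw [ind_neg (by omega), zero_mul]

/-- An instance which fails in an interpretation in which all the other schemas hold. -/
theorem fock_independent {R : Rule} (hR : ∀ R', R' ≠ R → FockSound lam Q φ one sc R')
    {A B A' B' : List ℕ+} {f : Diagram A B} {g : Diagram A' B'} (h : Instance R f g)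
    (hfg : ¬(fock lam Q φ one sc).Eqv f g) :
    ∃ (A B A' B' : List ℕ+) (D₁ : Diagram A B) (D₂ : Diagram A' B'),
      Instance R D₁ D₂ ∧ ¬Derivable {R' | R' ≠ R} D₁ D₂ :=
  ⟨A, B, A', B', f, g, h, fun hd => hfg (eqv_of_derivable _ (fun R' hR' _ _ _ _ _ _ h =>
    fock_eqv (hR R' hR') h) hd)⟩

end Fock

/-! ### The schemas separated by bosonic interpretations -/

theorem fock_S (lam : ℕ+ → ℂˣ) (Q : ℕ → Prop) (φ : ℂ → ℂ) (one : ℕ+ → ℕ) (sc : ℂ → ℂ) (a : ℕ+) :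
    (fock lam Q φ one sc).S a = Finset.range (a + 1) := rfl

theorem fock_Q (lam : ℕ+ → ℂˣ) (Q : ℕ → Prop) (φ : ℂ → ℂ) (one : ℕ+ → ℕ) (sc : ℂ → ℂ) :
    (fock lam Q φ one sc).Q = Q := rfl

theorem fock_g (lam : ℕ+ → ℂˣ) (Q : ℕ → Prop) (φ : ℂ → ℂ) (one : ℕ+ → ℕ) (sc : ℂ → ℂ) (a : ℕ+)
    (k : ℕ) : (fock lam Q φ one sc).g a k = k.factorial * (lam a : ℂ) ^ k := rfl

theorem fock_gi (lam : ℕ+ → ℂˣ) (Q : ℕ → Prop) (φ : ℂ → ℂ) (one : ℕ+ → ℕ) (sc : ℂ → ℂ) (a : ℕ+)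
    (k : ℕ) : (fock lam Q φ one sc).gi a k = (k.factorial * (lam a : ℂ) ^ k)⁻¹ := rfl

theorem fock_one (lam : ℕ+ → ℂˣ) (Q : ℕ → Prop) (φ : ℂ → ℂ) (one : ℕ+ → ℕ) (sc : ℂ → ℂ) :
    (fock lam Q φ one sc).one = one := rfl

/-- When W-nodes with three outputs only have the entry zero, they do not fuse any more. -/
theorem independent_a : ∃ (A B A' B' : List ℕ+) (D₁ : Diagram A B) (D₂ : Diagram A' B'),
    Instance .a D₁ D₂ ∧ ¬Derivable {R' | R' ≠ .a} D₁ D₂ := by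
  refine fock_independent (lam := fun _ => 1) (Q := fun n => n ≤ 2) (φ := id)
    (one := fun _ => 1) (sc := id) ?_
    (Instance.a 1 1 [1, 1] [1] [] (by simp) (by simp) (.inl rfl) (by simp)) ?_
  · intro R hR
    cases R <;> simp_all [FockSound]
    · exact ⟨fun a => a.pos, fun r => ⟨1, by simp⟩⟩
    · exact fun a => a.pos
    · exact fun a => Nat.factorial_ne_zero _
  · rintro ⟨-, -, c, hc⟩
    have h := hc [1] (by simp [fock_S]) [1, 0, 0] (by simp [fock_S])
    simp [eval, merge, wti, fock, ind, sum_states_cons, Finset.sum_range_succ] at h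

/-- When the weights depend on the capacity, a wire of larger capacity between two wires can not be
removed. -/
theorem independent_b2 : ∃ (A B A' B' : List ℕ+) (D₁ : Diagram A B) (D₂ : Diagram A' B'),
    Instance .b2 D₁ D₂ ∧ ¬Derivable {R' | R' ≠ .b2} D₁ D₂ := by
  refine fock_independent (lam := fun a => if a = 2 then Units.mk0 2 two_ne_zero else 1)
    (Q := fun _ => True) (φ := id)
    (one := fun _ => 1) (sc := id) ?_
    (Instance.b2 2 [1] [1] (by simp) (by simp) (by simp)) ?_
  · intro R hR
    cases R <;> simp_all [FockSound]
    · exact ⟨fun a => a.pos, fun r => ⟨1, by simp⟩⟩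
    · exact fun a => a.pos
    · exact fun a => Nat.factorial_ne_zero _
  · rintro ⟨-, -, c, hc⟩
    have h0 := hc [0] (by simp [fock_S]) [0] (by simp [fock_S])
    have h1 := hc [1] (by simp [fock_S]) [1] (by simp [fock_S])
    rw [eval_comp_transpose] at h0 h1
    simp only [eval_comp] at h0 h1
    simp [eval, par, transposeL, merge, wti, fock_S, fock_g, fock_gi, fock_Q, ind, sum_states_cons]
      at h0 h1
    rw [eval_coW _ _ _ _ (by simp [fock_S]) (by simp [fock_S]),
      eval_coW _ _ _ _ (by simp [fock_S]) (by simp [fock_S])] at h0 h1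
    simp [merge, fock_Q, ind] at h0 h1
    rw [← h0] at h1
    norm_num at h1

/-- Squaring the parameters is compatible with their product, not with their sum. -/
theorem independent_plus : ∃ (A B A' B' : List ℕ+) (D₁ : Diagram A B) (D₂ : Diagram A' B'),
    Instance .plus D₁ D₂ ∧ ¬Derivable {R' | R' ≠ .plus} D₁ D₂ := by
  refine fock_independent (lam := fun _ => 1) (Q := fun _ => True) (φ := fun r => r ^ 2)
    (one := fun _ => 1) (sc := fun r => r ^ 2) ?_ (Instance.plus 1 1 1 (by simp)) ?_
  · intro R hR
    cases R <;> simp_all [FockSound, mul_pow]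
    · exact ⟨fun a => a.pos, fun r => ⟨1, by simp⟩⟩
    · exact fun a => a.pos
    · exact fun a => Nat.factorial_ne_zero _
  · rintro ⟨-, -, c, hc⟩
    have h0 := hc [0] (by simp [fock_S]) [] (by simp)
    have h1 := hc [1] (by simp [fock_S]) [] (by simp)
    simp [eval, merge, wti, Zt, fock, ind, sum_states_cons, Finset.sum_range_succ] at h0 h1
    rw [← h0] at h1
    norm_num at h1

/-- The weights of the cups can be rescaled, except for the removal of loops. -/
theorem independent_l : ∃ (A B A' B' : List ℕ+) (D₁ : Diagram A B) (D₂ : Diagram A' B'),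
    Instance .l D₁ D₂ ∧ ¬Derivable {R' | R' ≠ .l} D₁ D₂ := by
  refine fock_independent (lam := fun _ => Units.mk0 2 two_ne_zero) (Q := fun _ => True) (φ := id)
    (one := fun _ => 1) (sc := id) ?_ (Instance.l 1) ?_
  · intro R hR
    cases R <;> simp_all [FockSound]
    · exact ⟨fun a => a.pos, fun r => ⟨1, by simp⟩⟩
    · exact fun a => a.pos
    · exact fun a => Nat.factorial_ne_zero _
  · rintro ⟨-, -, c, hc⟩
    have h0 := hc [0] (by simp [fock_S]) [] (by simp)
    have h1 := hc [1] (by simp [fock_S]) [] (by simp)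
    simp [eval, Zt, fock, ind, sum_states_cons, Finset.sum_range_succ] at h0 h1
    rw [← h0] at h1
    norm_num at h1

/-- The state `|1⟩` can be replaced by `|2⟩` on all the wires of capacity at least two. -/
theorem independent_i : ∃ (A B A' B' : List ℕ+) (D₁ : Diagram A B) (D₂ : Diagram A' B'),
    Instance .i D₁ D₂ ∧ ¬Derivable {R' | R' ≠ .i} D₁ D₂ := by
  refine fock_independent (lam := fun _ => 1) (Q := fun _ => True) (φ := id)
    (one := fun a => if a = 1 then 1 else 2) (sc := id) ?_ (Instance.i 2 1 (by simp)) ?_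
  · intro R hR
    cases R <;> simp_all [FockSound]
    · refine ⟨fun a => ?_, fun a r => ?_⟩
      · split_ifs with h
        · exact a.pos
        · exact Nat.lt_of_le_of_ne a.pos fun h' => h (PNat.eq h'.symm)
      · split_ifs with h
        · exact ⟨1, by simp⟩
        · by_cases hr : r = 0
          · exact ⟨1, by simp [hr]⟩
          · exact ⟨Units.mk0 r hr, by rw [Units.val_mk0, sq]⟩
    · exact fun a => Nat.factorial_ne_zero _
  · rintro ⟨-, -, c, hc⟩
    have h := hc [] (by simp) [2] (by simp [fock_S])
    rw [eval_comp_left _ (w := [1]) _ _ _ (fun y _ => rfl) (by simp [fock_S]),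
      eval_coW _ _ _ _ (by simp [fock_S]) (by simp [fock_S]), eval_one, merge, ind_neg (by simp),
      fock_one] at h
    simp [ind] at h
    exact c.ne_zero h.symm

/-! ### Boolean interpretations -/

/-- The Boolean semiring, with disjunction as addition and conjunction as multiplication. -/
def Truth : Type := Bool

namespace Truth

instance : DecidableEq Truth := inferInstanceAs (DecidableEq Bool)

instance : Fintype Truth := inferInstanceAs (Fintype Bool)

instance : Zero Truth := ⟨false⟩

instance : One Truth := ⟨true⟩

instance : Add Truth := ⟨or⟩

instance : Mul Truth := ⟨and⟩

instance : CommSemiring Truth where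
  add_assoc := by decide
  zero_add := by decide
  add_zero := by decide
  add_comm := by decide
  left_distrib := by decide
  right_distrib := by decide
  zero_mul := by decide
  mul_zero := by decide
  mul_assoc := by decide
  one_mul := by decide
  mul_one := by decide
  mul_comm := by decide
  nsmul := nsmulRec
  npow := npowRec

theorem eq_zero_or_one : ∀ x : Truth, x = 0 ∨ x = 1 := by decide

theorem one_add : ∀ x : Truth, 1 + x = 1 := by decide

theorem zero_ne_one : (0 : Truth) ≠ 1 := by decide

theorem eq_zero_of_add : ∀ {x y : Truth}, x + y = 0 → x = 0 := by decide

theorem sum_eq_one {α : Type} {s : Finset α} {f : α → Truth} (a : α) (ha : a ∈ s) (h : f a = 1) :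
    ∑ x ∈ s, f x = 1 := by
  classical
  rw [← Finset.add_sum_erase s f ha, h, one_add]

end Truth

/-- The interpretation with Boolean coefficients and Boolean labels, with diagonal Z-spiders. -/
def boolean (Q : ℕ → Prop) (ρ : Truth → Truth) (one : Truth) : Interp Truth Truth where
  S _ := Finset.univ
  g _ _ := 1
  gi _ _ := 1
  Q := Q
  π x := x
  ρ k _ := ρ k
  T _ _ _ := 1
  one _ := one
  sc _ := 1
  g_mul_gi _ _ := one_mul 1
  T_perm _ _ _ _ _ := rfl

section Boolean

variable {Q : ℕ → Prop} {ρ : Truth → Truth} {one : Truth}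

theorem mem_boolean (a : ℕ+) (x : Truth) : x ∈ (boolean Q ρ one).S a := Finset.mem_univ x

theorem boolean_graded : (boolean Q ρ one).Graded where
  zero_mem a := mem_boolean a _
  add_mem _ _ _ := mem_boolean _ _
  mem_of_add_mem _ := mem_boolean _ _
  eq_zero_of_add := Truth.eq_zero_of_add
  mono _ := subset_rfl
  π_π _ := rfl
  π_add _ _ := rfl
  π_mem := .rfl
  pure_of_add _ := rfl
  eq_zero_of_π h := h

theorem boolean_diag : (boolean Q ρ one).Diag where
  π_eq _ := rfl
  T_eq _ _ _ := rfl

/-- Sufficient conditions for the equations of a schema to hold in `boolean`. -/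
def BooleanSound (Q : ℕ → Prop) (ρ : Truth → Truth) (one : Truth) : Rule → Prop
  | .s => True
  | .a => (∀ n, Q n) ∨ ∀ n, ¬Q n
  | .o => ∀ n, Q n → Q 1 ∧ ρ 1 = 1
  | .id => Q 1
  | .b1 => True
  | .b2 => True
  | .plus => Q 2 ∨ ρ 1 = 0
  | .cp => ρ one = 1
  | .h => ρ 1 = 0
  | .l => True
  | .i => Q 1 ∨ one = 0
  | .u => ρ 1 = one ∧ (Q 2 ∨ one = 0)

theorem boolean_eqv {R : Rule} (hρ : ρ 0 = 1) (hR : BooleanSound Q ρ one R) {A B A' B' : List ℕ+}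
    {f : Diagram A B} {g : Diagram A' B'} (h : Instance R f g) : (boolean Q ρ one).Eqv f g := by
  have hM := boolean_graded (Q := Q) (ρ := ρ) (one := one)
  have hD := boolean_diag (Q := Q) (ρ := ρ) (one := one)
  have hmul : ∀ x y, ρ (x + y) = ρ x * ρ y := by
    revert hρ; clear hR hM hD
    revert ρ; decide
  cases h with
  | s a r t n m n' m' =>
    exact eqv_s hM (hD.fused a) (fun k _ _ => by
      change ρ k = ρ k * ρ k
      generalize ρ k = x
      revert x; decide) n m n' m' _
  | a c b as ds ds' hc hb hcap hc' => exact eqv_a hM hR c b as ds ds' hc hb hcap hc'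
  | o c b _ hbc hab hac =>
    exact eqv_o hM (fun n hn => (hR n hn).1) hρ (fun n hn x _ => by
      change ρ x = 1
      rcases Truth.eq_zero_or_one x with rfl | rfl
      exacts [hρ, (hR n hn).2]) c b _ (hD.fused b) (fun a _ => hD.fused a) hbc hab hac _ _ _
  | id a h => exact eqv_W_id hR a h
  | b1 b r n hn _ h => exact eqv_b1 hD b r hmul hρ n hn _ h _ _
  | b2 c _ _ ha hb hcap =>
    refine eqv_b2 (G := fun _ => 1) (Gi := fun _ => 1) hM (fun _ _ => rfl) (fun _ _ => rfl) rfl c ?_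
      _ _ ha hb hcap _ _
    intro x x' z z' h _
    have hsq : ∀ x x' z z' : Truth, x + x' = z + z' → x * z + x' * z = z ∧ x * z' + x' * z' = z' ∧
      x * z + x * z' = x ∧ x' * z + x' * z' = x' := by decide
    obtain ⟨h1, h2, h3, h4⟩ := hsq x x' z z' h
    refine (Truth.sum_eq_one (x * z) (mem_boolean _ _) (Truth.sum_eq_one (x' * z) (mem_boolean _ _)
      (Truth.sum_eq_one (x * z') (mem_boolean _ _) (Truth.sum_eq_one (x' * z') (mem_boolean _ _)
      ?_)))).trans ?_
    · rw [ind_pos h1, ind_pos h2, ind_pos h3, ind_pos h4]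
      rfl
    · simp
  | plus a r t h =>
    refine eqv_plus hM (hD.fused a) (fun k hk _ => ?_) h
    change ∑ x, ∑ y, ind Truth (x + y = k) * (1 * 1 * 1 * ρ x * ρ y) * ind Truth (Q 2 ∨ k = 0) = ρ k
    by_cases hQ : Q 2 ∨ k = 0
    · have e : ∀ x y, ind Truth (x + y = k) * (1 * 1 * 1 * ρ x * ρ y) * ind Truth (Q 2 ∨ k = 0)
          = ind Truth (x + y = k) * ρ k := fun x y => by
        rw [ind_pos hQ, mul_one]
        refine ind_mul_congr ?_
        rintro rfl
        rw [hmul, mul_one, mul_one, one_mul]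
      simp_rw [e, ← Finset.sum_mul]
      rw [Truth.sum_eq_one 0 (Finset.mem_univ _)
        (Truth.sum_eq_one k (Finset.mem_univ _) (ind_pos (zero_add k))), one_mul]
    · obtain rfl : k = 1 := (Truth.eq_zero_or_one k).resolve_left fun h => hQ (.inr h)
      rw [hR.resolve_left fun h => hQ (.inl h), ind_neg hQ]
      simp
  | cp a r n =>
    exact eqv_cp hM (hD.fused a) (mem_boolean _ _) (fun _ => .rfl) ⟨1, by
      change ρ one = 1 * 1
      rw [show ρ one = 1 from hR, one_mul]⟩ n
  | h a b n hn hab he =>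
    refine eqv_h hM (hD.fused a) (hD.fused b) n (fun k _ _ => ?_) hρ rfl rfl ?_ hab he
    · change ρ k = _
      rcases Truth.eq_zero_or_one k with rfl | rfl
      · rw [hρ, ind_pos rfl]
      · rw [show ρ 1 = 0 from hR, ind_neg Truth.zero_ne_one.symm]
    · intro x _ _ y _ _ _
      exact (Truth.eq_zero_or_one x).imp id fun h => by rw [h]; exact hR
  | l n => exact eqv_l hM (hD.fused 1) (fun _ _ => rfl) (fun _ _ => rfl) n
  | i a b h => exact eqv_i a b h (mem_boolean _ _) rfl hR
  | u a hk h =>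
    refine eqv_u hM (hD.fused a) (mem_boolean _ _) rfl hR.2 (fun w hw _ => hD.card_sector hw)
      ⟨1, fun y _ => ?_⟩ hk h
    change ind Truth (y = y) * ρ y = 1 * (1 * 1 * ∑ w, ind Truth (y + w = (a : ℕ) • one) * ρ w)
    have ha : (a : ℕ) • one = one := by
      obtain ⟨k, hk⟩ : ∃ k, (a : ℕ) = k + 1 := ⟨a.natPred, a.natPred_add_one.symm⟩
      rw [hk]
      clear hk
      induction k with
      | zero => rw [zero_add, one_nsmul]
      | succ k ih => rw [succ_nsmul, ih]; exact (by decide : ∀ x : Truth, x + x = x) one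
    rw [ha, ind_pos rfl, one_mul, one_mul, one_mul, one_mul]
    obtain ⟨h1, -⟩ := hR
    rcases Truth.eq_zero_or_one one with h0 | h0
    · rw [h0] at h1 ⊢
      rw [Finset.sum_eq_single_of_mem 0 (Finset.mem_univ _), hρ, mul_one]
      · rcases Truth.eq_zero_or_one y with rfl | rfl
        · rw [hρ, ind_pos (zero_add 0)]
        · rw [h1, ind_neg (by decide)]
      · intro w _ hw
        rw [(Truth.eq_zero_or_one w).resolve_left hw, h1, mul_zero]
    · rw [h0] at h1 ⊢
      have h1' : ∀ w, ρ w = 1 := fun w => by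
        rcases Truth.eq_zero_or_one w with rfl | rfl
        exacts [hρ, h1]
      rw [Truth.sum_eq_one 1 (Finset.mem_univ _), h1']
      rw [h1', mul_one, ind_pos ((by decide : ∀ x : Truth, x + 1 = 1) y)]

theorem boolean_independent {R : Rule} (hρ : ρ 0 = 1) (hR : ∀ R', R' ≠ R → BooleanSound Q ρ one R')
    {A B A' B' : List ℕ+} {f : Diagram A B} {g : Diagram A' B'} (h : Instance R f g)
    {x z : List Truth} (hx : x.length = A.length) (hz : z.length = B.length)
    (hxz : ((boolean Q ρ one).eval f x z = 0 ∧ (boolean Q ρ one).eval g x z = 1) ∨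
      (boolean Q ρ one).eval f x z = 1 ∧ (boolean Q ρ one).eval g x z = 0) :
    ∃ (A B A' B' : List ℕ+) (D₁ : Diagram A B) (D₂ : Diagram A' B'),
      Instance R D₁ D₂ ∧ ¬Derivable {R' | R' ≠ R} D₁ D₂ := by
  refine ⟨A, B, A', B', f, g, h, fun hd => ?_⟩
  obtain ⟨-, -, c, hc⟩ := eqv_of_derivable _ (fun R' hR' _ _ _ _ _ _ h =>
    boolean_eqv hρ (hR R' hR') h) hd
  have hmem : ∀ {A : List ℕ+} {x : List Truth}, x.length = A.length →
      x ∈ states (boolean Q ρ one).S A := by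
    intro A
    induction A with
    | nil => intro x hx; simpa using hx
    | cons a A ih =>
      intro x hx
      obtain ⟨p, x, rfl⟩ := List.exists_cons_of_length_eq_add_one hx
      exact cons_mem_states.2 ⟨mem_boolean _ _, ih (by simpa using hx)⟩
  have hcxz := hc x (hmem hx) z (hmem hz)
  have hc1 : (c : Truth) = 1 := by
    rcases Truth.eq_zero_or_one c with h | h
    · have := c.mul_inv
      rw [h, zero_mul] at this
      exact absurd this Truth.zero_ne_one
    · exact h
  rw [hc1, one_mul] at hcxz
  rcases hxz with ⟨h1, h2⟩ | ⟨h1, h2⟩ <;> rw [h1, h2] at hcxz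
  exacts [Truth.zero_ne_one hcxz, Truth.zero_ne_one hcxz.symm]

end Boolean

/-- Only the equation for wires excludes that all the W-nodes are restricted to the label zero. -/
theorem independent_id : ∃ (A B A' B' : List ℕ+) (D₁ : Diagram A B) (D₂ : Diagram A' B'),
    Instance .id D₁ D₂ ∧ ¬Derivable {R' | R' ≠ .id} D₁ D₂ := by
  refine boolean_independent (Q := fun _ => False) (ρ := fun k => ind Truth (k = 0)) (one := 0)
    (ind_pos rfl) ?_ (Instance.id 1 (by simp)) (x := [1]) (z := [1]) rfl rfl (.inl ⟨?_, ?_⟩)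
  · intro R hR
    cases R <;> simp_all [BooleanSound, ind, Truth.zero_ne_one.symm]
  · rw [eval_W, merge]
    simp [boolean, ind, Truth.zero_ne_one.symm]
  · exact ind_pos rfl

/-- When the Z-spiders only have the entry with all labels zero,
  the right-hand side of `(o)` vanishes
on the label one. -/
theorem independent_o : ∃ (A B A' B' : List ℕ+) (D₁ : Diagram A B) (D₂ : Diagram A' B'),
    Instance .o D₁ D₂ ∧ ¬Derivable {R' | R' ≠ .o} D₁ D₂ := by
  refine boolean_independent (Q := fun _ => True) (ρ := fun k => ind Truth (k = 0)) (one := 0)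
    (ind_pos rfl) ?_ (Instance.o 1 1 [1] (by simp) (by simp) (by simp)) (x := [1]) (z :=
      [1]) rfl rfl
    (.inr ⟨?_, ?_⟩)
  · intro R hR
    cases R <;> simp_all [BooleanSound, ind, Truth.zero_ne_one.symm]
  · rw [eval_comp]
    simp [eval, merge, wti, boolean, ind, sum_states_cons]
  · rw [eval_comp]
    refine Finset.sum_eq_zero fun w _ => ?_
    rw [eval_comp_transpose]
    refine mul_eq_zero_of_left (Finset.sum_eq_zero fun ms hms => mul_eq_zero_of_left ?_ _) _
    obtain ⟨m, hm, rfl⟩ := mem_states_singleton.1 hms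
    obtain ⟨p, -, q, -, rfl⟩ := mem_states_pair.1 hm
    -- The W-node produces the label `1`, and the Z-spider with parameter `1` annihilates it.
    rw [eval_comp]
    simp only [eval, par, merge, wti, boolean, ind, sum_states_cons, Zt]
    refine Finset.sum_eq_zero fun x _ => ?_
    rcases Truth.eq_zero_or_one x with rfl | rfl <;> simp [Truth.zero_ne_one,
      Truth.zero_ne_one.symm]

/-- With Boolean labels the capacity of a wire does not bound the number of its inputs. -/
theorem independent_h : ∃ (A B A' B' : List ℕ+) (D₁ : Diagram A B) (D₂ : Diagram A' B'),
    Instance .h D₁ D₂ ∧ ¬Derivable {R' | R' ≠ .h} D₁ D₂ := by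
  refine boolean_independent (Q := fun _ => True) (ρ := fun _ => 1) (one := 1)
    rfl ?_ (Instance.h 1 1 2 (by simp) (by simp) (by simp)) (x := [1]) (z := [1]) rfl rfl
    (.inr ⟨?_, ?_⟩)
  · intro R hR
    cases R <;> simp_all [BooleanSound, Truth.zero_ne_one.symm]
  · rw [eval_comp]
    have h2 : [1, 1] ∈ states (boolean (fun _ => True) (fun _ => 1) 1).S (List.replicate 2 1) :=
      mem_states_replicate.2 ⟨rfl, fun _ _ => mem_boolean _ _⟩
    refine Truth.sum_eq_one [1, 1] h2 ?_
    rw [eval_Z, eval_coW _ _ _ _ h2 (mem_boolean _ _), show [1] ++ [(1 : Truth), 1] = [1,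
      1] ++ [1] from rfl, Diag.Zt_concat boolean_diag _ (mem_boolean _ _) [1, 1]]
    simp [merge, boolean, ind]
    exact Truth.one_add 1
  · simp [eval, merge, wti, boolean, ind]

/-! ### Reduction of complex numbers to positive characteristic -/

theorem isJacobsonRing_int : IsJacobsonRing ℤ := by
  rw [isJacobsonRing_iff_prime_eq]
  intro P hP
  by_cases h : P = ⊥
  · subst h
    refine le_antisymm (fun x hx => ?_) Ideal.le_jacobson
    have := Ideal.mem_jacobson_bot.1 hx (3 * x)
    rw [Int.isUnit_iff] at this
    have hx2 : x * (3 * x) + 1 = 1 := by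
      rcases this with h | h
      · exact h
      · nlinarith [mul_self_nonneg x]
    have : x * x = 0 := by linarith
    simpa using this
  · have := IsPrime.to_maximal_ideal h
    exact Ideal.jacobson_eq_self_of_isMaximal

/-- A field which is finitely generated as an abelian group is algebraic over a finite prime
  field. -/
theorem exists_ringHom_of_finite_int (S : Type) [Field S] [Module.Finite ℤ S] :
    ∃ p : ℕ, ∃ _ : Fact p.Prime, CharP S p ∧ Nonempty (S →+* AlgebraicClosure (ZMod p)) := by
  obtain ⟨p, hp⟩ := CharP.exists S
  have hp0 : p ≠ 0 := by
    rintro rfl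
    have := CharP.charP_to_charZero S
    exact Int.not_isField (isField_of_isIntegral_of_isField (S := S)
      (FaithfulSMul.algebraMap_injective ℤ S) (Field.toIsField _))
  have := Fact.mk ((CharP.char_is_prime_or_zero S p).resolve_right hp0)
  let := ZMod.algebra S p
  have : Algebra.IsIntegral (ZMod p) S := .tower_top (R := ℤ)
  exact ⟨p, ‹_›, hp, ⟨(IsAlgClosed.lift : S →ₐ[ZMod p] AlgebraicClosure (ZMod p)).toRingHom⟩⟩

/-- Finitely many complex numbers can be mapped to an algebraic closure of a finite field of large
characteristic, compatibly with their sums and products. -/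
theorem exists_ringHom_algebraicClosure (T : Finset ℂ) (N : ℕ) :
    ∃ (p : ℕ) (_ : Fact p.Prime) (A : Subalgebra ℤ ℂ) (_ : A →+* AlgebraicClosure (ZMod p)),
      N < p ∧ ∀ r ∈ T, r ∈ A := by
  have := isJacobsonRing_int
  let A := Algebra.adjoin ℤ ((insert (N.factorial : ℂ)⁻¹ T : Finset ℂ) : Set ℂ)
  have hT : ∀ r ∈ insert (N.factorial : ℂ)⁻¹ T, r ∈ A := fun r hr => Algebra.subset_adjoin hr
  have : Algebra.FiniteType ℤ A := (Subalgebra.fg_iff_finiteType _).1 ⟨_, rfl⟩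
  obtain ⟨m, hm⟩ := Ideal.exists_maximal A
  let := Ideal.Quotient.field m
  have : Algebra.FiniteType ℤ (A ⧸ m) := .of_surjective (Ideal.Quotient.mkₐ ℤ m)
    (Ideal.Quotient.mkₐ_surjective ℤ m)
  have : Module.Finite ℤ (A ⧸ m) := finite_of_finite_type_of_isJacobsonRing ℤ _
  obtain ⟨p, hp, hc, ⟨f⟩⟩ := exists_ringHom_of_finite_int (A ⧸ m)
  refine ⟨p, hp, A, f.comp (Ideal.Quotient.mk m), ?_, fun r hr => hT r (by simp [hr])⟩
  by_contra hN
  have h1 : ((N.factorial : ℕ) : A ⧸ m) = 0 :=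
    (CharP.cast_eq_zero_iff _ p _).2 (hp.out.dvd_factorial.2 (not_lt.1 hN))
  let x : A := ⟨(N.factorial : ℂ)⁻¹, hT _ (by simp)⟩
  have h2 : ((N.factorial : ℕ) : A) * x = 1 := by
    apply Subtype.ext
    push_cast
    exact mul_inv_cancel₀ (Nat.cast_ne_zero.2 N.factorial_ne_zero)
  have h3 := congrArg (Ideal.Quotient.mk m) h2
  rw [map_mul, map_natCast, h1, zero_mul, map_one] at h3
  exact zero_ne_one h3

/-- A prime number, with a map from the complex numbers to a field of this characteristic. -/
abbrev Reduction : Type := Σ p : {p : ℕ // Fact p.Prime},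
  ℂ → (haveI := p.2; AlgebraicClosure (ZMod p))

/-- The reductions in characteristic larger than `N` which are compatible with the sums and products
of elements of `T`. -/
def Reduction.good (j : Finset ℂ × ℕ) : Set Reduction :=
  {i | j.2 < i.1 ∧ i.2 0 = 0 ∧ i.2 1 = 1 ∧ ∀ r ∈ j.1, ∀ t ∈ j.1,
    i.2 (r * t) = i.2 r * i.2 t ∧ i.2 (r + t) = i.2 r + i.2 t}

theorem Reduction.good_nonempty (j : Finset ℂ × ℕ) : (Reduction.good j).Nonempty := by
  obtain ⟨p, hp, A, f, hN, hT⟩ := exists_ringHom_algebraicClosure j.1 j.2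
  have hf : ∀ r (h : r ∈ A), (fun r : ℂ => open Classical in if h : r ∈ A then f ⟨r, h⟩ else 0) r
      = f ⟨r, h⟩ := fun r h => dif_pos h
  refine ⟨⟨⟨p, hp⟩, fun r => open Classical in if h : r ∈ A then f ⟨r, h⟩ else 0⟩, hN,
    (hf 0 A.zero_mem).trans (map_zero f), (hf 1 A.one_mem).trans (map_one f), fun r hr t ht => ?_⟩
  have hr := hT r hr
  have ht := hT t ht
  refine ⟨?_, ?_⟩
  · refine (hf _ (A.mul_mem hr ht)).trans ?_
    refine Eq.trans ?_ (congrArg₂ (· * ·) (hf r hr) (hf t ht)).symm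
    rw [← map_mul]
    rfl
  · refine (hf _ (A.add_mem hr ht)).trans ?_
    refine Eq.trans ?_ (congrArg₂ (· + ·) (hf r hr) (hf t ht)).symm
    rw [← map_add]
    rfl

/-- The filter generated by the sets `Reduction.good j`. -/
def Reduction.filter : Filter Reduction := ⨅ j, Filter.principal (Reduction.good j)

theorem Reduction.good_mem (j : Finset ℂ × ℕ) : ∀ᶠ i in Reduction.filter, i ∈ Reduction.good j :=
  Filter.mem_iInf_of_mem j (Filter.mem_principal_self _)

instance : Reduction.filter.NeBot := by
  classical
  refine Filter.iInf_neBot_of_directed' (fun j j' => ⟨(j.1 ∪ j'.1, max j.2 j'.2), ?_, ?_⟩)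
    fun j => Filter.principal_neBot_iff.2 (Reduction.good_nonempty j)
  all_goals
    refine Filter.principal_mono.2 fun i hi => ⟨?_, hi.2.1, hi.2.2.1, fun r hr t ht =>
      hi.2.2.2 r (by simp [hr]) t (by simp [ht])⟩
    exact lt_of_le_of_lt (by simp) hi.1

/-! ### A family of Frobenius algebras -/

/-- The commutative algebra `F ⊕ F N ⊕ V` where `V` has basis `R`, `N` is orthogonal to `N` and `V`,
and the product of `v, w ∈ V` is `N` times their scalar product,
  in which the vectors of the basis are
orthogonal with squares `c`. -/
@[ext]
structure SectorAlgebra {F X : Type} (R : Finset X) (c : X → F) where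
  /-- the coefficient of the unit -/
  scal : F
  /-- the coefficient of `N` -/
  nil : F
  /-- the component in `V` -/
  vec : X → F

namespace SectorAlgebra

variable {F X : Type} [Field F] {R : Finset X} {c : X → F}

instance : One (SectorAlgebra R c) := ⟨⟨1, 0, 0⟩⟩

instance : Mul (SectorAlgebra R c) :=
  ⟨fun a b => ⟨a.scal * b.scal, a.scal * b.nil + b.scal * a.nil + ∑ r ∈ R, a.vec r * b.vec r * c r,
    fun r => a.scal * b.vec r + b.scal * a.vec r⟩⟩

@[simp] theorem one_scal : (1 : SectorAlgebra R c).scal = 1 := rfl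

@[simp] theorem one_nil : (1 : SectorAlgebra R c).nil = 0 := rfl

@[simp] theorem one_vec (r : X) : (1 : SectorAlgebra R c).vec r = 0 := rfl

@[simp] theorem mul_scal (a b : SectorAlgebra R c) : (a * b).scal = a.scal * b.scal := rfl

@[simp] theorem mul_nil (a b : SectorAlgebra R c) :
    (a * b).nil = a.scal * b.nil + b.scal * a.nil + ∑ r ∈ R, a.vec r * b.vec r * c r := rfl

@[simp] theorem mul_vec (a b : SectorAlgebra R c) (r : X) :
    (a * b).vec r = a.scal * b.vec r + b.scal * a.vec r := rfl

instance : CommMonoid (SectorAlgebra R c) where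
  mul_assoc a b d := by
    ext
    · simp [mul_assoc]
    · simp only [mul_scal, mul_nil, mul_vec, add_mul, mul_add, Finset.sum_add_distrib,
        Finset.mul_sum]
      ring_nf
    · simp; ring
  one_mul a := by ext <;> simp
  mul_one a := by ext <;> simp
  mul_comm a b := by
    ext
    · simp [mul_comm]
    · simp only [mul_nil, mul_comm (a.vec _)]; ring
    · simp; ring

open Classical in
/-- The elements of a basis, indexed by `R` and two more elements `e` and `s`: the vectors of
  `R`, the
unit, and a multiple of `N - (c e)⁻¹`. -/
def elt (R : Finset X) (c : X → F) (e s : X) (β : F) (x : X) : SectorAlgebra R c :=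
  if x = e then 1 else if x = s then ⟨-(β * (c e)⁻¹), β, 0⟩ else ⟨0, 0, Pi.single x 1⟩

/-- The linear form with value `u` on the unit, `1` on `N` and `0` on `V`. -/
def form (u : F) (a : SectorAlgebra R c) : F := a.scal * u + a.nil

/-- The form applied to the product of the basis vectors with the labels in a list. -/
def tensor (R : Finset X) (c : X → F) (e s : X) (β : F) (l : List X) : F :=
  form (c e) (l.map (elt R c e s β)).prod

theorem form_mul_elt_vec {e s : X} {β u : F} {r : X} (hr : r ∈ R) (he : r ≠ e) (hs : r ≠ s)
    (a : SectorAlgebra R c) : form u (a * elt R c e s β r) = a.vec r * c r := by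
  classical
  rw [elt, if_neg he, if_neg hs, form, mul_scal, mul_nil, Finset.sum_eq_single_of_mem r hr]
  · simp
  · intro b _ hb
    simp [hb]

theorem form_mul_elt_right {e s : X} (hes : s ≠ e) (hc : c e ≠ 0) {β : F} (a : SectorAlgebra R c) :
    form (c e) (a * elt R c e s β s) = -(β * (c e)⁻¹ * a.nil) := by
  rw [elt, if_neg hes, if_pos rfl, form, mul_scal, mul_nil]
  simp
  field_simp
  ring

theorem elt_left {e s : X} {β : F} : elt R c e s β e = 1 := if_pos rfl

variable {E : Finset X} {e s : X} {β : F}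

/-- The basis vectors are orthogonal for the form, with squares `c`. -/
theorem tensor_pair (hE : ∀ x, x ∈ E ↔ x = e ∨ x = s ∨ x ∈ R) (heR : e ∉ R) (hsR : s ∉ R)
    (hes : s ≠ e) (hc : ∀ x, c x ≠ 0) (hβ : β ^ 2 = -(c e * c s)) {x y : X} (hx : x ∈ E)
    (hy : y ∈ E) : tensor R c e s β [x, y] = ind F (x = y) * c x := by
  classical
  have h0 : tensor R c e s β [x, y] = form (c e) (elt R c e s β x * elt R c e s β y) := by
    simp [tensor]
  rw [h0]
  have hce := hc e
  rcases (hE y).1 hy with rfl | rfl | hy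
  · rw [elt_left, mul_one]
    rcases (hE x).1 hx with rfl | rfl | hx
    · rw [elt_left, ind_pos rfl]; simp [form]
    · rw [ind_neg hes, elt, if_neg hes, if_pos rfl]; simp [form, hce]
    · rw [ind_neg (by rintro rfl; exact heR hx), elt, if_neg (by rintro rfl; exact heR hx),
        if_neg (by rintro rfl; exact hsR hx)]; simp [form]
  · rw [form_mul_elt_right hes hce]
    rcases (hE x).1 hx with rfl | rfl | hx
    · rw [elt_left, ind_neg hes.symm]; simp
    · rw [ind_pos rfl, elt, if_neg hes, if_pos rfl]
      have : -(β * (c e)⁻¹ * β) = -β ^ 2 * (c e)⁻¹ := by ring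
      rw [this, hβ]
      field_simp
    · rw [ind_neg (by rintro rfl; exact hsR hx), elt, if_neg (by rintro rfl; exact heR hx),
        if_neg (by rintro rfl; exact hsR hx)]; simp
  · have hye : y ≠ e := by rintro rfl; exact heR hy
    have hys : y ≠ s := by rintro rfl; exact hsR hy
    rw [form_mul_elt_vec hy hye hys]
    by_cases hxy : x = y
    · subst hxy
      rw [ind_pos rfl, elt, if_neg hye, if_neg hys]; simp
    · rw [ind_neg hxy, elt]
      split_ifs <;> simp [Ne.symm hxy]

theorem tensor_fuse (hE : ∀ x, x ∈ E ↔ x = e ∨ x = s ∨ x ∈ R) (heR : e ∉ R) (hsR : s ∉ R)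
    (hes : s ≠ e) (hc : ∀ x, c x ≠ 0) (hβ : β ^ 2 = -(c e * c s)) (l l' : List X) :
    ∑ p ∈ E, tensor R c e s β (l ++ [p]) * (c p)⁻¹ * tensor R c e s β (p :: l')
      = tensor R c e s β (l ++ l') := by
  classical
  have hE' : E = insert e (insert s R) := by
    ext x; simp [hE]
  have h1 : ∀ p, tensor R c e s β (l ++ [p])
      = form (c e) ((l.map (elt R c e s β)).prod * elt R c e s β p) := by simp [tensor]
  have h2 : ∀ p, tensor R c e s β (p :: l')
      = form (c e) ((l'.map (elt R c e s β)).prod * elt R c e s β p) := by simp [tensor, mul_comm]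
  have h3 : tensor R c e s β (l ++ l')
      = form (c e) ((l.map (elt R c e s β)).prod * (l'.map (elt R c e s β)).prod) :=
        by simp [tensor]
  simp_rw [h1, h2, h3]
  generalize (l.map (elt R c e s β)).prod = a
  generalize (l'.map (elt R c e s β)).prod = b
  have hce := hc e
  have hcs := hc s
  rw [hE', Finset.sum_insert (by simp [heR, hes.symm]), Finset.sum_insert hsR,
    Finset.sum_congr rfl fun r hr => show _ = a.vec r * b.vec r * c r by
      have hre : r ≠ e := by rintro rfl; exact heR hr
      have hrs : r ≠ s := by rintro rfl; exact hsR hr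
      have := hc r
      rw [form_mul_elt_vec hr hre hrs, form_mul_elt_vec hr hre hrs]
      field_simp,
    form_mul_elt_right hes hce, form_mul_elt_right hes hce, elt_left, mul_one, mul_one, form, form,
    form, mul_scal, mul_nil]
  have : -(β * (c e)⁻¹ * a.nil) * (c s)⁻¹ * -(β * (c e)⁻¹ * b.nil)
      = β ^ 2 * ((c e)⁻¹ ^ 2 * (c s)⁻¹ * a.nil * b.nil) := by ring
  rw [this, hβ]
  field_simp
  ring

theorem tensor_unit (l : List X) : tensor R c e s β (e :: l) = tensor R c e s β l := by
  simp [tensor, elt_left]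

theorem tensor_perm {l l' : List X} (h : l.Perm l') : tensor R c e s β l = tensor R c e s β l' := by
  rw [tensor, tensor, (h.map _).prod_eq]

end SectorAlgebra

/-! ### Labels with additional bosons -/

section Config

variable (p : ℕ)

/-- The labels are the configurations of particles of size `1`, of one kind, and of particles of
size `2`, of `p` kinds. -/
abbrev Config : Type := Option (ZMod p) → ℕ

variable {p}

namespace Config

/-- The configuration of `m` particles of size `1`. -/
def ones (m : ℕ) : Config p := Pi.single none m

theorem ones_none (m : ℕ) : (ones m : Config p) none = m := Pi.single_eq_same _ _

theorem ones_some (m : ℕ) (r : ZMod p) : (ones m : Config p) (some r) = 0 :=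
  Pi.single_eq_of_ne (by simp) _

theorem ones_add (m n : ℕ) : (ones (m + n) : Config p) = ones m + ones n := Pi.single_add _ _ _

theorem ones_zero : (ones 0 : Config p) = 0 := Pi.single_zero _

theorem ones_inj {m n : ℕ} (h : (ones m : Config p) = ones n) : m = n := by
  rw [← ones_none (p := p) m, h, ones_none]

variable [Fact p.Prime]

/-- The total size of the particles in a configuration. -/
def size (x : Config p) : ℕ := x none + 2 * ∑ r, x (some r)

theorem size_add (x y : Config p) : size (x + y) = size x + size y := by
  simp only [size, Pi.add_apply, Finset.sum_add_distrib]; ring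

theorem size_ones (m : ℕ) : size (ones m : Config p) = m := by
  simp [size, ones_none, ones_some]

theorem apply_le_size (x : Config p) (i : Option (ZMod p)) : x i ≤ size x := by
  cases i with
  | none => exact Nat.le_add_right _ _
  | some r =>
    have := Finset.single_le_sum (f := fun r => x (some r)) (fun _ _ => Nat.zero_le _)
      (Finset.mem_univ r)
    unfold size
    omega

theorem eq_ones_of_size {x : Config p} (h : size x = x none) : x = ones (size x) := by
  have h0 : ∑ r, x (some r) = 0 := by unfold size at h; omega
  funext i
  cases i with
  | none => rw [ones_none, h]
  | some r =>
    rw [ones_some]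
    exact (Finset.sum_eq_zero_iff.1 h0) r (Finset.mem_univ r)

theorem eq_ones_of_size_lt {x : Config p} (h : size x < 2) : x = ones (size x) :=
  eq_ones_of_size (by unfold size at *; omega)

theorem eq_zero_of_size {x : Config p} (h : size x = 0) : x = 0 := by
  rw [eq_ones_of_size_lt (x := x) (by omega), h, ones_zero]

theorem eq_ones_of_add {x y : Config p} (h : x + y = ones (size (x + y))) : x = ones (size x) := by
  have h1 := congrFun h none
  rw [ones_none, size_add, Pi.add_apply] at h1
  have h2 := apply_le_size x none
  have h3 := apply_le_size y none
  exact eq_ones_of_size (by omega)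

variable (p) in
/-- The configurations of size at most `n`. -/
def upTo (n : ℕ) : Finset (Config p) :=
  {x ∈ Fintype.piFinset fun _ => Finset.range (n + 1) | size x ≤ n}

theorem mem_upTo {n : ℕ} {x : Config p} : x ∈ upTo p n ↔ size x ≤ n := by
  rw [upTo, Finset.mem_filter, and_iff_right_iff_imp]
  intro h
  rw [Fintype.mem_piFinset]
  intro i
  have := apply_le_size x i
  rw [Finset.mem_range]
  omega

/-- The cyclic permutation of the kinds of particles of size `2`. -/
def rotate (x : Config p) : Config p
  | none => x none
  | some r => x (some (r + 1))

theorem size_rotate (x : Config p) : size (rotate x) = size x := by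
  change x none + 2 * ∑ r, x (some (r + 1)) = _
  rw [Fintype.sum_equiv (Equiv.addRight (1 : ZMod p)) (fun r => x (some (r + 1)))
    (fun r => x (some r)) fun _ => rfl]
  rfl

theorem rotate_iterate_some (x : Config p) (n : ℕ) (r : ZMod p) :
    (rotate^[n] x) (some r) = x (some (r + n)) := by
  induction n generalizing x with
  | zero => simp
  | succ n ih =>
    rw [Function.iterate_succ_apply, ih]
    change x (some (r + n + 1)) = _
    push_cast
    rw [add_assoc]

theorem rotate_iterate_none (x : Config p) (n : ℕ) : (rotate^[n] x) none = x none := by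
  induction n generalizing x with
  | zero => rfl
  | succ n ih => rw [Function.iterate_succ_apply, ih]; rfl

theorem eq_ones_of_rotate {x : Config p} (h : rotate x = x) (hx : size x < p) :
    x = ones (size x) := by
  refine eq_ones_of_size ?_
  have h1 : ∀ r, x (some r) = x (some 0) := by
    intro r
    have := rotate_iterate_some x r.val 0
    rwa [Function.iterate_fixed h, ZMod.natCast_zmod_val, zero_add, eq_comm] at this
  have h2 : size x = x none + 2 * (p * x (some 0)) := by
    unfold size
    rw [Finset.sum_congr rfl fun r _ => h1 r]
    simp [ZMod.card]
  rcases Nat.eq_zero_or_pos (x (some 0)) with h0 | h0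
  · rw [h2, h0]; simp
  · have := Nat.le_mul_of_pos_right p h0
    omega

/-- Since `p` is prime, the number of configurations of size `m < p` is `1` modulo `p`. -/
theorem card_sector {m n : ℕ} (hm : m ≤ n) (hp : m < p) :
    {x ∈ upTo p n | size x = m}.card ≡ 1 [MOD p] := by
  classical
  let f : Function.End {x // x ∈ {x ∈ upTo p n | size x = m}} := fun x => ⟨rotate x.1, by
    have := x.2
    simp only [Finset.mem_filter, mem_upTo, size_rotate] at this ⊢
    exact this⟩
  have hf : ∀ (k : ℕ) x, ((f ^ k : Function.End _) x).1 = rotate^[k] x.1 := by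
    intro k
    induction k with
    | zero => exact fun _ => rfl
    | succ k ih =>
      intro x
      rw [pow_succ, Function.iterate_succ_apply]
      exact ih (f x)
  have hfp : f ^ p ^ 1 = 1 := by
    funext x
    apply Subtype.ext
    rw [pow_one, hf]
    funext i
    cases i with
    | none => exact rotate_iterate_none _ _
    | some r => rw [rotate_iterate_some, CharP.cast_eq_zero, add_zero]; rfl
  have := Equiv.Perm.card_fixedPoints_modEq hfp
  rw [Fintype.card_coe] at this
  have h1 : Fintype.card (Function.fixedPoints f) = 1 := by
    have hmem : (ones m : Config p) ∈ {x ∈ upTo p n | size x = m} := by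
      simp [mem_upTo, size_ones, hm]
    have hfix : ∀ x : {x // x ∈ {x ∈ upTo p n | size x = m}}, f x = x → x.1 = ones m := by
      intro x hx
      have hs := (Finset.mem_filter.1 x.2).2
      rw [eq_ones_of_rotate (congrArg Subtype.val hx) (by omega), hs]
    refine Fintype.card_eq_one_iff.2 ⟨⟨⟨ones m, hmem⟩, Subtype.ext ?_⟩, fun x =>
      Subtype.ext (Subtype.ext (hfix x.1 x.2))⟩
    change rotate (ones m) = ones m
    funext i
    cases i with
    | none => rfl
    | some r => exact (ones_some _ _).trans (ones_some _ _).symm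
  rw [h1] at this
  exact this

/-- A configuration of size `m` with one particle of size `2`. -/
def side (m : ℕ) : Config p := ones (m - 2) + Pi.single (some 0) 1

theorem size_side {m : ℕ} (h : 2 ≤ m) : size (side m : Config p) = m := by
  rw [side, size_add, size_ones]
  have : size (Pi.single (some 0) 1 : Config p) = 2 := by
    unfold size
    rw [Finset.sum_eq_single_of_mem 0 (Finset.mem_univ _)]
    · simp
    · intro r _ hr
      exact Pi.single_eq_of_ne (by simpa using hr) _
  omega

theorem side_ne_ones (m n : ℕ) : (side m : Config p) ≠ ones n := by
  intro h
  have := congrFun h (some 0)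
  rw [side, Pi.add_apply, ones_some, ones_some, Pi.single_eq_same] at this
  omega

end Config

end Config

/-! ### The interpretation by configurations, in positive characteristic -/

section Bosonic

open Config

variable (p : ℕ) (F : Type) [Field F]

/-- The factorial in characteristic `p`, with the value `1` when it would vanish. -/
def facMod (n : ℕ) : F := if n < p then (n.factorial : F) else 1

theorem facMod_of_lt {p : ℕ} {F : Type} [Field F] {n : ℕ} (h : n < p) :
    facMod p F n = n.factorial := if_pos h

variable [Fact p.Prime]

/-- The product of the factorials of the numbers of particles of each kind. -/
def weight (x : Config p) : F := ∏ i, facMod p F (x i)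

variable {p F}

theorem facMod_ne_zero [CharP F p] (n : ℕ) : facMod p F n ≠ 0 := by
  rw [facMod]
  split_ifs with h
  · rw [Ne, CharP.cast_eq_zero_iff F p, (Fact.out : p.Prime).dvd_factorial]
    exact not_le.2 h
  · exact one_ne_zero

theorem weight_ne_zero [CharP F p] (x : Config p) : weight p F x ≠ 0 :=
  Finset.prod_ne_zero_iff.2 fun i _ => facMod_ne_zero (x i)

theorem weight_ones {m : ℕ} (h : m < p) : weight p F (ones m) = m.factorial := by
  rw [weight, Fintype.prod_option, ones_none, facMod_of_lt h]
  have : 0 < p := (Fact.out : p.Prime).pos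
  simp [ones_some, facMod_of_lt this]

theorem weight_zero : weight p F 0 = 1 := by
  rw [← ones_zero, weight_ones (Fact.out : p.Prime).pos]
  simp

variable (p F) in
/-- The Frobenius algebra of the configurations of size `m`: its unit is the configuration of
particles of size `1`, and `side m` is the second special basis vector. -/
def sectorTensor [IsAlgClosed F] (m : ℕ) (l : List (Config p)) : F :=
  if m < 2 then (weight p F (ones m))⁻¹
  else SectorAlgebra.tensor ((({x ∈ upTo p m | size x = m}).erase (ones m)).erase (side m))
    (fun x => (weight p F x)⁻¹) (ones m) (side m)
    (IsAlgClosed.exists_pow_nat_eq (-((weight p F (ones m))⁻¹ * (weight p F (side m))⁻¹))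
      two_pos).choose l

variable (p F) in
/-- The interpretation in which the labels of a wire of capacity `a` are the configurations of size
at most `a`; the sectors consist of the configurations of the same size. -/
def bosonic [IsAlgClosed F] [CharP F p] (φ : ℂ → F) : Interp F (Config p) where
  S a := upTo p a
  g _ := weight p F
  gi _ x := (weight p F x)⁻¹
  Q _ := True
  π x := ones (size x)
  ρ k r := φ r ^ size k
  T _ k := sectorTensor p F (size k)
  one _ := ones 1
  sc := φ
  g_mul_gi _ x := mul_inv_cancel₀ (weight_ne_zero x)
  T_perm _ k l l' h := by
    rw [sectorTensor, sectorTensor]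
    split_ifs
    · rfl
    · exact SectorAlgebra.tensor_perm h

variable [IsAlgClosed F] [CharP F p] {φ : ℂ → F}

theorem mem_bosonic {a : ℕ+} {x : Config p} : x ∈ (bosonic p F φ).S a ↔ size x ≤ a := mem_upTo

theorem bosonic_pi (x : Config p) : (bosonic p F φ).π x = ones (size x) := rfl

theorem bosonic_graded : (bosonic p F φ).Graded where
  zero_mem a := by rw [mem_bosonic, ← ones_zero, size_ones]; exact Nat.zero_le _
  add_mem {a b c x y} hx hy h := by
    rw [mem_bosonic] at *
    have : (a : ℕ) + b ≤ c := by exact_mod_cast h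
    rw [size_add]
    omega
  mem_of_add_mem h := by rw [mem_bosonic, size_add] at *; omega
  eq_zero_of_add {x y} h := eq_zero_of_size <| by
    have := congrArg size h
    rw [size_add, ← ones_zero, size_ones] at this
    omega
  mono {a b} h x hx := by
    rw [mem_bosonic] at *
    have : (a : ℕ) ≤ b := by exact_mod_cast h
    omega
  π_π x := by rw [bosonic_pi, bosonic_pi, size_ones]
  π_add x y := by rw [bosonic_pi, bosonic_pi, bosonic_pi, size_add, ones_add]
  π_mem := by intro a x; rw [bosonic_pi, mem_bosonic, mem_bosonic, size_ones]
  pure_of_add h := (eq_ones_of_add h.symm).symm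
  eq_zero_of_π h := eq_zero_of_size (ones_inj (p := p) (h.trans ones_zero.symm))

theorem bosonic_fused (a : ℕ+) : (bosonic p F φ).Fused a := by
  classical
  have hwi : ∀ x, (weight p F x)⁻¹ ≠ 0 := fun x => inv_ne_zero (weight_ne_zero x)
  have hbig : ∀ k ∈ (bosonic p F φ).S a, (bosonic p F φ).π k = k → ¬size k < 2 →
      ∃ R β, (bosonic p F φ).T a k = SectorAlgebra.tensor R (fun x => (weight p F x)⁻¹) k
        (side (size k)) β ∧ k ∉ R ∧ side (size k) ∉ R ∧ side (size k) ≠ k ∧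
        β ^ 2 = -((weight p F k)⁻¹ * (weight p F (side (size k)))⁻¹) ∧
        ∀ x, x ∈ {x ∈ (bosonic p F φ).S a | (bosonic p F φ).π x = k} ↔
          x = k ∨ x = side (size k) ∨ x ∈ R := by
    intro k hk hk' h2
    rw [bosonic_pi] at hk'
    refine ⟨(({x ∈ upTo p (size k) | size x = size k}).erase (ones (size k))).erase (side (size k)),
      _, funext fun l => (if_neg h2).trans (congrArg (fun e => SectorAlgebra.tensor _ _ e _ _ l)
        hk'),
      by simp [hk'], by simp, ?_, ?_, fun x => ?_⟩
    · intro h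
      exact side_ne_ones _ _ (h.trans hk'.symm)
    · exact (IsAlgClosed.exists_pow_nat_eq _ two_pos).choose_spec.trans (by rw [hk'])
    · rw [mem_bosonic] at hk
      rw [Finset.mem_filter, mem_bosonic, bosonic_pi, Finset.mem_erase, Finset.mem_erase,
        Finset.mem_filter, mem_upTo, hk']
      have e : ones (size x) = k ↔ size x = size k := by
        rw [← hk', size_ones]
        exact ⟨ones_inj, fun h => by rw [h]⟩
      rw [e]
      constructor
      · intro h
        by_cases h3 : x = k
        · exact .inl h3
        by_cases h4 : x = side (size k)
        · exact .inr (.inl h4)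
        · exact .inr (.inr ⟨h4, h3, h.2.le, h.2⟩)
      · rintro (rfl | rfl | h)
        · exact ⟨hk, rfl⟩
        · rw [size_side (by omega)]
          exact ⟨hk, rfl⟩
        · exact ⟨by omega, h.2.2.2⟩
  have hsmall : ∀ k x : Config p, size k < 2 → (bosonic p F φ).π k = k → (bosonic p F φ).π x = k →
      x = k := by
    intro k x h2 hk hx
    rw [bosonic_pi] at hk hx
    rw [← hx]
    refine eq_ones_of_size_lt ?_
    rw [← hx, size_ones] at h2
    exact h2
  have hT : ∀ k l, size k < 2 → (bosonic p F φ).π k = k →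
      (bosonic p F φ).T a k l = (weight p F k)⁻¹ := by
    intro k l h2 hk
    refine (if_pos h2).trans ?_
    rw [bosonic_pi] at hk
    rw [hk]
  refine ⟨fun k hk hk' l l' hl hl' => ?_, fun k hk hk' l hl => ?_,
    fun k hk hk' x hx hx' y hy hy' => ?_⟩
  · by_cases h2 : size k < 2
    · refine (Finset.sum_eq_single_of_mem k ?_ ?_).trans ?_
      · simp only [Finset.mem_filter]
        exact ⟨hk, hk'⟩
      · intro x hx hxk
        simp only [Finset.mem_filter] at hx
        exact absurd (hsmall k x h2 hk' hx.2) hxk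
      · rw [hT _ _ h2 hk', hT _ _ h2 hk', hT _ _ h2 hk']
        change _ * weight p F k * _ = _
        rw [inv_mul_cancel₀ (weight_ne_zero k), one_mul]
    · obtain ⟨R, β, hTk, hkR, hsR, hsk, hβ, hE⟩ := hbig k hk hk' h2
      rw [hTk]
      refine Eq.trans ?_ (SectorAlgebra.tensor_fuse hE hkR hsR hsk hwi hβ l l')
      refine Finset.sum_congr (by congr) fun x _ => ?_
      change _ * weight p F x * _ = _
      rw [inv_inv]
  · by_cases h2 : size k < 2
    · rw [hT _ _ h2 hk', hT _ _ h2 hk']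
    · obtain ⟨R, β, hTk, -⟩ := hbig k hk hk' h2
      rw [hTk, SectorAlgebra.tensor_unit]
  · by_cases h2 : size k < 2
    · rw [hT _ _ h2 hk', hsmall k x h2 hk' hx', hsmall k y h2 hk' hy', ind_pos rfl, one_mul]
      rfl
    · obtain ⟨R, β, hTk, hkR, hsR, hsk, hβ, hE⟩ := hbig k hk hk' h2
      rw [hTk]
      exact SectorAlgebra.tensor_pair hE hkR hsR hsk hwi hβ (Finset.mem_filter.2 ⟨hx, hx'⟩)
        (Finset.mem_filter.2 ⟨hy, hy'⟩)

end Bosonic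

open Config

section Bosonic

variable {p : ℕ} [Fact p.Prime] {F : Type} [Field F] [CharP F p]

theorem ind_eq_prod {κ α : Type} [Fintype κ] (x y : κ → α) :
    ind F (x = y) = ∏ i, ind F (x i = y i) := by
  by_cases h : x = y
  · rw [ind_pos h, Finset.prod_eq_one fun i _ => ind_pos (congrFun h i)]
  · obtain ⟨i, hi⟩ := Function.ne_iff.1 h
    rw [ind_neg h, Finset.prod_eq_zero (Finset.mem_univ i) (ind_neg hi)]

theorem sum_quadruple_prod {κ : Type} [Fintype κ] [DecidableEq κ] (S : Finset ℕ)
    (q : κ → ℕ → ℕ → ℕ → ℕ → F) :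
    ∑ u ∈ Fintype.piFinset fun _ : κ => S, ∑ v ∈ Fintype.piFinset fun _ : κ => S,
      ∑ u' ∈ Fintype.piFinset fun _ : κ => S, ∑ v' ∈ Fintype.piFinset fun _ : κ => S,
        ∏ i, q i (u i) (v i) (u' i) (v' i)
      = ∏ i, ∑ k ∈ S, ∑ l ∈ S, ∑ k' ∈ S, ∑ l' ∈ S, q i k l k' l' := by
  rw [← Finset.sum_prod_piFinset S fun i k => ∑ l ∈ S, ∑ k' ∈ S, ∑ l' ∈ S, q i k l k' l']
  refine Finset.sum_congr rfl fun u _ => ?_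
  rw [← Finset.sum_prod_piFinset S fun i l => ∑ k' ∈ S, ∑ l' ∈ S, q i (u i) l k' l']
  refine Finset.sum_congr rfl fun v _ => ?_
  rw [← Finset.sum_prod_piFinset S fun i k' => ∑ l' ∈ S, q i (u i) (v i) k' l']
  refine Finset.sum_congr rfl fun u' _ => ?_
  exact Finset.sum_prod_piFinset S fun i l' => q i (u i) (v i) (u' i) l'

/-- The square identity for configurations is the product of those for the numbers of particles of
each kind. -/
theorem squareIdentity_weight {c : ℕ} (hc : c < p) :
    SquareIdentity (upTo p c) (weight p F) fun x => (weight p F x)⁻¹ := by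
  classical
  intro x x' z z' h hx
  rw [mem_upTo] at hx
  set D : Finset (Config p) := Fintype.piFinset fun _ => Finset.range (c + 1) with hD
  have hsub : upTo p c ⊆ D := Finset.filter_subset _ _
  have hsize : size z + size z' = size (x + x') := by rw [h, size_add]
  rw [size_add] at hx hsize
  have hgrow : ∀ w y : Config p, ∀ s : Config p, w + y = s → size s ≤ c →
      w ∈ upTo p c ∧ y ∈ upTo p c := by
    intro w y s hs hsc
    rw [← hs, size_add] at hsc
    rw [mem_upTo, mem_upTo]
    omega
  set f : Config p → Config p → Config p → Config p → F := fun u v u' v' =>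
    ind F (u + v = z) * (ind F (u' + v' = z') * (ind F (u + u' = x) * (ind F (v + v' = x') *
      ((weight p F u)⁻¹ * (weight p F v)⁻¹ * (weight p F u')⁻¹ * (weight p F v')⁻¹)))) with hf
  have hf0 : ∀ u v u' v', f u v u' v' ≠ 0 →
      u ∈ upTo p c ∧ v ∈ upTo p c ∧ u' ∈ upTo p c ∧ v' ∈ upTo p c := by
    intro u v u' v' hne
    have h1 : u + v = z := by
      by_contra h1
      exact hne (by simp only [hf]; rw [ind_neg h1, zero_mul])
    have h2 : u' + v' = z' := by
      by_contra h2
      exact hne (by simp only [hf]; rw [ind_neg (p := u' + v' = z') h2, zero_mul, mul_zero])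
    obtain ⟨h3, h4⟩ := hgrow u v z h1 (by omega)
    obtain ⟨h5, h6⟩ := hgrow u' v' z' h2 (by omega)
    exact ⟨h3, h4, h5, h6⟩
  have hext : ∀ g : Config p → F, (∀ w, w ∉ upTo p c → g w = 0) →
      ∑ w ∈ upTo p c, g w = ∑ w ∈ D, g w :=
    fun g hg => Finset.sum_subset hsub fun w _ hw => hg w hw
  have e1 : ∑ u ∈ upTo p c, ∑ v ∈ upTo p c, ∑ u' ∈ upTo p c, ∑ v' ∈ upTo p c, f u v u' v'
      = ∑ u ∈ D, ∑ v ∈ D, ∑ u' ∈ D, ∑ v' ∈ D, f u v u' v' := by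
    rw [hext]
    · refine Finset.sum_congr rfl fun u _ => ?_
      rw [hext]
      · refine Finset.sum_congr rfl fun v _ => ?_
        rw [hext]
        · refine Finset.sum_congr rfl fun u' _ => hext _ fun v' hv' => ?_
          by_contra hne
          exact hv' (hf0 _ _ _ _ hne).2.2.2
        · refine fun u' hu' => Finset.sum_eq_zero fun v' _ => ?_
          by_contra hne
          exact hu' (hf0 _ _ _ _ hne).2.2.1
      · refine fun v hv => Finset.sum_eq_zero fun u' _ => Finset.sum_eq_zero fun v' _ => ?_
        by_contra hne
        exact hv (hf0 _ _ _ _ hne).2.1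
    · refine fun u hu => Finset.sum_eq_zero fun v _ => Finset.sum_eq_zero fun u' _ =>
        Finset.sum_eq_zero fun v' _ => ?_
      by_contra hne
      exact hu (hf0 _ _ _ _ hne).1
  refine e1.trans ?_
  let q : Option (ZMod p) → ℕ → ℕ → ℕ → ℕ → F := fun i k l k' l' =>
    ind F (k + l = z i) * (ind F (k' + l' = z' i) * (ind F (k + k' = x i) * (ind F (l + l' = x' i) *
      ((facMod p F k)⁻¹ * (facMod p F l)⁻¹ * (facMod p F k')⁻¹ * (facMod p F l')⁻¹))))
  have e2 : ∀ u v u' v', f u v u' v' = ∏ i, q i (u i) (v i) (u' i) (v' i) := by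
    intro u v u' v'
    simp only [hf, q, ind_eq_prod, weight, Finset.prod_mul_distrib, Finset.prod_inv_distrib,
      Pi.add_apply]
  simp_rw [e2]
  refine (sum_quadruple_prod _ q).trans ?_
  simp only [weight, ← Finset.prod_inv_distrib, ← Finset.prod_mul_distrib]
  refine Finset.prod_congr rfl fun i _ => ?_
  have hi : x i + x' i ≤ c := by
    have h1 := apply_le_size x i
    have h2 := apply_le_size x' i
    omega
  refine squareIdentity_nat (fun k => facMod_ne_zero k) one_ne_zero (c := c) (fun k hk => ?_)
    (congrFun h i) hi fun u hu => Finset.mem_range.2 (by omega)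
  rw [facMod_of_lt (by omega), one_pow, mul_one]

variable [IsAlgClosed F] {φ : ℂ → F}

theorem bosonic_one (a : ℕ+) : (bosonic p F φ).one a = ones 1 := rfl

theorem bosonic_card {a : ℕ+} (ha : (a : ℕ) < p) {w : Config p} (hw : w ∈ (bosonic p F φ).S a)
    (hw' : (bosonic p F φ).π w = w) (_ : DecidablePred fun q => (bosonic p F φ).π q = w) :
    (({q ∈ (bosonic p F φ).S a | (bosonic p F φ).π q = w}.card : ℕ) : F) = 1 := by
  rw [mem_bosonic] at hw
  have e : {q ∈ (bosonic p F φ).S a | (bosonic p F φ).π q = w} =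
      {x ∈ upTo p a | size x = size w} := by
    refine Finset.filter_congr fun x _ => ?_
    rw [bosonic_pi] at hw' ⊢
    rw [← hw', size_ones]
    exact ⟨ones_inj, fun h => by rw [h]⟩
  have := (CharP.natCast_eq_natCast F p).2 (card_sector (p := p) hw (by omega))
  rw [Nat.cast_one] at this
  rw [← this, e]

theorem bosonic_eqv_plus {a : ℕ+} (ha : (a : ℕ) < p) {r t : ℂ} (hφ : φ (r + t) = φ r + φ t) (h) :
    (bosonic p F φ).Eqv (comp (.W a [a, a] h) (Diagram.tensor (.Z a r 1 0) (.Z a t 1 0)) rfl)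
      (.Z a (r + t) 1 0) := by
  classical
  refine eqv_plus bosonic_graded (bosonic_fused a) (fun k hk hk' => ?_) h
  rw [mem_bosonic] at hk
  rw [bosonic_pi] at hk'
  obtain ⟨m, rfl⟩ : ∃ m, k = ones m := ⟨_, hk'.symm⟩
  clear hk'
  rw [size_ones] at hk
  have e : ∀ x y : Config p, ind F (x + y = ones m) * (weight p F (ones m) * (weight p F x)⁻¹ *
      (weight p F y)⁻¹ * φ r ^ size x * φ t ^ size y) * ind F (True ∨ ones m = (0 : Config p))
      = ind F (x + y = ones m) * (φ r ^ size x * φ t ^ size y * (m.choose (size x) : F)) := by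
    intro x y
    rw [ind_pos (p := True ∨ _) (.inl trivial), mul_one]
    refine ind_mul_congr fun hxy => ?_
    have hs : size x + size y = m := by rw [← size_add, hxy, size_ones]
    have hx := eq_ones_of_add (x := x) (y := y) (by rw [hxy, size_ones])
    have hy := eq_ones_of_add (x := y) (y := x) (by rw [add_comm, hxy, size_ones])
    have h1 := weight_ne_zero (F := F) x
    have h2 := weight_ne_zero (F := F) y
    rw [hx, weight_ones (by omega)] at h1
    rw [hy, weight_ones (by omega)] at h2
    have h3 : (m.choose (size x) : F) * (size x).factorial * (size y).factorial = m.factorial := by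
      have := Nat.choose_mul_factorial_mul_factorial (Nat.le_add_right (size x) (size y))
      rw [Nat.add_sub_cancel_left, hs] at this
      exact_mod_cast congrArg (Nat.cast (R := F)) this
    rw [show weight p F x = (size x).factorial by rw [hx, weight_ones (by omega), size_ones],
      show weight p F y = (size y).factorial by rw [hy, weight_ones (by omega), size_ones],
      weight_ones (by omega), ← h3]
    field_simp
  refine (Finset.sum_congr rfl fun x _ => Finset.sum_congr rfl fun y _ => e x y).trans ?_
  change _ = φ (r + t) ^ size (ones m : Config p)
  rw [size_ones, hφ, (Commute.all (φ r) (φ t)).add_pow', ← Finset.sum_product']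
  simp only [ind, ite_mul, one_mul, zero_mul]
  rw [← Finset.sum_filter]
  refine (Finset.sum_nbij' (fun xy => (size xy.1, size xy.2)) (fun ij => (ones ij.1, ones ij.2))
    ?_ ?_ ?_ ?_ ?_)
  · rintro ⟨x, y⟩ hxy
    have := (Finset.mem_filter.1 hxy).2
    rw [Finset.HasAntidiagonal.mem_antidiagonal]
    change size x + size y = m
    rw [← size_add, this, size_ones]
  · rintro ⟨i, j⟩ hij
    rw [Finset.HasAntidiagonal.mem_antidiagonal] at hij
    simp only at hij
    rw [Finset.mem_filter, Finset.mem_product, mem_bosonic, mem_bosonic, size_ones, size_ones]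
    refine ⟨⟨by omega, by omega⟩, ?_⟩
    change ones i + ones j = ones m
    rw [← ones_add, hij]
  · rintro ⟨x, y⟩ hxy
    have hxy := (Finset.mem_filter.1 hxy).2
    simp only at hxy
    rw [← eq_ones_of_add (x := x) (y := y) (by rw [hxy, size_ones]),
      ← eq_ones_of_add (x := y) (y := x) (by rw [add_comm, hxy, size_ones])]
  · rintro ⟨i, j⟩ _
    simp only [size_ones]
  · rintro ⟨x, y⟩ hxy
    rw [nsmul_eq_mul, mul_comm]

theorem bosonic_eqv_u {a : ℕ+} (ha : (a : ℕ) < p) (h1 : φ 1 = 1)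
    (hφ : φ (1 / (Nat.factorial a : ℂ)) ≠ 0) (hk) (h) :
    (bosonic p F φ).Eqv (.Z a 1 0 1) (Diagram.tensor (scalar (1 / (Nat.factorial a : ℂ)))
          (comp (comp (ket a.natPred a hk) (.W a [a, a] h) rfl)
            (Diagram.tensor (.id [a]) (comp (.Z a 1 1 2) (cup a) rfl)) rfl)) := by
  have hone : (a : ℕ) • (bosonic p F φ).one 1 = ones a := by
    rw [bosonic_one]
    induction (a : ℕ) with
    | zero => rw [zero_nsmul, ones_zero]
    | succ n ih => rw [succ_nsmul, ih, ones_add]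
  refine eqv_u bosonic_graded (bosonic_fused a) ?_ ?_ (.inl trivial)
    (fun w hw hw' => bosonic_card ha hw hw' _) ?_ hk h
  · rw [bosonic_one, mem_bosonic, size_ones, PNat.one_coe]
  · rw [bosonic_one, bosonic_pi, size_ones]
  refine ⟨(Units.mk0 _ (mul_ne_zero hφ (weight_ne_zero (ones a))))⁻¹, fun y hy => ?_⟩
  rw [hone]
  rw [mem_bosonic] at hy
  change ind F (ones (size y) = y) * φ 1 ^ size y
    = _ * (φ _ * weight p F (ones a) * ∑ w ∈ upTo p a, ind F (y + w = ones a) * φ 1 ^ size w)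
  simp_rw [h1, one_pow, mul_one]
  have e : ∑ w ∈ upTo p a, ind F (y + w = ones a) = ind F (ones (size y) = y) := by
    by_cases hp : ones (size y) = y
    · rw [Finset.sum_eq_single_of_mem (ones ((a : ℕ) - size y)), ind_pos hp, ind_pos]
      · rw [← hp, ← ones_add, size_ones]
        congr 1
        omega
      · rw [mem_upTo, size_ones]
        omega
      · intro w _ hw
        refine ind_neg fun hyw => hw ?_
        rw [eq_ones_of_add (x := w) (y := y) (by rw [add_comm, hyw, size_ones])]
        congr 1
        have := congrArg size hyw
        rw [size_add, size_ones] at this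
        omega
    · rw [ind_neg hp]
      exact Finset.sum_eq_zero fun w _ => ind_neg fun hyw =>
        hp (eq_ones_of_add (x := y) (y := w) (by rw [hyw, size_ones])).symm
  rw [e, ← mul_assoc]
  exact (one_mul _).symm.trans (congrArg (· * _) (Units.inv_mul (Units.mk0 _ _)).symm)

end Bosonic

/-! ### The schema separated by interpretations of large characteristic -/

/-- The interpretations attached to reductions of the complex numbers to positive characteristic. -/
def reduced (i : Reduction) : haveI := i.1.2
    Interp (AlgebraicClosure (ZMod i.1)) (Config i.1) :=
  haveI := i.1.2
  bosonic i.1 (AlgebraicClosure (ZMod i.1)) i.2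

theorem reduced_eqv {R : Rule} (hR : R ≠ .b1) {A B A' B' : List ℕ+} {f : Diagram A B}
    {g : Diagram A' B'} (h : Instance R f g) : ∀ᶠ i in Reduction.filter, (reduced i).Eqv f g := by
  classical
  cases h with
  | s a r t n m n' m' =>
    filter_upwards [Reduction.good_mem ({r, t}, 0)] with i hi
    have := i.1.2
    refine eqv_s bosonic_graded (bosonic_fused a) (fun k _ _ => ?_) n m n' m' _
    change i.2 (r * t) ^ size k = i.2 r ^ size k * i.2 t ^ size k
    rw [(hi.2.2.2 r (by simp) t (by simp)).1, mul_pow]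
  | a c b as ds ds' hc hb hcap hc' =>
    refine .of_forall fun i => ?_
    have := i.1.2
    exact eqv_a bosonic_graded (.inl fun _ => trivial) c b as ds ds' hc hb hcap hc'
  | o c b _ hbc hab hac =>
    filter_upwards [Reduction.good_mem (∅, 0)] with i hi
    have := i.1.2
    refine eqv_o bosonic_graded (fun _ _ => trivial) ?_ (fun n _ x _ => ?_) c b _ (bosonic_fused b)
      (fun a _ => bosonic_fused a) hbc hab hac _ _ _
    · change i.2 1 ^ _ = 1
      rw [hi.2.2.1, one_pow]
    · change i.2 1 ^ _ = 1
      rw [hi.2.2.1, one_pow]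
  | id a h =>
    refine .of_forall fun i => ?_
    have := i.1.2
    exact eqv_W_id trivial a h
  | b1 b r n hn _ h => exact absurd rfl hR
  | b2 c _ _ ha hb hcap =>
    filter_upwards [Reduction.good_mem (∅, c)] with i hi
    have := i.1.2
    exact eqv_b2 bosonic_graded (fun _ _ => rfl) (fun _ _ => rfl) weight_zero c
      (squareIdentity_weight hi.1) _ _ ha hb hcap _ _
  | plus a r t h =>
    filter_upwards [Reduction.good_mem ({r, t}, a)] with i hi
    have := i.1.2
    exact bosonic_eqv_plus hi.1 (hi.2.2.2 r (by simp) t (by simp)).2 h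
  | cp a r n =>
    refine .of_forall fun i => ?_
    have := i.1.2
    refine eqv_cp bosonic_graded (bosonic_fused a) ?_ (fun x => ?_) ⟨1, ?_⟩ n
    · rw [bosonic_one, mem_bosonic, size_ones]
      exact a.pos
    · rw [bosonic_one, bosonic_pi]
      constructor
      · intro h
        have := ones_inj h
        rw [eq_ones_of_size_lt (x := x) (by omega), this]
      · rintro rfl
        rw [size_ones]
    · rw [bosonic_one, Units.val_one, one_mul]
      change i.2 r ^ size (ones 1 : Config i.1) = i.2 r
      rw [size_ones, pow_one]
  | h a b n hn hab he =>
    filter_upwards [Reduction.good_mem (∅, 0)] with i hi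
    have := i.1.2
    refine eqv_h bosonic_graded (bosonic_fused a) (bosonic_fused b) n (fun k _ _ => ?_) ?_
      weight_zero weight_zero ?_ hab he
    · change i.2 0 ^ size k = _
      rw [hi.2.1]
      by_cases hk : size k = 0
      · rw [ind_pos (eq_zero_of_size hk), hk, pow_zero]
      · rw [zero_pow hk, ind_neg]
        rintro rfl
        rw [← ones_zero, size_ones] at hk
        exact hk rfl
    · change i.2 1 ^ _ = 1
      rw [hi.2.2.1, one_pow]
    · intro x _ hx y hy hyx hys
      refine .inl (eq_zero_of_size ?_)
      rw [mem_bosonic] at hys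
      have hl : y.length = n := by simpa using length_of_mem hy
      have hs : ∀ l : List (Config i.1), (∀ q ∈ l, size q = size x) →
          size l.sum = l.length * size x := by
        intro l
        induction l with
        | nil => intro _; rw [List.sum_nil, ← ones_zero, size_ones]; simp
        | cons q l ih =>
          intro hq
          rw [List.sum_cons, size_add, ih fun q' hq' => hq q' (by simp [hq']), hq q (by simp),
            List.length_cons]
          ring
      rw [hs y fun q hq => by
        have := congrArg size (hyx q hq)
        rwa [bosonic_pi, size_ones] at this, hl] at hys
      by_contra h0
      have := Nat.le_mul_of_pos_right n (Nat.pos_of_ne_zero h0)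
      omega
  | l n =>
    refine .of_forall fun i => ?_
    have := i.1.2
    have hx : ∀ x ∈ (reduced i).S 1, x = ones (size x) := fun x hx => by
      have := mem_bosonic.1 hx
      rw [PNat.one_coe] at this
      exact eq_ones_of_size_lt (by omega)
    refine eqv_l bosonic_graded (bosonic_fused 1) (fun x hx' => (hx x hx').symm) (fun x hx' => ?_) n
    have h1 := mem_bosonic.1 hx'
    rw [PNat.one_coe] at h1
    change weight _ _ x = 1
    rw [hx x hx', weight_ones (lt_of_le_of_lt h1 this.out.one_lt), Nat.factorial_eq_one.2 h1,
      Nat.cast_one]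
  | i a b h =>
    refine .of_forall fun i => ?_
    have := i.1.2
    refine eqv_i a b h ?_ rfl (.inl trivial)
    change (bosonic _ _ _).one b ∈ (bosonic _ _ _).S b
    rw [bosonic_one, mem_bosonic, size_ones]
    exact b.pos
  | u a hk h =>
    filter_upwards [Reduction.good_mem ({1 / (Nat.factorial a : ℂ), (Nat.factorial a : ℂ)}, a)]
      with i hi
    have := i.1.2
    refine bosonic_eqv_u hi.1 hi.2.2.1 (fun h0 => ?_) hk h
    have := (hi.2.2.2 (1 / (Nat.factorial a : ℂ)) (by simp) (Nat.factorial a : ℂ) (by simp)).1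
    rw [h0, zero_mul, one_div_mul_cancel (Nat.cast_ne_zero.2 (Nat.factorial_ne_zero _)),
      hi.2.2.1] at this
    exact one_ne_zero this

section Failure

variable {p : ℕ} [Fact p.Prime] {F : Type} [Field F] [IsAlgClosed F] [CharP F p] {φ : ℂ → F}

theorem side_two_mem : side 2 ∈ (bosonic p F φ).S 2 := mem_bosonic.2 (size_side le_rfl).le

theorem ones_one_mem (a : ℕ+) : ones 1 ∈ (bosonic p F φ).S a := by
  rw [mem_bosonic, size_ones]
  exact a.pos

/-- Two particles of size `2` of the same kind are merged by a Z-spider,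
  and the result is split into
two particles of size `1`. -/
theorem bosonic_eval_Z_W (hφ : φ 1 ≠ 0) (h) :
    (bosonic p F φ).eval (comp (.Z 2 1 2 1) (.W 2 [1, 1] h) rfl) [side 2, side 2] [ones 1, ones 1]
      ≠ 0 := by
  have h2 : (ones 2 : Config p) ∈ (bosonic p F φ).S 2 := mem_bosonic.2 (size_ones 2).le
  have hs : (bosonic p F φ).π (side 2) = ones 2 := by rw [bosonic_pi, size_side le_rfl]
  have h2' : (bosonic p F φ).π (ones 2) = ones 2 := by rw [bosonic_pi, size_ones]
  have hF := bosonic_fused (p := p) (F := F) (φ := φ) 2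
  rw [eval_comp]
  refine ne_of_eq_of_ne (Finset.sum_eq_single_of_mem [ones 2] (by simpa using h2) ?_) ?_
  · intro k hk hk2
    obtain ⟨k, -, rfl⟩ := mem_states_singleton.1 hk
    rw [eval_W, merge, ind_neg]
    · simp
    · rintro rfl
      exact hk2 (by simp [← ones_add])
  · have hw := fun x : Config p => weight_ne_zero (F := F) x
    rw [eval_Z, eval_W, Zt_perm _ 2 1 (l' := [ones 2, side 2, side 2]) (by
        exact List.perm_append_comm (l₁ := [side 2, side 2]) (l₂ := [ones 2])),
      bosonic_graded.Zt_cons 1 h2, h2', ind_pos (by simp [hs]),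
      hF.unit _ h2 h2' _ (by simp [side_two_mem, hs]),
      hF.pair _ h2 h2' _ side_two_mem hs _ side_two_mem hs, ind_pos rfl, one_mul, one_mul, merge,
      ind_pos (by simp [← ones_add]), ind_pos (.inl trivial), one_mul, one_mul, wti_cons, wti_cons,
      wti_nil, mul_one]
    change ([weight p F (side 2), weight p F (side 2)].prod *
      (φ 1 ^ size (ones 2 : Config p) * (weight p F (side 2))⁻¹)) *
      (weight p F (ones 2) * ((weight p F (ones 1))⁻¹ * (weight p F (ones 1))⁻¹)) ≠ 0
    simp [hw, hφ]

/-- A particle of size `2` cannot be split. -/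
theorem bosonic_eval_par_W (h) {u v : List (Config p)} (hu : u ∈ states (bosonic p F φ).S [1, 1]) :
    (bosonic p F φ).eval (par (fun _ => [2]) (fun _ => [1, 1]) (fun _ => .W 2 [1,
      1] h) (List.range 2))
      [side 2, side 2] (u ++ v) = 0 := by
  refine (eval_tensor _ (.W 2 [1, 1] h) _ (x := [side 2]) (x' := [side 2]) rfl
    (length_of_mem hu)).trans ?_
  rw [eval_W, merge, ind_neg]
  · simp
  · obtain ⟨x, hx, y, hy, rfl⟩ := mem_states_pair.1 hu
    rw [mem_bosonic, PNat.one_coe] at hx hy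
    rw [eq_ones_of_size_lt (x := x) (by omega), eq_ones_of_size_lt (x := y) (by omega)]
    intro hxy
    refine side_ne_ones 2 (size x + size y) (hxy.symm.trans ?_)
    simp [ones_add]

end Failure

/-- In large positive characteristic, two particles of the same kind can be merged before they are
split, but they can not be split before they are merged. -/
theorem independent_b1 : ∃ (A B A' B' : List ℕ+) (D₁ : Diagram A B) (D₂ : Diagram A' B'),
    Instance .b1 D₁ D₂ ∧ ¬Derivable {R' | R' ≠ .b1} D₁ D₂ := by
  refine ⟨_, _, _, _, _, _, Instance.b1 2 1 2 two_ne_zero [1, 1] (by simp), fun hd => ?_⟩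
  have hev := eventually_eqv_of_derivable
    (K := fun i : Reduction => (haveI := i.1.2; AlgebraicClosure (ZMod i.1))) reduced
      Reduction.filter (fun R hR _ _ _ _ _ _ h => reduced_eqv hR h) hd
  obtain ⟨i, ⟨-, -, c, hc⟩, hi⟩ := (hev.and (Reduction.good_mem (∅, 2))).exists
  have := i.1.2
  have hs : side 2 ∈ (reduced i).S 2 := side_two_mem
  have ho : ones 1 ∈ (reduced i).S 1 := ones_one_mem 1
  have h1 := hc [side 2, side 2] (mem_states_pair.2 ⟨_, hs, _, hs, rfl⟩) [ones 1, ones 1]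
    (mem_states_pair.2 ⟨_, ho, _, ho, rfl⟩)
  refine bosonic_eval_Z_W (by rw [hi.2.2.1]; exact one_ne_zero) _ (h1.trans ?_)
  rw [eval_comp_transpose]
  refine mul_eq_zero_of_right _ (Finset.sum_eq_zero fun ms hms => mul_eq_zero_of_left ?_ _)
  obtain ⟨m, hm, ms, -, rfl⟩ := mem_states_cons.1 hms
  exact bosonic_eval_par_W _ hm

end

end ZWf

theorem mainTheorem4 :
    ∀ R : ZWf.Rule, ∃ (A B A' B' : List ℕ+) (D₁ : ZWf.Diagram A B) (D₂ : ZWf.Diagram A' B'),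
      ZWf.Instance R D₁ D₂ ∧ ¬ ZWf.Derivable {R' : ZWf.Rule | R' ≠ R} D₁ D₂ := by
  intro R
  cases R
  exacts [ZWf.independent_s, ZWf.independent_a, ZWf.independent_o, ZWf.independent_id,
    ZWf.independent_b1, ZWf.independent_b2, ZWf.independent_plus, ZWf.independent_cp,
    ZWf.independent_h, ZWf.independent_l, ZWf.independent_i, ZWf.independent_u]
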